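/- A collection of subsets of the Euclidean plane (the tiles) is a tiling if its union is the whole plane and the interiors of different tiles are disjoint. A tiling is monohedral if any two of its tiles are congruent (mirror images allowed), and periodic if it coincides with its translate by some nonzero vector. A convex hexagon is the convex hull of six points, none of which lies in the convex hull of the other five; these points are its corners. A tiling by convex polygons is edge-to-edge if any two different tiles either are disjoint, or have exactly one point in common, which is a corner of both, or intersect exactly in an entire side of both. A vertex of the tiling is a point at which corners of two or more tiles meet, and its valence is the number of tiles that contain it. Corollary 1. Every monohedral periodic tiling of the plane whose tiles are convex hexagons is edge-to-edge, and all of its vertices have valence $3$. -/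

import Mathlib

/-- The Euclidean plane. -/
abbrev Plane : Type := EuclideanSpace ℝ (Fin 2)

/-- `P` is a (closed) convex `n`-gon: the convex hull of `n ≥ 3` points, none of which lies in the
convex hull of the others. So `P` has exactly `n` corners, all angles being less than `π`. -/
def IsConvexPolygon (n : ℕ) (P : Set Plane) : Prop :=
  3 ≤ n ∧ ∃ A : Fin n → Plane, ConvexIndependent ℝ A ∧ P = convexHull ℝ (Set.range A)

/-- `p` is a corner of the convex polygon `P`, i.e. an extreme point of it. -/
def IsCornerOf (P : Set Plane) (p : Plane) : Prop :=
  p ∈ Set.extremePoints ℝ P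

/-- `s` is a side of the convex polygon `P`: a segment that joins two different corners
and runs in the boundary of `P`. -/
def IsSideOf (P : Set Plane) (s : Set Plane) : Prop :=
  ∃ a b : Plane, IsCornerOf P a ∧ IsCornerOf P b ∧ a ≠ b ∧ s = segment ℝ a b ∧ s ⊆ frontier P

/-- A collection of sets is a tiling of the plane if the sets cover the plane and
different ones have disjoint interiors. -/
def IsTiling (𝒯 : Set (Set Plane)) : Prop :=
  ⋃₀ 𝒯 = Set.univ ∧
    ∀ T ∈ 𝒯, ∀ T' ∈ 𝒯, T ≠ T' → Disjoint (interior T) (interior T')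

/-- All tiles have the same size and shape: any two are congruent (reflections allowed). -/
def IsMonohedral (𝒯 : Set (Set Plane)) : Prop :=
  ∀ T ∈ 𝒯, ∀ T' ∈ 𝒯, ∃ e : Plane ≃ᵢ Plane, e '' T = T'

/-- The collection coincides with its translate by some nonzero vector. -/
def IsPeriodic (𝒯 : Set (Set Plane)) : Prop :=
  ∃ v : Plane, v ≠ 0 ∧ (fun T : Set Plane => (fun x : Plane => v + x) '' T) '' 𝒯 = 𝒯

/-- Any two different tiles are disjoint, or their intersection is exactly a common corner,
or their intersection is exactly an entire side of both. -/
def IsEdgeToEdge (𝒯 : Set (Set Plane)) : Prop :=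
  ∀ T ∈ 𝒯, ∀ T' ∈ 𝒯, T ≠ T' →
    T ∩ T' = ∅ ∨
    (∃ p : Plane, IsCornerOf T p ∧ IsCornerOf T' p ∧ T ∩ T' = {p}) ∨
    (∃ s : Set Plane, IsSideOf T s ∧ IsSideOf T' s ∧ T ∩ T' = s)

/-- `p` is a vertex of the tiling by polygons: corners of two or more tiles meet at `p`. -/
def IsVertex (𝒯 : Set (Set Plane)) (p : Plane) : Prop :=
  ∃ T ∈ 𝒯, ∃ T' ∈ 𝒯, T ≠ T' ∧ IsCornerOf T p ∧ IsCornerOf T' p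

/-- The valence of `p`: the number of tiles that meet at `p` (whether `p` is a corner of the tile
or a point inside one of its sides). -/
noncomputable def valence (𝒯 : Set (Set Plane)) (p : Plane) : ℕ∞ :=
  {T : Set Plane | T ∈ 𝒯 ∧ p ∈ T}.encard

/-! Congruence is needed only for a common bound on the diameters and a common radius of inscribed
discs. These make the tiling locally finite and bound the number of corners, modulo the period `v`,
in a band of given width parallel to `v`. The argument then runs on the cylinder obtained by
dividing the plane by the multiples of `v`, with height measured across `v`.

In every hexagon the lowest and the highest corner get weight -2 and the other four get 1, so the
total is 0. Around a corner `p` there are at least three tiles. At most two of them reach both above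
and below `p`, and a tile that has `p` inside a side is one of these. Hence the weights at `p` add
up to at most 0, and to 0 only if exactly three tiles contain `p`, all with a corner there
(`sum_weight`). The flux at height `b` is the sum of the weights of all corners below `b` of the
tiles that cross this height, that is, the number of these corners minus three times the number of
these tiles. Going up, it changes by the weights passed, so it never increases (`flux_le_sub`). As
an integer bounded from below it is finally constant, so above some height all vertices are regular.

The heart is that the flux is not negative there (`flux_nonneg_of_regularAbove`). Take the tiles
that reach above a very high level and add layer after layer of neighbours. By a discrete
Gauss-Bonnet argument, convex minus reflex boundary vertices of such a region are at most the flux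
(`euler_le`, `turning_le_flux`), and each new layer changes the number of convex vertices by at most
the flux (`ncard_convexDarts_expand_le`). A negative flux would make this number negative while the
layers are still in the regular zone. By monotonicity the flux is nonnegative at every height.

Turning the cylinder upside down negates the flux (`flux_neg`), so it is 0 everywhere, all weights
at vertices cancel, and every corner is regular (`corner_regular`). The extreme points of the
intersection of two tiles are then corners of both, which leaves only a common corner or a common
side (`inter_eq`). -/

/-- A system of hexagonal faces given by its darts (face, corner) modulo a period: `next` turns to the
following corner of the face, `opp` crosses the side that starts at the corner. -/
structure HexSystem (Δ Q : Type*) where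
  next : Equiv.Perm Δ
  opp : Δ → Δ
  tile : Δ → Q
  ht : Δ → ℝ
  diam : ℝ
  card_fiber : ∀ q, {d | tile d = q}.ncard = 6
  tile_next : ∀ d, tile (next d) = tile d
  transitive : ∀ (C : Set Δ) (d : Δ), d ∈ C → (∀ x ∈ C, tile x = tile d → next x ∈ C) →
    ∀ e, tile e = tile d → e ∈ C
  opp_opp : ∀ d, opp (opp d) = d
  ht_le : ∀ d e, tile d = tile e → ht d ≤ ht e + diam
  finite_band : ∀ c c' : ℝ, {d | c < ht d ∧ ht d < c'}.Finite

/-! ### Euler's inequality for regions of hexagonal faces -/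

namespace HexSystem

variable {Δ Q : Type*} (H : HexSystem Δ Q)

/-- Rotation about the corner of a dart. -/
def rot (d : Δ) : Δ := H.next (H.opp d)

/-- Above height `y₀` three faces meet at each vertex, and some side leads down. -/
def RegularAbove (y₀ : ℝ) : Prop :=
  ∀ d, y₀ < H.ht d → H.ht (H.opp d) = H.ht (H.next d) ∧ H.ht (H.rot d) = H.ht d ∧
    H.rot (H.rot (H.rot d)) = d ∧
    (H.ht (H.next d) < H.ht d ∨ H.ht (H.next (H.rot d)) < H.ht d ∨
      H.ht (H.next (H.rot (H.rot d))) < H.ht d)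

theorem tile_rot (d : Δ) : H.tile (H.rot d) = H.tile (H.opp d) := H.tile_next _

theorem rot_opp (d : Δ) : H.rot (H.opp d) = H.next d := by simp [rot, H.opp_opp]

theorem opp_injective : Function.Injective H.opp := fun a b h => by
  rw [← H.opp_opp a, h, H.opp_opp]

theorem finite_fiber (q : Q) : {d | H.tile d = q}.Finite :=
  Set.finite_of_ncard_ne_zero (by rw [H.card_fiber]; norm_num)

theorem exists_dart (q : Q) : ∃ d, H.tile d = q := by
  have : {d | H.tile d = q}.Nonempty :=
    Set.nonempty_of_ncard_ne_zero (by rw [H.card_fiber]; norm_num)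
  exact this

/-- If a set of darts of a face contains some, but not all of them, it is entered and left. -/
theorem exists_leaving (C : Set Δ) {d e : Δ} (hde : H.tile e = H.tile d) (hd : d ∈ C)
    (he : e ∉ C) : ∃ x, H.tile x = H.tile d ∧ x ∈ C ∧ H.next x ∉ C := by
  by_contra! hcon
  exact he (H.transitive C d hd (fun x hx hxd => hcon x hxd hx) e hde)

/-- If a face has a side with exactly one end in `C`, then it has another one. -/
theorem exists_other_cut (C : Set Δ) {e : Δ} (he : ¬ (e ∈ C ↔ H.next e ∈ C)) :
    ∃ x, x ≠ e ∧ H.tile x = H.tile e ∧ ¬ (x ∈ C ↔ H.next x ∈ C) := by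
  by_cases h : e ∈ C
  · have h2 : H.next e ∉ C := fun h3 => he (by tauto)
    obtain ⟨x, hx, hx1, hx2⟩ := H.exists_leaving Cᶜ (d := H.next e) (e := e)
      (H.tile_next e).symm h2 (by simpa using h)
    refine ⟨x, ?_, hx.trans (H.tile_next e), ?_⟩
    · rintro rfl; exact hx1 h
    · simp only [Set.mem_compl_iff, not_not] at hx1 hx2; tauto
  · have h2 : H.next e ∈ C := by tauto
    obtain ⟨x, hx, hx1, hx2⟩ := H.exists_leaving C (d := H.next e) (e := e)
      (H.tile_next e).symm h2 h
    refine ⟨x, ?_, hx.trans (H.tile_next e), ?_⟩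
    · rintro rfl; exact h hx1
    · tauto

section Forest

variable {y₀ b : ℝ} (hreg : H.RegularAbove y₀) (S : Set Q)
  (hS : ∀ d, H.tile d ∈ S → y₀ < H.ht d)

/-- The darts below `b` at vertices with all three faces in `S`. -/
def full (b : ℝ) (S : Set Q) : Set Δ :=
  {d | H.ht d < b ∧ H.tile d ∈ S ∧ H.tile (H.rot d) ∈ S ∧ H.tile (H.rot (H.rot d)) ∈ S}

/-- The darts of the sides below `b` between faces in `S`. -/
def lowSides (b : ℝ) (S : Set Q) : Set Δ :=
  {d | H.ht d < b ∧ H.ht (H.next d) < b ∧ H.tile d ∈ S ∧ H.tile (H.opp d) ∈ S}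

/-- The faces in `S` that are entirely below `b`. -/
def lowFaces (b : ℝ) (S : Set Q) : Set Q := {q | q ∈ S ∧ ∀ d, H.tile d = q → H.ht d < b}

include hreg hS in
theorem opp_mem_lowSides {d : Δ} (hd : d ∈ H.lowSides b S) : H.opp d ∈ H.lowSides b S := by
  obtain ⟨h1, h2, h3, h4⟩ := hd
  have hr := hreg d (hS d h3)
  refine ⟨hr.1 ▸ h2, ?_, h4, by rwa [H.opp_opp]⟩
  have : H.ht (H.next (H.opp d)) = H.ht d := hr.2.1
  rwa [this]

include hS

theorem finite_lowSides : (H.lowSides b S).Finite :=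
  (H.finite_band y₀ b).subset fun d hd => ⟨hS d hd.2.2.1, hd.1⟩

theorem finite_lowFaces : (H.lowFaces b S).Finite := by
  refine ((H.finite_band y₀ b).image H.tile).subset fun q hq => ?_
  obtain ⟨d, rfl⟩ := H.exists_dart q
  exact ⟨d, ⟨hS d hq.1, hq.2 d rfl⟩, rfl⟩

theorem finite_full : (H.full b S).Finite :=
  (H.finite_band y₀ b).subset fun d hd => ⟨hS d hd.2.1, hd.1⟩

include hreg

/-- A set of full vertices is left by a side that is not a side to a parent face. -/
theorem exists_cut_side (dep : Q → ℕ) (par : Q → Δ)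
    (hpar : ∀ q ∈ H.lowFaces b S, H.tile (par q) = q ∧ H.tile (H.opp (par q)) ∈ S ∧
      dep (H.tile (H.opp (par q))) < dep q)
    (C : Set Δ) (hC : C ⊆ H.full b S) (hrot : ∀ x ∈ C, H.rot x ∈ C) (hne : C.Nonempty) :
    ∃ d ∈ C, d ∈ H.lowSides b S ∧ H.opp d ∉ C ∧
      ∀ q ∈ H.lowFaces b S, par q ≠ d ∧ H.opp (par q) ≠ d := by
  -- Otherwise every side that leaves `C` joins a face to its parent. But the boundary of a face is
  -- a cycle, which never crosses out of `C` just once, while a finite forest has leaves.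
  by_contra! hcon
  have hfin : C.Finite := (H.finite_full S hS).subset hC
  have hy : ∀ d ∈ C, y₀ < H.ht d := fun d hd => hS d (hC hd).2.1
  have hlow : ∀ d ∈ C, H.ht (H.next d) < b → d ∈ H.lowSides b S := fun d hd h =>
    ⟨(hC hd).1, h, (hC hd).2.1, by rw [← H.tile_rot]; exact (hC hd).2.2.1⟩
  -- `opp x` and `next x` are darts at the same end of the side, and `C` consists of whole vertices.
  have hoppC : ∀ x, y₀ < H.ht (H.opp x) → (H.opp x ∈ C ↔ H.next x ∈ C) := by
    intro x hx
    constructor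
    · intro h; rw [← H.rot_opp]; exact hrot _ h
    · intro h
      have h1 := hrot _ (hrot _ h)
      rw [← H.rot_opp, (hreg _ hx).2.2.1] at h1
      exact h1
  let K : Set Q := {q | q ∈ H.lowFaces b S ∧ ∃ d ∈ C, d ∈ H.lowSides b S ∧ H.opp d ∉ C ∧
    (par q = d ∨ H.opp (par q) = d)}
  -- A descending side at a lowest vertex of `C` leaves `C`.
  have hK : K.Nonempty := by
    obtain ⟨d, hd, hmin⟩ := Set.exists_min_image C H.ht hfin hne
    have key : ∃ e ∈ C, H.ht e = H.ht d ∧ H.ht (H.next e) < H.ht e := by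
      obtain ⟨-, h1, -, h2⟩ := hreg d (hy d hd)
      have h3 := (hreg _ (hy _ (hrot _ hd))).2.1
      rcases h2 with h | h | h
      · exact ⟨d, hd, rfl, h⟩
      · exact ⟨_, hrot _ hd, h1, h.trans_eq h1.symm⟩
      · exact ⟨_, hrot _ (hrot _ hd), h3.trans h1, h.trans_eq (h3.trans h1).symm⟩
    obtain ⟨e, he, hed, hlt⟩ := key
    have hel : e ∈ H.lowSides b S := hlow e he (hlt.trans (hC he).1)
    have hoe : H.opp e ∉ C := fun h => by
      have := hmin _ h
      rw [(hreg e (hy e he)).1] at this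
      linarith
    obtain ⟨q, hq, h⟩ := hcon e he hel hoe
    exact ⟨q, hq, e, he, hel, hoe, by tauto⟩
  -- A deepest face in `K` has a second side `x` leaving `C`. It is not the parent side of `q`, so
  -- it is that of a child of `q`, which is deeper and lies in `K`.
  obtain ⟨q, ⟨hq, d, hd, hdl, hod, hqd⟩, hmax⟩ := Set.exists_max_image K dep
    ((H.finite_lowFaces S hS).subset fun q hq => hq.1) hK
  obtain ⟨hp1, hp2, hp3⟩ := hpar q hq
  have hyq : ∀ x, H.tile x = q → y₀ < H.ht (H.opp x) := fun x hx => by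
    have h1 : y₀ < H.ht x := hS x (hx ▸ hq.1)
    rw [(hreg x h1).1]
    exact hS _ (by rw [H.tile_next, hx]; exact hq.1)
  have hcut : ¬ (par q ∈ C ↔ H.next (par q) ∈ C) := by
    rw [← hoppC _ (hyq _ hp1)]
    rcases hqd with h | h
    · subst h; tauto
    · subst h; rw [H.opp_opp] at hod; tauto
  obtain ⟨x, hxe, hxt, hx⟩ := H.exists_other_cut C hcut
  rw [hp1] at hxt
  rw [← hoppC _ (hyq _ hxt)] at hx
  have hxl : x ∈ H.lowSides b S ∨ H.opp x ∈ H.lowSides b S → x ∈ H.lowSides b S := by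
    rintro (h | h)
    · exact h
    · rw [← H.opp_opp x]; exact H.opp_mem_lowSides hreg S hS h
  have main : ∃ q' ∈ H.lowFaces b S, q' ∈ K ∧ (par q' = x ∨ H.opp (par q') = x) := by
    by_cases hxC : x ∈ C
    · have hx' : H.opp x ∉ C := by tauto
      have hl := hlow x hxC (hq.2 _ (by rw [H.tile_next, hxt]))
      obtain ⟨q', hq', h⟩ := hcon x hxC hl hx'
      have h' : par q' = x ∨ H.opp (par q') = x := by tauto
      exact ⟨q', hq', ⟨hq', x, hxC, hl, hx', h'⟩, h'⟩
    · have hx' : H.opp x ∈ C := by tauto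
      have hx'' : H.opp (H.opp x) ∉ C := by rwa [H.opp_opp]
      have hyx : y₀ < H.ht x := hS x (hxt ▸ hq.1)
      have hl := hlow _ hx' (by
        have : H.ht (H.next (H.opp x)) = H.ht x := (hreg x hyx).2.1
        rw [this]; exact hq.2 _ hxt)
      obtain ⟨q', hq', h⟩ := hcon _ hx' hl hx''
      have h' : par q' = H.opp x ∨ H.opp (par q') = H.opp x := by tauto
      refine ⟨q', hq', ⟨hq', _, hx', hl, hx'', h'⟩, ?_⟩
      rcases h' with h' | h'
      · right; rw [h', H.opp_opp]
      · left; exact H.opp_injective h'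
  obtain ⟨q', hq', hqK, h⟩ := main
  obtain ⟨hp1', hp2', hp3'⟩ := hpar q' hq'
  rcases h with h | h
  · rw [← h, hp1'] at hxt
    subst hxt
    exact hxe h.symm
  · have h2 : H.tile (H.opp (par q')) = q := by rw [h, hxt]
    rw [h2] at hp3'
    exact absurd (hmax q' hqK) (by omega)

/-- The Euler characteristic inequality for a set of faces that is connected to the faces above `b`. -/
theorem euler_le (dep : Q → ℕ)
    (hdep : ∀ q ∈ H.lowFaces b S, ∃ d, H.tile d = q ∧ H.tile (H.opp d) ∈ S ∧
      dep (H.tile (H.opp d)) < dep q) :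
    6 * (H.lowFaces b S).ncard + 2 * (H.full b S).ncard ≤ 3 * (H.lowSides b S).ncard := by
  classical
  have hex : ∀ q, ∃ d, q ∈ H.lowFaces b S → (H.tile d = q ∧ H.tile (H.opp d) ∈ S ∧
      dep (H.tile (H.opp d)) < dep q) := fun q => by
    by_cases hq : q ∈ H.lowFaces b S
    · obtain ⟨d, hd⟩ := hdep q hq
      exact ⟨d, fun _ => hd⟩
    · obtain ⟨d, -⟩ := H.exists_dart q
      exact ⟨d, fun h => absurd h hq⟩
  choose par hpar using hex
  set F := H.lowFaces b S with hF
  set E := H.lowSides b S with hE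
  have hEfin : E.Finite := H.finite_lowSides S hS
  have hFfin : F.Finite := H.finite_lowFaces S hS
  have hparE : ∀ q ∈ F, par q ∈ E := fun q hq => by
    obtain ⟨h1, h2, -⟩ := hpar q hq
    exact ⟨hq.2 _ h1, hq.2 _ (by rw [H.tile_next, h1]), by rw [h1]; exact hq.1, h2⟩
  have hinj : Set.InjOn par F := fun q hq q' hq' h => by
    rw [← (hpar q hq).1, h, (hpar q' hq').1]
  have hinj' : Set.InjOn (fun q => H.opp (par q)) F := fun q hq q' hq' h =>
    hinj hq hq' (H.opp_injective h)
  -- If two faces had each other as parents, each would be deeper than the other.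
  have hdisj : Disjoint (par '' F) ((fun q => H.opp (par q)) '' F) := by
    rw [Set.disjoint_left]
    rintro _ ⟨q, hq, rfl⟩ ⟨q', hq', h⟩
    simp only at h
    have h1 := (hpar q hq).2.2
    have h2 := (hpar q' hq').2.2
    rw [h, (hpar q hq).1] at h2
    rw [← h, H.opp_opp, (hpar q' hq').1] at h1
    omega
  let T : Set Δ := par '' F ∪ (fun q => H.opp (par q)) '' F
  have hTE : T ⊆ E := by
    rintro _ (⟨q, hq, rfl⟩ | ⟨q, hq, rfl⟩)
    · exact hparE q hq
    · exact H.opp_mem_lowSides hreg S hS (hparE q hq)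
  have hTcard : T.ncard = 2 * F.ncard := by
    rw [Set.ncard_union_eq hdisj (hFfin.image _) (hFfin.image _), hinj.ncard_image,
      hinj'.ncard_image]
    ring
  have hWcard : (E \ T).ncard + 2 * F.ncard = E.ncard := by
    rw [← hTcard]; exact Set.ncard_sdiff_add_ncard_of_subset hTE hEfin
  have hTopp : ∀ d ∈ T, H.opp d ∈ T := by
    rintro _ (⟨q, hq, rfl⟩ | ⟨q, hq, rfl⟩)
    · exact Or.inr ⟨q, hq, rfl⟩
    · exact Or.inl ⟨q, hq, (H.opp_opp _).symm⟩
  -- Vertices are peeled off: removing the one at a cut side takes at most three darts from `C` and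
  -- also removes the two darts of that side, which lies outside the forest `T`, from the set on the
  -- right.
  have ind : ∀ n : ℕ, ∀ C : Set Δ, C ⊆ H.full b S → (∀ x ∈ C, H.rot x ∈ C) → C.ncard = n →
      2 * C.ncard ≤ 3 * {d | d ∈ E \ T ∧ (d ∈ C ∨ H.opp d ∈ C)}.ncard := by
    intro n
    induction n using Nat.strong_induction_on with
    | _ n ih =>
      intro C hC hrot hn
      have hCfin : C.Finite := (H.finite_full S hS).subset hC
      rcases C.eq_empty_or_nonempty with rfl | hne
      · simp
      obtain ⟨d, hd, hdE, hod, hdp⟩ := H.exists_cut_side hreg S hS dep par hpar C hC hrot hne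
      have hdT : d ∉ T := by
        rintro (⟨q, hq, h⟩ | ⟨q, hq, h⟩)
        · exact (hdp q hq).1 h
        · exact (hdp q hq).2 h
      have hoT : H.opp d ∉ T := fun h => hdT (by rw [← H.opp_opp d]; exact hTopp _ h)
      have hoE : H.opp d ∈ E := H.opp_mem_lowSides hreg S hS hdE
      let O : Set Δ := {d, H.rot d, H.rot (H.rot d)}
      have hO : O.ncard ≤ 3 := by
        have := Set.ncard_insert_le d {H.rot d, H.rot (H.rot d)}
        have := Set.ncard_insert_le (H.rot d) {H.rot (H.rot d)}
        simp only [Set.ncard_singleton] at this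
        simp only [O]
        omega
      have hOfin : O.Finite := by simp [O]
      have hOC : O ⊆ C := by
        rintro x (rfl | rfl | rfl)
        · exact hd
        · exact hrot _ hd
        · exact hrot _ (hrot _ hd)
      have hr3 : ∀ x ∈ C, H.rot (H.rot (H.rot x)) = x := fun x hx =>
        (hreg x (hS x (hC hx).2.1)).2.2.1
      have hC'card : (C \ O).ncard + O.ncard = C.ncard :=
        Set.ncard_sdiff_add_ncard_of_subset hOC hCfin
      have hOpos : 0 < O.ncard := (Set.ncard_pos hOfin).2 ⟨d, by simp [O]⟩
      have h1 := ih (C \ O).ncard (by omega) (C \ O) (Set.sdiff_subset.trans hC) (by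
        rintro x ⟨hx, hxO⟩
        refine ⟨hrot x hx, fun h => hxO ?_⟩
        have hx3 := hr3 x hx
        rcases h with h | h | h
        · rw [h] at hx3; rw [← hx3]; simp [O]
        · rw [h, hr3 d hd] at hx3; rw [← hx3]; simp [O]
        · have h : H.rot x = H.rot (H.rot d) := h
          rw [h, hr3 d hd] at hx3; rw [← hx3]; simp [O]) rfl
      have hWfin : (E \ T).Finite := hEfin.subset Set.sdiff_subset
      have hne' : d ≠ H.opp d := fun h => hod (h ▸ hd)
      have h2 : ({d, H.opp d} ∪ {d | d ∈ E \ T ∧ (d ∈ C \ O ∨ H.opp d ∈ C \ O)} : Set Δ) ⊆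
          {d | d ∈ E \ T ∧ (d ∈ C ∨ H.opp d ∈ C)} := by
        rintro x ((rfl | rfl) | ⟨hx, hx2⟩)
        · exact ⟨⟨hdE, hdT⟩, Or.inl hd⟩
        · exact ⟨⟨hoE, hoT⟩, Or.inr (by rwa [H.opp_opp])⟩
        · exact ⟨hx, hx2.imp (fun h => h.1) (fun h => h.1)⟩
      have h3 := Set.ncard_le_ncard h2 (hWfin.subset fun x hx => hx.1)
      rw [Set.ncard_union_eq ?_ (by simp) (hWfin.subset fun x hx => hx.1),
        Set.ncard_pair hne'] at h3
      · omega
      · rw [Set.disjoint_left]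
        rintro x (rfl | rfl) ⟨-, hx⟩
        · rcases hx with hx | hx
          · exact hx.2 (by simp [O])
          · exact hod hx.1
        · rcases hx with hx | hx
          · exact hod hx.1
          · rw [H.opp_opp] at hx; exact hx.2 (by simp [O])
  have hfin := ind _ (H.full b S) subset_rfl (by
    rintro x ⟨h1, h2, h3, h4⟩
    have hr := hreg x (hS x h2)
    exact ⟨hr.2.1 ▸ h1, h3, h4, by rw [hr.2.2.1]; exact h2⟩) rfl
  have h4 := Set.ncard_le_ncard (s := {d | d ∈ E \ T ∧ (d ∈ H.full b S ∨ H.opp d ∈ H.full b S)})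
    (t := E \ T) (fun x hx => hx.1) (hEfin.subset Set.sdiff_subset)
  omega

end Forest

end HexSystem

/-! ### Flux, turning and the Gauss-Bonnet bound -/

namespace HexSystem

variable {Δ Q : Type*} (H : HexSystem Δ Q)

/-- The darts below `b` of the faces that are crossed by the horizontal line at height `b`. -/
def crossDarts (b : ℝ) : Set Δ := {d | H.ht d < b ∧ ∃ e, H.tile e = H.tile d ∧ b < H.ht e}

/-- The faces crossed by the horizontal line at height `b`. -/
def crossFaces (b : ℝ) : Set Q :=
  {q | (∃ d, H.tile d = q ∧ H.ht d < b) ∧ ∃ e, H.tile e = q ∧ b < H.ht e}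

/-- The combinatorial turning of the horizontal line at height `b`. -/
noncomputable def flux (b : ℝ) : ℤ := (H.crossDarts b).ncard - 3 * (H.crossFaces b).ncard

/-- The darts below `b` of faces in `S` at vertices with no other face in `S`. -/
def convexDarts (y₀ b : ℝ) (S : Set Q) : Set Δ :=
  {d | y₀ < H.ht d ∧ H.ht d < b ∧ H.tile d ∈ S ∧ H.tile (H.rot d) ∉ S ∧
    H.tile (H.rot (H.rot d)) ∉ S}

/-- The neighbours of `S` and `S` itself. -/
def expand (S : Set Q) : Set Q := S ∪ {q | ∃ d, H.tile d = q ∧ H.tile (H.opp d) ∈ S}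

/-- The faces outside `S` all of whose neighbours are in `S`. -/
def holes (S : Set Q) : Set Q := {q | q ∉ S ∧ ∀ d, H.tile d = q → H.tile (H.opp d) ∈ S}

section Count

variable {y₀ b : ℝ} (hreg : H.RegularAbove y₀)

include hreg

theorem rot_mem_band {d : Δ} (hd : y₀ < H.ht d ∧ H.ht d < b) :
    y₀ < H.ht (H.rot d) ∧ H.ht (H.rot d) < b := by
  rwa [(hreg d hd.1).2.1]

/-- On the darts of a band `rot` is a permutation whose inverse is its square. -/
theorem sum_rot (B : Finset Δ) (hB : ∀ d, d ∈ B ↔ y₀ < H.ht d ∧ H.ht d < b) (f : Δ → ℤ) :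
    ∑ d ∈ B, f (H.rot d) = ∑ d ∈ B, f d := by
  have hm : ∀ d ∈ B, H.rot d ∈ B := fun d hd =>
    (hB _).2 (H.rot_mem_band hreg ((hB d).1 hd))
  have h3 : ∀ d ∈ B, H.rot (H.rot (H.rot d)) = d := fun d hd => (hreg d ((hB d).1 hd).1).2.2.1
  refine Finset.sum_bij' (fun d _ => H.rot d) (fun d _ => H.rot (H.rot d)) hm
    (fun d hd => hm _ (hm _ hd)) h3 h3 (fun d hd => rfl)

end Count

open Classical in
/-- The indicator function of the darts of the faces in `S`. -/
noncomputable def ind (S : Set Q) (d : Δ) : ℤ := if H.tile d ∈ S then 1 else 0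

theorem ind_eq_or (S : Set Q) (d : Δ) : H.ind S d = 0 ∨ H.ind S d = 1 := by
  unfold ind; split_ifs <;> simp

/-- The number of convex minus the number of reflex boundary vertices of `S` in a band. -/
noncomputable def turning (B : Finset Δ) (S : Set Q) : ℤ :=
  ∑ d ∈ B, H.ind S d - 3 * ∑ d ∈ B, H.ind S d * H.ind S (H.rot d)
    + 2 * ∑ d ∈ B, H.ind S d * H.ind S (H.rot d) * H.ind S (H.rot (H.rot d))

section Growth

variable {y₀ b : ℝ} (hreg : H.RegularAbove y₀)
  (B : Finset Δ) (hB : ∀ d, d ∈ B ↔ y₀ < H.ht d ∧ H.ht d < b)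

include hB in
theorem sum_eq_ncard (f : Δ → ℤ) (p : Δ → Prop)
    (hf : ∀ d, y₀ < H.ht d → H.ht d < b → (p d → f d = 1) ∧ (¬ p d → f d = 0)) :
    ∑ d ∈ B, f d = {d | y₀ < H.ht d ∧ H.ht d < b ∧ p d}.ncard := by
  classical
  have h1 : {d | y₀ < H.ht d ∧ H.ht d < b ∧ p d} = ((B.filter p : Finset Δ) : Set Δ) := by
    ext d; simp [hB, and_assoc]
  rw [h1, Set.ncard_coe_finset, Finset.card_filter]
  push_cast
  refine Finset.sum_congr rfl fun d hd => ?_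
  obtain ⟨h2, h3⟩ := hf d ((hB d).1 hd).1 ((hB d).1 hd).2
  split_ifs with h
  · exact h2 h
  · exact h3 h

theorem ncard_tile_mem (A : Set Q) (hA : A.Finite) : {d | H.tile d ∈ A}.ncard = 6 * A.ncard := by
  classical
  have h1 : {d | H.tile d ∈ A} = ⋃ q ∈ A, {d | H.tile d = q} := by
    ext d; simp
  have key : ∀ s : Finset Q, (⋃ q ∈ s, {d | H.tile d = q}).ncard = 6 * s.card := by
    intro s
    induction s using Finset.induction_on with
    | empty => simp
    | insert a s ha ih =>
      have hs : (⋃ q ∈ s, {d | H.tile d = q}).Finite :=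
        s.finite_toSet.biUnion fun q _ => H.finite_fiber q
      rw [Finset.set_biUnion_insert, Set.ncard_union_eq ?_ (H.finite_fiber a) hs, ih, H.card_fiber,
        Finset.card_insert_of_notMem ha]
      · ring
      · rw [Set.disjoint_left]
        intro d hd hd'
        simp only [Set.mem_iUnion, Set.mem_ofPred_eq, exists_prop] at hd hd'
        obtain ⟨q, hq, h⟩ := hd'
        exact ha (by rw [← hd, h]; exact hq)
  have := key hA.toFinset
  simp only [Set.Finite.mem_toFinset] at this
  rw [h1, this, Set.ncard_eq_toFinset_card A hA]

variable (S : Set Q) (hS : ∀ d, H.tile d ∈ S → y₀ < H.ht d)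
  (habove : ∀ d, b < H.ht d → H.tile d ∈ S) (hgen : ∀ d, H.ht d ≠ b)

include hreg hB hS habove hgen

/-- Faces below `b` contribute six darts each, crossed faces their `crossDarts`. Adjacent pairs
exceed `lowSides` by at least one for each crossed face, which has a side going up through `b`.
Euler's inequality absorbs all terms from below `b`, and the flux remains. -/
theorem turning_le_flux (dep : Q → ℕ)
    (hdep : ∀ q ∈ H.lowFaces b S, ∃ d, H.tile d = q ∧ H.tile (H.opp d) ∈ S ∧
      dep (H.tile (H.opp d)) < dep q) :
    H.turning B S ≤ H.flux b := by
  classical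
  have hE := H.euler_le hreg S hS dep hdep
  have hFfin : (H.lowFaces b S).Finite := H.finite_lowFaces S hS
  have hband := H.finite_band y₀ b
  have hcross : ∀ d, (∃ e, H.tile e = H.tile d ∧ b < H.ht e) → H.tile d ∈ S := by
    rintro d ⟨e, he, h⟩
    exact he ▸ habove e h
  have hN : ∑ d ∈ B, H.ind S d = 6 * (H.lowFaces b S).ncard + (H.crossDarts b).ncard := by
    rw [H.sum_eq_ncard B hB _ (fun d => H.tile d ∈ S) (by
      intro d _ _; unfold ind; split_ifs <;> simp_all)]
    have : {d | y₀ < H.ht d ∧ H.ht d < b ∧ H.tile d ∈ S} =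
        {d | H.tile d ∈ H.lowFaces b S} ∪ H.crossDarts b := by
      ext d
      simp only [Set.mem_ofPred_eq, Set.mem_union, lowFaces, crossDarts]
      constructor
      · rintro ⟨h1, h2, h3⟩
        by_cases h : ∃ e, H.tile e = H.tile d ∧ b < H.ht e
        · exact Or.inr ⟨h2, h⟩
        · left
          push Not at h
          exact ⟨h3, fun e he => lt_of_le_of_ne (h e he) (hgen e)⟩
      · rintro (⟨h1, h2⟩ | ⟨h1, h2⟩)
        · exact ⟨hS d h1, h2 d rfl, h1⟩
        · exact ⟨hS d (hcross d h2), h1, hcross d h2⟩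
    rw [this, Set.ncard_union_eq ?_ (hband.subset fun d hd => ⟨hS d hd.1, hd.2 d rfl⟩)
      (hband.subset fun d hd => ⟨hS d (hcross d hd.2), hd.1⟩), H.ncard_tile_mem _ hFfin]
    · push_cast; ring
    · rw [Set.disjoint_left]
      rintro d hd ⟨-, e, he, h⟩
      exact absurd (hd.2 e he) (not_lt.2 h.le)
  have hT : ∑ d ∈ B, H.ind S d * H.ind S (H.rot d) * H.ind S (H.rot (H.rot d)) =
      (H.full b S).ncard := by
    rw [H.sum_eq_ncard B hB _ (fun d => H.tile d ∈ S ∧ H.tile (H.rot d) ∈ S ∧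
      H.tile (H.rot (H.rot d)) ∈ S) (by
      intro d _ _; unfold ind; split_ifs <;> simp_all)]
    congr 2
    ext d
    simp only [Set.mem_ofPred_eq, full]
    constructor
    · rintro ⟨h1, h2, h3⟩; exact ⟨h2, h3⟩
    · rintro ⟨h2, h3⟩; exact ⟨hS d h3.1, h2, h3⟩
  have hP : ((H.lowSides b S).ncard : ℤ) + (H.crossFaces b).ncard ≤
      ∑ d ∈ B, H.ind S d * H.ind S (H.rot d) := by
    rw [H.sum_eq_ncard B hB _ (fun d => H.tile d ∈ S ∧ H.tile (H.rot d) ∈ S) (by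
      intro d _ _; unfold ind; split_ifs <;> simp_all)]
    -- The face across such an ascending side also reaches above `b`, so `habove` puts it in `S`.
    have hup : ∀ q, ∃ d, q ∈ H.crossFaces b →
        H.tile d = q ∧ H.ht d < b ∧ b < H.ht (H.next d) := by
      intro q
      by_cases hq : q ∈ H.crossFaces b
      swap
      · exact (H.exists_dart q).imp fun d _ h => absurd h hq
      obtain ⟨⟨d, hd, hdb⟩, e, he, heb⟩ := hq
      obtain ⟨x, hx, hx1, hx2⟩ := H.exists_leaving {x | H.ht x < b} (d := d) (e := e)
        (by rw [he, hd]) hdb (by simpa using heb.le)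
      exact ⟨x, fun _ => ⟨by rw [hx, hd], hx1,
        lt_of_le_of_ne (by simpa using hx2) (hgen _).symm⟩⟩
    choose up hup using hup
    have hinj : Set.InjOn up (H.crossFaces b) := fun q hq q' hq' h => by
      rw [← (hup q hq).1, h, (hup q' hq').1]
    have hrotS : ∀ d, H.ht d < b → y₀ < H.ht d → b < H.ht (H.next d) →
        H.tile (H.rot d) ∈ S := fun d h1 h2 h3 => by
      rw [H.tile_rot]
      exact habove _ (by rw [(hreg d h2).1]; exact h3)
    have hupS : ∀ q ∈ H.crossFaces b, H.tile (up q) ∈ S := fun q hq =>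
      hcross _ ⟨H.next (up q), H.tile_next _, (hup q hq).2.2⟩
    rw [← hinj.ncard_image]
    norm_cast
    rw [← Set.ncard_union_eq ?_ (H.finite_lowSides S hS) (hband.subset ?_)]
    · refine Set.ncard_le_ncard ?_ (hband.subset fun d hd => ⟨hd.1, hd.2.1⟩)
      rintro d (hd | ⟨q, hq, rfl⟩)
      · exact ⟨hS d hd.2.2.1, hd.1, hd.2.2.1, by rw [H.tile_rot]; exact hd.2.2.2⟩
      · have h1 := hS _ (hupS q hq)
        exact ⟨h1, (hup q hq).2.1, hupS q hq, hrotS _ (hup q hq).2.1 h1 (hup q hq).2.2⟩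
    · rw [Set.disjoint_left]
      rintro _ hd ⟨q, hq, rfl⟩
      exact absurd hd.2.1 (not_lt.2 (hup q hq).2.2.le)
    · rintro _ ⟨q, hq, rfl⟩
      exact ⟨hS _ (hupS q hq), (hup q hq).2.1⟩
  unfold turning flux
  rw [hN, hT]
  have hE' : 6 * ((H.lowFaces b S).ncard : ℤ) + 2 * (H.full b S).ncard ≤
    3 * (H.lowSides b S).ncard := by exact_mod_cast hE
  linarith

end Growth

end HexSystem

/-! ### Growth of a region by one layer of faces -/

namespace HexSystem

variable {Δ Q : Type*} (H : HexSystem Δ Q)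

theorem subset_expand (S : Set Q) : S ⊆ H.expand S := Set.subset_union_left

theorem tile_opp_mem_expand {S : Set Q} {d : Δ} (h : H.tile d ∈ S) :
    H.tile (H.opp d) ∈ H.expand S :=
  Or.inr ⟨H.opp d, rfl, by rwa [H.opp_opp]⟩

section Step

variable {y₀ b : ℝ} (hreg : H.RegularAbove y₀)
  (B : Finset Δ) (hB : ∀ d, d ∈ B ↔ y₀ < H.ht d ∧ H.ht d < b)
  (S : Set Q)

include hreg hB

/-- Inclusion-exclusion for one face in `S` and two outside; the two pair terms have equal sums by
`sum_rot`. -/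
theorem ncard_convexDarts : ((H.convexDarts y₀ b S).ncard : ℤ) =
    ∑ d ∈ B, H.ind S d - 2 * ∑ d ∈ B, H.ind S d * H.ind S (H.rot d)
    + ∑ d ∈ B, H.ind S d * H.ind S (H.rot d) * H.ind S (H.rot (H.rot d)) := by
  classical
  have h1 := H.sum_eq_ncard B hB
    (fun d => H.ind S d * (1 - H.ind S (H.rot d)) * (1 - H.ind S (H.rot (H.rot d))))
    (fun d => H.tile d ∈ S ∧ H.tile (H.rot d) ∉ S ∧ H.tile (H.rot (H.rot d)) ∉ S) (by
      intro d _ _; unfold ind; split_ifs <;> simp_all)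
  have h2 := H.sum_rot hreg B hB (fun d => H.ind S d * H.ind S (H.rot d))
  have h3 := H.sum_rot hreg B hB (fun d => H.ind S (H.rot d) * H.ind S (H.rot (H.rot d)))
  have h4 : ∑ d ∈ B, H.ind S (H.rot (H.rot d)) * H.ind S (H.rot (H.rot (H.rot d))) =
      ∑ d ∈ B, H.ind S (H.rot (H.rot d)) * H.ind S d :=
    Finset.sum_congr rfl fun d hd => by rw [(hreg d ((hB d).1 hd).1).2.2.1]
  have h5 : (H.convexDarts y₀ b S) = {d | y₀ < H.ht d ∧ H.ht d < b ∧ H.tile d ∈ S ∧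
      H.tile (H.rot d) ∉ S ∧ H.tile (H.rot (H.rot d)) ∉ S} := rfl
  rw [h5, ← h1]
  have h6 : ∀ d, H.ind S d * (1 - H.ind S (H.rot d)) * (1 - H.ind S (H.rot (H.rot d))) =
      H.ind S d - H.ind S d * H.ind S (H.rot d) - H.ind S (H.rot (H.rot d)) * H.ind S d
        + H.ind S d * H.ind S (H.rot d) * H.ind S (H.rot (H.rot d)) := fun d => by ring
  simp only [h6, Finset.sum_add_distrib, Finset.sum_sub_distrib]
  linarith

variable (hS' : ∀ d, H.tile d ∈ H.expand S → y₀ < H.ht d)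
  (habove : ∀ d, b < H.ht d → H.tile d ∈ S) (hgen : ∀ d, H.ht d ≠ b)

omit hB in
theorem tile_rot_rot {d : Δ} (hd : y₀ < H.ht d) :
    H.tile (H.opp (H.rot (H.rot d))) = H.tile d := by
  rw [← H.tile_rot, (hreg d hd).2.2.1]

omit hB in
theorem rot_mem_of_mem_holes {d : Δ} (hd : y₀ < H.ht d) (h : H.tile d ∈ H.holes S) :
    H.tile (H.rot d) ∈ S ∧ H.tile (H.rot (H.rot d)) ∈ S := by
  refine ⟨by rw [H.tile_rot]; exact h.2 d rfl, ?_⟩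
  have := h.2 _ (H.tile_rot_rot hreg hd)
  rwa [H.opp_opp] at this

omit hreg hB in
theorem holes_subset_expand : H.holes S ⊆ H.expand S := fun q hq => by
  obtain ⟨d, hd⟩ := H.exists_dart q
  exact Or.inr ⟨d, hd, hq.2 d hd⟩

include hS' habove hgen

omit hreg in
-- A face outside `S` has no corner above `b`, and one in the expansion none below `y₀`, so all six
-- of its corners are counted.
theorem sum_ind_of_disjoint (A : Set Q) (hA : A ⊆ H.expand S) (hAS : Disjoint A S) :
    A.Finite ∧ ∑ d ∈ B, H.ind A d = 6 * A.ncard := by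
  classical
  have hlow : ∀ d, H.tile d ∈ A → y₀ < H.ht d ∧ H.ht d < b := fun d hd => by
    refine ⟨hS' d (hA hd), lt_of_le_of_ne (not_lt.1 fun h => ?_) (hgen d)⟩
    exact Set.disjoint_left.1 hAS hd (habove d h)
  have hAfin : A.Finite := by
    refine ((H.finite_band y₀ b).image H.tile).subset fun q hq => ?_
    obtain ⟨d, rfl⟩ := H.exists_dart q
    exact ⟨d, hlow d hq, rfl⟩
  refine ⟨hAfin, ?_⟩
  rw [H.sum_eq_ncard B hB _ (fun d => H.tile d ∈ A) (by
    intro d _ _; unfold ind; split_ifs <;> simp_all)]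
  have : {d | y₀ < H.ht d ∧ H.ht d < b ∧ H.tile d ∈ A} = {d | H.tile d ∈ A} := by
    ext d
    exact ⟨fun h => h.2.2, fun h => ⟨(hlow d h).1, (hlow d h).2, h⟩⟩
  rw [this, H.ncard_tile_mem A hAfin]
  push_cast; rfl

/-- At each corner of a hole the two other faces lie in `S`. Filling the hole turns its six reflex
vertices, each counted -1, into full ones, counted 0. -/
theorem turning_union_holes :
    H.turning B (S ∪ H.holes S) = H.turning B S + 6 * (H.holes S).ncard := by
  classical
  obtain ⟨hZfin, hZ⟩ := H.sum_ind_of_disjoint B hB S hS' habove hgen (H.holes S)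
    (H.holes_subset_expand S) (Set.disjoint_left.2 fun q hq => hq.1)
  have hu : ∀ d, H.ind (S ∪ H.holes S) d = H.ind S d + H.ind (H.holes S) d := fun d => by
    unfold ind
    by_cases h1 : H.tile d ∈ S
    · have : H.tile d ∉ H.holes S := fun h => h.1 h1
      simp [h1, this]
    · simp [h1]
  have hz1 := H.sum_rot hreg B hB (fun d => H.ind (H.holes S) d)
  have hz2 := H.sum_rot hreg B hB (fun d => H.ind (H.holes S) (H.rot d))
  have key : ∀ d ∈ B, H.ind (S ∪ H.holes S) d * H.ind (S ∪ H.holes S) (H.rot d) =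
        H.ind S d * H.ind S (H.rot d) + H.ind (H.holes S) d + H.ind (H.holes S) (H.rot d) ∧
      H.ind (S ∪ H.holes S) d * H.ind (S ∪ H.holes S) (H.rot d) *
        H.ind (S ∪ H.holes S) (H.rot (H.rot d)) =
      H.ind S d * H.ind S (H.rot d) * H.ind S (H.rot (H.rot d)) + H.ind (H.holes S) d
        + H.ind (H.holes S) (H.rot d) + H.ind (H.holes S) (H.rot (H.rot d)) := by
    intro d hd
    have hd0 := (hB d).1 hd
    have hd1 := H.rot_mem_band hreg hd0
    have hd2 := H.rot_mem_band hreg hd1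
    have h3 := (hreg d hd0.1).2.2.1
    have f0 := H.rot_mem_of_mem_holes hreg S hd0.1
    have f1 := H.rot_mem_of_mem_holes hreg S hd1.1
    have f2 := H.rot_mem_of_mem_holes hreg S hd2.1
    rw [h3] at f1 f2
    have g0 : H.tile d ∈ H.holes S → H.tile d ∉ S := fun h => h.1
    have g1 : H.tile (H.rot d) ∈ H.holes S → H.tile (H.rot d) ∉ S := fun h => h.1
    have g2 : H.tile (H.rot (H.rot d)) ∈ H.holes S → H.tile (H.rot (H.rot d)) ∉ S := fun h => h.1
    simp only [hu]
    unfold ind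
    by_cases a0 : H.tile d ∈ H.holes S <;> by_cases a1 : H.tile (H.rot d) ∈ H.holes S <;>
      by_cases a2 : H.tile (H.rot (H.rot d)) ∈ H.holes S <;> simp_all
  unfold turning
  rw [Finset.sum_congr rfl fun d hd => (key d hd).1, Finset.sum_congr rfl fun d hd => (key d hd).2]
  simp only [hu, Finset.sum_add_distrib]
  linarith

omit hB in
-- Around a new face that is not a hole, some side away from `S` is followed by a side on `S`. The
-- vertex between them is convex for `S`, and the dart of `S` there determines the new face by
-- rotation.
theorem ncard_frontier_le :
    ((H.expand S \ S) \ H.holes S).ncard ≤ (H.convexDarts y₀ b S).ncard := by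
  have hex : ∀ q, ∃ e, q ∈ (H.expand S \ S) \ H.holes S →
      H.tile e = q ∧ H.tile (H.rot e) ∈ S ∧ H.tile (H.rot (H.rot e)) ∉ S := by
    intro q
    by_cases hq : q ∈ (H.expand S \ S) \ H.holes S
    swap
    · exact (H.exists_dart q).imp fun d _ h => absurd h hq
    obtain ⟨⟨hqE, hqS⟩, hqZ⟩ := hq
    obtain ⟨x₁, hx₁, h₁⟩ : ∃ d, H.tile d = q ∧ H.tile (H.opp d) ∈ S := by
      rcases hqE with h | h
      · exact absurd h hqS
      · exact h
    obtain ⟨x₂, hx₂, h₂⟩ : ∃ d, H.tile d = q ∧ H.tile (H.opp d) ∉ S := by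
      by_contra! h
      exact hqZ ⟨hqS, h⟩
    obtain ⟨x, hx, hx3, hx4⟩ := H.exists_leaving {x | H.tile (H.opp x) ∉ S} (d := x₂) (e := x₁)
      (by rw [hx₁, hx₂]) h₂ (by simpa using h₁)
    simp only [Set.mem_ofPred_eq, not_not] at hx3 hx4
    have hyx : y₀ < H.ht x := hS' x (by rw [hx, hx₂]; exact hqE)
    have hyo : y₀ < H.ht (H.opp x) := by
      rw [(hreg x hyx).1]; exact hS' _ (by rw [H.tile_next, hx, hx₂]; exact hqE)
    refine ⟨H.next x, fun _ => ⟨by rw [H.tile_next, hx, hx₂], by rwa [H.tile_rot], ?_⟩⟩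
    rw [← H.rot_opp, (hreg _ hyo).2.2.1]
    exact hx3
  choose f hf using hex
  have hyf : ∀ q ∈ (H.expand S \ S) \ H.holes S, y₀ < H.ht (f q) ∧ H.ht (f q) < b := by
    intro q hq
    have h1 := (hf q hq).1
    refine ⟨hS' _ (by rw [h1]; exact hq.1.1), lt_of_le_of_ne (not_lt.1 fun h => ?_) (hgen _)⟩
    exact hq.1.2 (h1 ▸ habove _ h)
  refine Set.ncard_le_ncard_of_injOn (fun q => H.rot (f q)) ?_ ?_
    ((H.finite_band y₀ b).subset fun d hd => ⟨hd.1, hd.2.1⟩)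
  · intro q hq
    obtain ⟨h1, h2, h3⟩ := hf q hq
    have hb := H.rot_mem_band hreg (hyf q hq)
    refine ⟨hb.1, hb.2, h2, h3, ?_⟩
    rw [(hreg _ (hyf q hq).1).2.2.1, h1]
    exact hq.1.2
  · intro q hq q' hq' h
    have h : H.rot (f q) = H.rot (f q') := h
    rw [← (hf q hq).1, ← (hf q' hq').1, ← (hreg _ (hyf q hq).1).2.2.1,
      ← (hreg _ (hyf q' hq').1).2.2.1, h]

/-- Let `N`, `P`, `T` be the three sums in `turning` and `c = N - 2P + T` the number of convex
darts, with primes for the expansion, and let `A` be the new faces. A vertex that touches `S` is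
full in the expansion, so `T' ≥ 3N - 3P + T`, while `N' = N + 6|A|`. Hence `3c' = 2(N' - 3P' + 2T')
+ N' - T' ≤ 2β + 6|A| - 3c + (N - 3P + 2T)`. Now `|A| ≤ c + |holes|`, and `N - 3P + 2T + 6|holes| ≤
β` since filling the holes keeps the bound, so `3c' ≤ 3c + 3β`. -/
theorem ncard_convexDarts_expand_le (β : ℤ) (h1 : H.turning B (H.expand S) ≤ β)
    (h2 : H.turning B (S ∪ H.holes S) ≤ β) :
    ((H.convexDarts y₀ b (H.expand S)).ncard : ℤ) ≤ (H.convexDarts y₀ b S).ncard + β := by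
  classical
  rw [H.turning_union_holes hreg B hB S hS' habove hgen] at h2
  have h3 := H.ncard_frontier_le hreg S hS' habove hgen
  obtain ⟨hAfin, hA⟩ := H.sum_ind_of_disjoint B hB S hS' habove hgen (H.expand S \ S)
    Set.sdiff_subset Set.disjoint_sdiff_left
  have hZA : H.holes S ⊆ H.expand S \ S := fun q hq => ⟨H.holes_subset_expand S hq, hq.1⟩
  have h4 := Set.ncard_sdiff_add_ncard_of_subset hZA hAfin
  have h5 := H.ncard_convexDarts hreg B hB S
  have h6 := H.ncard_convexDarts hreg B hB (H.expand S)
  set S' := H.expand S with hS'def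
  set A := S' \ S with hAdef
  have hsum : ∀ d, H.ind S' d = H.ind S d + H.ind A d := fun d => by
    unfold ind
    by_cases h : H.tile d ∈ S
    · have : H.tile d ∈ S' := H.subset_expand S h
      simp [h, this, hAdef]
    · simp [h, hAdef]
  -- Three faces at a vertex all lie in `S'` exactly if one of them lies in `S` or all lie in `A`;
  -- the first case is expanded by inclusion-exclusion.
  have key : ∀ d ∈ B, H.ind S' d * H.ind S' (H.rot d) * H.ind S' (H.rot (H.rot d)) =
      H.ind S d + H.ind S (H.rot d) + H.ind S (H.rot (H.rot d))
      - H.ind S d * H.ind S (H.rot d) - H.ind S (H.rot d) * H.ind S (H.rot (H.rot d))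
      - H.ind S (H.rot (H.rot d)) * H.ind S (H.rot (H.rot (H.rot d)))
      + H.ind S d * H.ind S (H.rot d) * H.ind S (H.rot (H.rot d))
      + H.ind A d * H.ind A (H.rot d) * H.ind A (H.rot (H.rot d)) := by
    intro d hd
    have hd0 := (hB d).1 hd
    have hd1 := H.rot_mem_band hreg hd0
    have hd2 := H.rot_mem_band hreg hd1
    have g3 := (hreg d hd0.1).2.2.1
    have fwd : ∀ x, y₀ < H.ht x → H.tile x ∈ S → H.tile (H.rot x) ∈ S' ∧
        H.tile (H.rot (H.rot x)) ∈ S' := by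
      intro x hx h
      refine ⟨by rw [H.tile_rot]; exact H.tile_opp_mem_expand h, ?_⟩
      have := H.tile_opp_mem_expand (S := S) (d := H.opp (H.rot (H.rot x)))
        (by rw [H.tile_rot_rot hreg hx]; exact h)
      rwa [H.opp_opp] at this
    have f0 := fwd _ hd0.1
    have f1 := fwd _ hd1.1
    have f2 := fwd _ hd2.1
    rw [g3] at f1 f2
    rw [g3]
    have e0 : H.tile d ∈ S → H.tile d ∈ S' := fun h => H.subset_expand S h
    have e1 : H.tile (H.rot d) ∈ S → H.tile (H.rot d) ∈ S' := fun h => H.subset_expand S h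
    have e2 : H.tile (H.rot (H.rot d)) ∈ S → H.tile (H.rot (H.rot d)) ∈ S' :=
      fun h => H.subset_expand S h
    have hAm : ∀ x, H.tile x ∈ A ↔ H.tile x ∈ S' ∧ H.tile x ∉ S := fun x => Iff.rfl
    unfold ind
    simp only [hAm]
    by_cases p0 : H.tile d ∈ S <;> by_cases p1 : H.tile (H.rot d) ∈ S <;>
      by_cases p2 : H.tile (H.rot (H.rot d)) ∈ S <;> simp_all
  have hT := Finset.sum_congr rfl key
  simp only [Finset.sum_add_distrib, Finset.sum_sub_distrib] at hT
  have s1 := H.sum_rot hreg B hB (fun d => H.ind S d)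
  have s2 := H.sum_rot hreg B hB (fun d => H.ind S (H.rot d))
  have s3 := H.sum_rot hreg B hB (fun d => H.ind S d * H.ind S (H.rot d))
  have s4 := H.sum_rot hreg B hB (fun d => H.ind S (H.rot d) * H.ind S (H.rot (H.rot d)))
  have hN : ∑ d ∈ B, H.ind S' d = ∑ d ∈ B, H.ind S d + ∑ d ∈ B, H.ind A d := by
    rw [← Finset.sum_add_distrib]; exact Finset.sum_congr rfl fun d _ => hsum d
  have hpos : 0 ≤ ∑ d ∈ B, H.ind A d * H.ind A (H.rot d) * H.ind A (H.rot (H.rot d)) := by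
    refine Finset.sum_nonneg fun d _ => ?_
    have hn : ∀ x, 0 ≤ H.ind A x := fun x => by
      rcases H.ind_eq_or A x with h | h <;> simp [h]
    exact mul_nonneg (mul_nonneg (hn _) (hn _)) (hn _)
  unfold turning at h1 h2
  have h3' : ((A \ H.holes S).ncard : ℤ) ≤ (H.convexDarts y₀ b S).ncard := by exact_mod_cast h3
  have h4' : ((A \ H.holes S).ncard : ℤ) + (H.holes S).ncard = A.ncard := by exact_mod_cast h4
  linarith

end Step

/-- The faces at distance at most `n` from those that reach above `b`. -/
def layers (H : HexSystem Δ Q) (b : ℝ) : ℕ → Set Q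
  | 0 => {q | ∃ d, H.tile d = q ∧ b < H.ht d}
  | n + 1 => H.expand (layers H b n)

theorem layers_mono (b : ℝ) : Monotone (H.layers b) :=
  monotone_nat_of_le_succ fun _ => H.subset_expand _

/-- In the regular zone neighbours share the height of an end of their common side, so a layer
reaches down at most `diam` further. -/
theorem lt_ht_of_mem_layers {y₀ b : ℝ} (hreg : H.RegularAbove y₀) (hD : 0 ≤ H.diam) (n : ℕ)
    (hb : y₀ + (n + 1) * H.diam ≤ b) (d : Δ) (hd : H.tile d ∈ H.layers b n) :
    b - (n + 1) * H.diam < H.ht d := by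
  induction n generalizing d with
  | zero =>
    obtain ⟨e, he, hbe⟩ := hd
    have := H.ht_le e d he
    push_cast; linarith
  | succ n ih =>
    push_cast at hb ⊢
    have ih' := ih (by nlinarith)
    rcases hd with hd | ⟨e, he, hd⟩
    · have := ih' d hd
      nlinarith
    · have h1 := ih' _ hd
      have h2 := ih' (H.next (H.opp e)) (by rwa [H.tile_next])
      have h3 := (hreg (H.opp e) (by nlinarith)).1
      rw [H.opp_opp] at h3
      have := H.ht_le e d he
      nlinarith

/-- Far above the irregular vertices, the flux cannot be negative. -/
theorem flux_nonneg_of_regularAbove {y₀ b : ℝ} (hreg : H.RegularAbove y₀) (hD : 0 ≤ H.diam)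
    (hgen : ∀ d, H.ht d ≠ b)
    (hb : y₀ + ((H.convexDarts y₀ b (H.layers b 0)).ncard + 3) * H.diam ≤ b) :
    0 ≤ H.flux b := by
  classical
  -- The flux is then at most -1, so each layer loses a convex dart and `n₀ + 1` layers are too
  -- many. The summand 3 in `hb` keeps layer `n₀ + 2` above `y₀`.
  by_contra! hneg
  set n₀ := (H.convexDarts y₀ b (H.layers b 0)).ncard with hn₀
  let B := (H.finite_band y₀ b).toFinset
  have hB : ∀ d, d ∈ B ↔ y₀ < H.ht d ∧ H.ht d < b := fun d => by simp [B]
  have habove : ∀ n d, b < H.ht d → H.tile d ∈ H.layers b n := fun n d hd =>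
    H.layers_mono b (Nat.zero_le n) ⟨d, rfl, hd⟩
  have hht : ∀ n, n ≤ n₀ + 2 → ∀ d, H.tile d ∈ H.layers b n → y₀ < H.ht d := by
    intro n hn d hd
    have hn' : (n : ℝ) ≤ n₀ + 2 := by exact_mod_cast hn
    have h1 : y₀ + (n + 1) * H.diam ≤ b := by nlinarith
    have := H.lt_ht_of_mem_layers hreg hD n h1 d hd
    linarith
  -- The index of the first layer that contains the face. The value 0 of `sInf ∅` plays no role,
  -- since only faces in some layer are compared.
  let dep : Q → ℕ := fun q => sInf {n | q ∈ H.layers b n}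
  have hdep_le : ∀ q n, q ∈ H.layers b n → dep q ≤ n := fun q n h => Nat.sInf_le h
  have hturn : ∀ n, n ≤ n₀ + 1 → ∀ S, H.layers b n ⊆ S → S ⊆ H.layers b (n + 1) →
      H.turning B S ≤ H.flux b := by
    intro n hn S h1 h2
    refine H.turning_le_flux hreg B hB S (fun d hd => hht (n + 1) (by omega) d (h2 hd))
      (fun d hd => h1 (habove n d hd)) hgen dep ?_
    rintro q ⟨hq, hlow⟩
    have hmem : q ∈ H.layers b (dep q) := Nat.sInf_mem (s := {n | q ∈ H.layers b n}) ⟨n + 1, h2 hq⟩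
    have hle : dep q ≤ n + 1 := hdep_le q _ (h2 hq)
    rcases hk : dep q with _ | k
    · rw [hk] at hmem
      obtain ⟨d, hd, hbd⟩ := hmem
      exact absurd (hlow d hd) (not_lt.2 hbd.le)
    · rw [hk] at hmem
      rcases hmem with hmem | ⟨d, hd, hmem⟩
      · have := hdep_le q k hmem
        omega
      · exact ⟨d, hd, h1 (H.layers_mono b (by omega) hmem),
          lt_of_le_of_lt (hdep_le _ _ hmem) (Nat.lt_succ_self k)⟩
  have main : ∀ n, n ≤ n₀ + 1 →
      ((H.convexDarts y₀ b (H.layers b n)).ncard : ℤ) ≤ n₀ - n := by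
    intro n
    induction n with
    | zero => intro _; simp [hn₀]
    | succ n ih =>
      intro hn
      have h1 := H.ncard_convexDarts_expand_le hreg B hB (H.layers b n)
        (hht (n + 1) (by omega)) (habove n) hgen (H.flux b)
        (hturn n (by omega) _ (H.subset_expand _) subset_rfl)
        (hturn n (by omega) _ Set.subset_union_left
          (Set.union_subset (H.subset_expand _) (H.holes_subset_expand _)))
      have h2 := ih (by omega)
      have h3 : H.layers b (n + 1) = H.expand (H.layers b n) := rfl
      rw [h3]
      push_cast
      linarith
  have := main (n₀ + 1) le_rfl
  push_cast at this
  linarith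

end HexSystem

/-! ### Corner weights and monotonicity of the flux -/

namespace HexSystem

variable {Δ Q P : Type*} (H : HexSystem Δ Q)

/-- A weight that is `-2` at a lowest and at a highest corner of each face and `1` at the others. -/
def IsCornerWeight (ω : Δ → ℤ) : Prop :=
  ∀ q, ∃ m M, H.tile m = q ∧ H.tile M = q ∧ m ≠ M ∧ ω m = -2 ∧ ω M = -2 ∧
    (∀ d, H.tile d = q → d ≠ m → d ≠ M → ω d = 1) ∧
    ∀ d, H.tile d = q → H.ht m ≤ H.ht d ∧ H.ht d ≤ H.ht M

theorem exists_generic {c c' : ℝ} (h : c < c') : ∃ b, c < b ∧ b < c' ∧ ∀ d, H.ht d ≠ b := by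
  have h1 := (H.finite_band c c').image H.ht
  obtain ⟨b, hb, hb'⟩ := ((Set.Ioo_infinite h).sdiff h1).nonempty
  exact ⟨b, hb.1, hb.2, fun d hd => hb' ⟨d, ⟨hd ▸ hb.1, hd ▸ hb.2⟩, hd⟩⟩

theorem finite_crossDarts (b : ℝ) : (H.crossDarts b).Finite := by
  refine (H.finite_band (b - H.diam) b).subset fun d hd => ⟨?_, hd.1⟩
  obtain ⟨-, e, he, hbe⟩ := hd
  have := H.ht_le e d he
  linarith

theorem crossFaces_eq (b : ℝ) : H.crossFaces b = H.tile '' H.crossDarts b := by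
  ext q
  constructor
  · rintro ⟨⟨d, rfl, hd⟩, e⟩
    exact ⟨d, ⟨hd, e⟩, rfl⟩
  · rintro ⟨d, ⟨hd, e⟩, rfl⟩
    exact ⟨⟨d, rfl, hd⟩, e⟩

/-- Each crossed face owns a dart below `b`. With a bound on the number of `crossDarts`, this bounds
the flux from below. -/
theorem neg_le_flux (b : ℝ) : -3 * ((H.crossDarts b).ncard : ℤ) ≤ H.flux b := by
  have h : (H.crossFaces b).ncard ≤ (H.crossDarts b).ncard := by
    rw [H.crossFaces_eq]; exact Set.ncard_image_le (H.finite_crossDarts b)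
  unfold flux
  omega

variable {ω : Δ → ℤ} (hω : H.IsCornerWeight ω)

include hω

open Classical in
-- A whole face has weight 4 - 4 = 0. A crossed face has its lowest but not its highest corner below
-- `c`, so `k` corners there weigh `k - 3`.
theorem sum_weight_fiber (q : Q) (Y : Finset Δ) (hY : ∀ d, d ∈ Y ↔ H.tile d = q) (c : ℝ)
    (hgen : ∀ d, H.ht d ≠ c) :
    ∑ d ∈ Y with H.ht d < c, ω d =
      if q ∈ H.crossFaces c then ((Y.filter (fun d => H.ht d < c)).card : ℤ) - 3 else 0 := by
  obtain ⟨m, M, hm, hM, hmM, h1, h2, h3, h4⟩ := hω q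
  have hw : ∀ d ∈ Y, ω d = 1 - (if d = m then 3 else 0) - (if d = M then 3 else 0) := by
    intro d hd
    by_cases hdm : d = m
    · subst hdm; simp [h1, hmM]
    · by_cases hdM : d = M
      · subst hdM; simp [h2, hdm]
      · simp [hdm, hdM, h3 d ((hY d).1 hd) hdm hdM]
  have hYc : Y.card = 6 := by
    rw [← H.card_fiber q, ← Set.ncard_coe_finset]
    congr 1; ext d; simp [hY]
  rw [Finset.sum_congr rfl fun d hd => hw d (Finset.mem_filter.1 hd).1]
  simp only [Finset.sum_sub_distrib, Finset.sum_const, Finset.sum_ite_eq', Finset.mem_filter, hY,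
    hm, hM, true_and]
  by_cases ha : H.ht m < c
  · by_cases hb : H.ht M < c
    · have : q ∉ H.crossFaces c := by
        rintro ⟨-, e, he, hce⟩
        exact absurd (lt_of_le_of_lt (h4 e he).2 hb) (not_lt.2 hce.le)
      have hall : Y.filter (fun d => H.ht d < c) = Y :=
        Finset.filter_true_of_mem fun d hd => lt_of_le_of_lt (h4 d ((hY d).1 hd)).2 hb
      simp [ha, hb, this, hall, hYc]
    · have : q ∈ H.crossFaces c :=
        ⟨⟨m, hm, ha⟩, M, hM, lt_of_le_of_ne (not_lt.1 hb) (hgen M).symm⟩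
      simp [ha, hb, this]
  · have hb : ¬ H.ht M < c := fun h => ha (lt_of_le_of_lt (h4 M hM).1 h)
    have : q ∉ H.crossFaces c := by
      rintro ⟨⟨d, hd, hdc⟩, -⟩
      exact ha (lt_of_le_of_lt (h4 d hd).1 hdc)
    have hnone : Y.filter (fun d => H.ht d < c) = ∅ :=
      Finset.filter_false_of_mem fun d hd h => ha (lt_of_le_of_lt (h4 d ((hY d).1 hd)).1 h)
    simp [ha, hb, this, hnone]

open Classical in
-- Faces that are not crossed contribute 0, so `W` may be enlarged at will; this allows two heights
-- to be compared on the same `W`.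
theorem flux_eq_sum (W : Finset Q) (Y : Finset Δ) (hY : ∀ d, d ∈ Y ↔ H.tile d ∈ W) (c : ℝ)
    (hgen : ∀ d, H.ht d ≠ c) (hW : H.crossFaces c ⊆ W) :
    H.flux c = ∑ d ∈ Y with H.ht d < c, ω d := by
  have hmaps : ∀ d ∈ Y.filter (fun d => H.ht d < c), H.tile d ∈ W :=
    fun d hd => (hY d).1 (Finset.mem_filter.1 hd).1
  rw [← Finset.sum_fiberwise_of_maps_to hmaps]
  have h1 : ∀ q ∈ W, ∑ d ∈ (Y.filter fun d => H.ht d < c) with H.tile d = q, ω d =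
      if q ∈ H.crossFaces c then
        ((((Y.filter fun d => H.tile d = q).filter fun d => H.ht d < c).card : ℤ) - 3)
      else 0 := by
    intro q hq
    rw [← H.sum_weight_fiber hω q (Y.filter fun d => H.tile d = q) (by
      intro d
      simp only [Finset.mem_filter, hY]
      exact ⟨fun h => h.2, fun h => ⟨h ▸ hq, h⟩⟩) c hgen]
    rw [Finset.filter_comm]
  rw [Finset.sum_congr rfl h1, ← Finset.sum_filter]
  have hX : ((W.filter fun q => q ∈ H.crossFaces c : Finset Q) : Set Q) = H.crossFaces c := by
    ext q; simp only [Finset.coe_filter, Set.mem_ofPred_eq]; exact ⟨fun h => h.2, fun h => ⟨hW h, h⟩⟩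
  unfold flux
  rw [Finset.sum_sub_distrib, Finset.sum_const, ← Set.ncard_coe_finset
    (W.filter fun q => q ∈ H.crossFaces c), hX]
  have hC : H.crossDarts c = ((Y.filter fun d => H.ht d < c ∧ H.tile d ∈ H.crossFaces c :
      Finset Δ) : Set Δ) := by
    ext d
    simp only [Finset.coe_filter, Set.mem_ofPred_eq, hY]
    constructor
    · rintro ⟨h1, h2⟩
      have : H.tile d ∈ H.crossFaces c := ⟨⟨d, rfl, h1⟩, h2⟩
      exact ⟨hW this, h1, this⟩
    · rintro ⟨-, h1, -, h2⟩
      exact ⟨h1, h2⟩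
  rw [hC, Set.ncard_coe_finset, Finset.card_eq_sum_card_fiberwise
    (t := W.filter fun q => q ∈ H.crossFaces c) (f := H.tile)]
  · push_cast
    have : ∀ q ∈ W.filter fun q => q ∈ H.crossFaces c,
        (((Y.filter fun d => H.ht d < c ∧ H.tile d ∈ H.crossFaces c).filter
          fun d => H.tile d = q).card : ℤ) =
        ((Y.filter fun d => H.tile d = q).filter fun d => H.ht d < c).card := by
      intro q hq
      congr 2
      ext d
      simp only [Finset.mem_filter] at hq ⊢
      constructor
      · rintro ⟨⟨h1, h2, h3⟩, h4⟩; exact ⟨⟨h1, h4⟩, h2⟩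
      · rintro ⟨⟨h1, h4⟩, h2⟩; exact ⟨⟨h1, h2, h4 ▸ hq.2⟩, h4⟩
    rw [Finset.sum_congr rfl this]
    simp; ring
  · intro d hd
    simp only [Finset.coe_filter, Set.mem_ofPred_eq, hY] at hd ⊢
    exact ⟨hd.1, hd.2.2⟩

theorem flux_sub_flux {b₀ b : ℝ} (hb : b₀ ≤ b) (hgen₀ : ∀ d, H.ht d ≠ b₀)
    (hgen : ∀ d, H.ht d ≠ b) :
    H.flux b - H.flux b₀ = ∑ d ∈ (H.finite_band b₀ b).toFinset, ω d := by
  classical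
  let W : Finset Q := (((H.finite_crossDarts b₀).union (H.finite_crossDarts b)).union
    (H.finite_band b₀ b)).toFinset.image H.tile
  have hWY : {d | H.tile d ∈ W}.Finite := by
    have : {d | H.tile d ∈ W} = ⋃ q ∈ W, {d | H.tile d = q} := by ext d; simp
    rw [this]
    exact W.finite_toSet.biUnion fun q _ => H.finite_fiber q
  have hY : ∀ d, d ∈ hWY.toFinset ↔ H.tile d ∈ W := fun d => by simp
  have hsub : ∀ c, c = b₀ ∨ c = b → H.crossFaces c ⊆ W := by
    rintro c hc q hq
    rw [H.crossFaces_eq] at hq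
    obtain ⟨d, hd, rfl⟩ := hq
    simp only [W, Finset.coe_image, Set.Finite.coe_toFinset]
    refine ⟨d, ?_, rfl⟩
    rcases hc with rfl | rfl
    · exact Or.inl (Or.inl hd)
    · exact Or.inl (Or.inr hd)
  rw [H.flux_eq_sum hω W _ hY b hgen (hsub b (Or.inr rfl)),
    H.flux_eq_sum hω W _ hY b₀ hgen₀ (hsub b₀ (Or.inl rfl)), sub_eq_iff_eq_add]
  rw [← Finset.sum_union]
  · refine Finset.sum_congr ?_ fun _ _ => rfl
    ext d
    simp only [Finset.mem_filter, Finset.mem_union, hY, Set.Finite.mem_toFinset, Set.mem_ofPred_eq]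
    constructor
    · rintro ⟨h1, h2⟩
      rcases lt_or_gt_of_ne (hgen₀ d) with h | h
      · exact Or.inr ⟨h1, h⟩
      · exact Or.inl ⟨h, h2⟩
    · rintro (⟨h1, h2⟩ | ⟨h1, h2⟩)
      · refine ⟨Finset.mem_image.2 ⟨d, ?_, rfl⟩, h2⟩
        rw [Set.Finite.mem_toFinset]
        exact Or.inr ⟨h1, h2⟩
      · exact ⟨h1, h2.trans_le hb⟩
  · rw [Finset.disjoint_left]
    intro d hd hd'
    simp only [Finset.mem_filter, Set.Finite.mem_toFinset, Set.mem_ofPred_eq] at hd hd'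
    linarith [hd.1, hd'.2]

variable {vert : Δ → P} (hvert : ∀ d e, vert d = vert e → H.ht d = H.ht e)
  (hle : ∀ d, ∑ᶠ e ∈ {e | vert e = vert d}, ω e ≤ 0)

include hvert hle

/-- Darts at one vertex have the same height, so a band contains all or none of them and its weights
can be summed vertex by vertex. -/
theorem flux_le_sub {b₀ b : ℝ} (hb : b₀ ≤ b) (hgen₀ : ∀ d, H.ht d ≠ b₀) (hgen : ∀ d, H.ht d ≠ b) :
    H.flux b ≤ H.flux b₀ ∧ ∀ d, b₀ < H.ht d → H.ht d < b →
      ∑ᶠ e ∈ {e | vert e = vert d}, ω e ≠ 0 → H.flux b < H.flux b₀ := by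
  classical
  set B := (H.finite_band b₀ b).toFinset with hB
  have hmem : ∀ d, d ∈ B ↔ b₀ < H.ht d ∧ H.ht d < b := fun d => by simp [hB]
  have h1 := H.flux_sub_flux hω hb hgen₀ hgen
  rw [← hB, ← Finset.sum_fiberwise_of_maps_to
    (fun d hd => Finset.mem_image_of_mem vert hd : ∀ d ∈ B, vert d ∈ B.image vert)] at h1
  have h2 : ∀ d ∈ B, ∑ e ∈ B with vert e = vert d, ω e =
      ∑ᶠ e ∈ {e | vert e = vert d}, ω e := by
    intro d hd
    rw [finsum_mem_eq_finite_toFinset_sum]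
    swap
    · refine (H.finite_band b₀ b).subset fun e he => ?_
      have := (hmem d).1 hd
      rwa [← hvert e d he] at this
    refine Finset.sum_congr ?_ fun _ _ => rfl
    ext e
    simp only [Finset.mem_filter, Set.Finite.mem_toFinset, Set.mem_ofPred_eq]
    refine ⟨fun h => h.2, fun h => ⟨?_, h⟩⟩
    rw [hmem, hvert e d h]
    exact (hmem d).1 hd
  have h3 : ∀ p ∈ B.image vert, ∑ e ∈ B with vert e = p, ω e ≤ 0 := by
    intro p hp
    obtain ⟨d, hd, rfl⟩ := Finset.mem_image.1 hp
    rw [h2 d hd]; exact hle d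
  refine ⟨by have := Finset.sum_nonpos h3; linarith, fun d hd hd' hne => ?_⟩
  have hdB := (hmem d).2 ⟨hd, hd'⟩
  have := Finset.sum_neg' h3 ⟨vert d, Finset.mem_image_of_mem _ hdB, by
    rw [h2 d hdB]; exact lt_of_le_of_ne (hle d) hne⟩
  linarith

/-- The flux is nonnegative when vertices are regular wherever the weights at them cancel. -/
theorem flux_nonneg (hD : 0 ≤ H.diam) (K : ℝ) (N : ℕ) (hN : ∀ b, (H.crossDarts b).ncard ≤ N)
    (hreg : ∀ y₀, (∀ d, y₀ < H.ht d → ∑ᶠ e ∈ {e | vert e = vert d}, ω e = 0) →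
      H.RegularAbove (y₀ + K)) (b : ℝ) (hgen : ∀ d, H.ht d ≠ b) : 0 ≤ H.flux b := by
  by_contra! hneg
  have hbound : ∀ c, -3 * (N : ℤ) ≤ H.flux c := fun c => by
    have := H.neg_le_flux c
    have := hN c
    omega
  -- Otherwise there are vertices of negative weight arbitrarily high up, and the flux drops by at
  -- least 1 again and again, past its lower bound.
  obtain ⟨y₀, hy₀⟩ : ∃ y₀, ∀ d, y₀ < H.ht d → ∑ᶠ e ∈ {e | vert e = vert d}, ω e = 0 := by
    by_contra! hcon
    have : ∀ n : ℕ, ∃ c, (∀ d, H.ht d ≠ c) ∧ H.flux c ≤ -(n : ℤ) := by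
      intro n
      induction n with
      | zero => exact ⟨b, hgen, by push_cast; linarith⟩
      | succ n ih =>
        obtain ⟨c, hc, hcf⟩ := ih
        obtain ⟨d, hd, hdne⟩ := hcon c
        obtain ⟨c', h1, -, h3⟩ := H.exists_generic (lt_add_one (H.ht d))
        refine ⟨c', h3, ?_⟩
        have := (H.flux_le_sub hω hvert hle (hd.trans h1).le hc h3).2 d hd h1 hdne
        push_cast; linarith
    obtain ⟨c, -, hc⟩ := this (3 * N + 1)
    have := hbound c
    push_cast at hc
    linarith
  have hr := hreg y₀ hy₀
  obtain ⟨c, hc, -, hcgen⟩ := H.exists_generic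
    (lt_add_one (max b (y₀ + K + (N + 3) * H.diam)))
  have h1 := le_max_left b (y₀ + K + (N + 3) * H.diam)
  have h2 := le_max_right b (y₀ + K + (N + 3) * H.diam)
  have h3 := (H.flux_le_sub hω hvert hle (h1.trans hc.le) hgen hcgen).1
  -- The faces of the starting region with corners below `c` cross height `c`. So `N` bounds the
  -- convex darts whatever `c` is, and `c` could be chosen in advance.
  have h4 : (H.convexDarts (y₀ + K) c (H.layers c 0)).ncard ≤ N := by
    refine le_trans (Set.ncard_le_ncard ?_ (H.finite_crossDarts c)) (hN c)
    rintro d ⟨-, h5, ⟨e, he, hce⟩, -⟩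
    exact ⟨h5, e, he, hce⟩
  have h4' : ((H.convexDarts (y₀ + K) c (H.layers c 0)).ncard : ℝ) ≤ N := by exact_mod_cast h4
  have h5 := H.flux_nonneg_of_regularAbove hr hD hcgen (by nlinarith)
  linarith

end HexSystem

/-! ### Orientation in the plane and convex polygons -/

/-- The cross product of two vectors of the plane. -/
def cr (x y : Plane) : ℝ := x 0 * y 1 - x 1 * y 0

theorem cr_add_left (x y z : Plane) : cr (x + y) z = cr x z + cr y z := by
  simp only [cr, PiLp.add_apply]; ring

theorem cr_add_right (x y z : Plane) : cr x (y + z) = cr x y + cr x z := by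
  simp only [cr, PiLp.add_apply]; ring

theorem cr_sub_right (x y z : Plane) : cr x (y - z) = cr x y - cr x z := by
  simp only [cr, PiLp.sub_apply]; ring

theorem cr_smul_left (t : ℝ) (x y : Plane) : cr (t • x) y = t * cr x y := by
  simp only [cr, PiLp.smul_apply, smul_eq_mul]; ring

theorem cr_smul_right (t : ℝ) (x y : Plane) : cr x (t • y) = t * cr x y := by
  simp only [cr, PiLp.smul_apply, smul_eq_mul]; ring

theorem cr_self (x : Plane) : cr x x = 0 := by simp only [cr]; ring

theorem cr_swap (x y : Plane) : cr y x = -cr x y := by simp only [cr]; ring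

theorem cr_neg_left (x y : Plane) : cr (-x) y = -cr x y := by
  simp only [cr, PiLp.neg_apply]; ring

/-- The orientation of the triangle `abc`. -/
def ori (a b c : Plane) : ℝ := cr (b - a) (c - a)

theorem ori_rotate (a b c : Plane) : ori b c a = ori a b c := by
  simp only [ori, cr, PiLp.sub_apply]; ring

theorem ori_swap (a b c : Plane) : ori b a c = -ori a b c := by
  simp only [ori, cr, PiLp.sub_apply]; ring

theorem ori_swap_right (a b c : Plane) : ori a c b = -ori a b c := by
  simp only [ori, cr, PiLp.sub_apply]; ring

theorem continuous_ori (a b : Plane) : Continuous (ori a b) := by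
  unfold ori cr; fun_prop

/-- Cramer's rule, without division. -/
theorem cr_smul_add (x y z : Plane) : cr x y • z = cr z y • x + cr x z • y := by
  ext i
  fin_cases i <;> simp [cr] <;> ring

theorem eq_smul_of_cr_eq_zero {x y : Plane} (hx : x ≠ 0) (h : cr x y = 0) : ∃ t : ℝ, y = t • x := by
  have h1 : x 0 ≠ 0 ∨ x 1 ≠ 0 := by
    by_contra! hc
    exact hx (by ext i; fin_cases i <;> simp [hc])
  simp only [cr] at h
  rcases h1 with h1 | h1
  · refine ⟨y 0 / x 0, ?_⟩
    ext i; fin_cases i <;> simp <;> field_simp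
    linarith
  · refine ⟨y 1 / x 1, ?_⟩
    ext i; fin_cases i <;> simp <;> field_simp
    linarith

theorem mem_openSegment_of_smul {a b : Plane} {t : ℝ} (h0 : 0 < t) (h1 : t < 1) :
    a + t • (b - a) ∈ openSegment ℝ a b :=
  ⟨1 - t, t, by linarith, h0, by ring, by module⟩

/-- A point on the line `ab` that is not on the segment puts an end of it between two points. -/
theorem mem_segment_of_ori_eq_zero {a b x : Plane} (hab : a ≠ b) (h : ori a b x = 0)
    (ha : a ∉ openSegment ℝ x b) (hb : b ∉ openSegment ℝ a x) : x ∈ segment ℝ a b := by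
  obtain ⟨t, ht⟩ := eq_smul_of_cr_eq_zero (sub_ne_zero.2 hab.symm) h
  have hx : x = a + t • (b - a) := by rw [← ht]; abel
  by_cases h0 : t < 0
  · refine absurd ⟨1 / (1 - t), -t / (1 - t), by apply div_pos <;> linarith,
      by apply div_pos <;> linarith, by rw [← add_div, div_eq_one_iff_eq] <;> linarith, ?_⟩ ha
    have : (1 - t) ≠ 0 := by linarith
    rw [hx]
    ext i
    simp
    field_simp
    ring
  by_cases h1 : 1 < t
  · refine absurd ⟨(t - 1) / t, 1 / t, by apply div_pos <;> linarith,
      by apply div_pos <;> linarith, by rw [← add_div, div_eq_one_iff_eq] <;> linarith, ?_⟩ hb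
    have : t ≠ 0 := by linarith
    rw [hx]
    ext i
    simp
    field_simp
    ring
  · exact ⟨1 - t, t, by linarith, by linarith, by ring, by rw [hx]; module⟩

section Triangle

variable {T : Set Plane} (hT : Convex ℝ T) {a b c : Plane} (ha : a ∈ T) (hb : b ∈ T) (hc : c ∈ T)

include hT ha hb hc

/-- The orientations of the three subtriangles at `x`, divided by that of `abc`, are barycentric
coordinates of `x`. -/
theorem mem_of_ori_nonneg (h : 0 < ori a b c) {x : Plane} (h1 : 0 ≤ ori a b x)
    (h2 : 0 ≤ ori b c x) (h3 : 0 ≤ ori c a x) : x ∈ T := by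
  have hsum : ori a b x + ori b c x + ori c a x = ori a b c := by
    simp only [ori, cr, PiLp.sub_apply]; ring
  have hx : x = (ori b c x / ori a b c) • a + (ori c a x / ori a b c) • b
      + (ori a b x / ori a b c) • c := by
    have hne : ori a b c ≠ 0 := h.ne'
    ext i
    simp only [PiLp.add_apply, PiLp.smul_apply, smul_eq_mul]
    field_simp
    simp only [ori, cr, PiLp.sub_apply]
    fin_cases i <;> simp <;> ring
  rw [hx]
  have := hT.sum_mem (t := Finset.univ)
    (w := ![ori b c x / ori a b c, ori c a x / ori a b c, ori a b x / ori a b c]) (z := ![a, b, c])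
    (by
      intro i _
      fin_cases i <;> simp <;> positivity)
    (by
      simp [Fin.sum_univ_three]
      rw [← add_div, ← add_div, div_eq_one_iff_eq h.ne']
      linarith)
    (by intro i _; fin_cases i <;> simpa)
  simpa [Fin.sum_univ_three] using this

theorem mem_interior_of_ori_pos (h : 0 < ori a b c) {x : Plane} (h1 : 0 < ori a b x)
    (h2 : 0 < ori b c x) (h3 : 0 < ori c a x) : x ∈ interior T := by
  rw [mem_interior]
  refine ⟨{x | 0 < ori a b x} ∩ {x | 0 < ori b c x} ∩ {x | 0 < ori c a x}, ?_, ?_, ⟨h1, h2⟩, h3⟩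
  · rintro y ⟨⟨h1, h2⟩, h3⟩
    exact mem_of_ori_nonneg hT ha hb hc h (le_of_lt h1) (le_of_lt h2) (le_of_lt h3)
  · exact ((isOpen_lt continuous_const (continuous_ori a b)).inter
      (isOpen_lt continuous_const (continuous_ori b c))).inter
      (isOpen_lt continuous_const (continuous_ori c a))

theorem interior_nonempty_of_ori_pos (h : 0 < ori a b c) : (interior T).Nonempty := by
  refine ⟨(1 / 3 : ℝ) • (a + b + c), mem_interior_of_ori_pos hT ha hb hc h ?_ ?_ ?_⟩ <;>
  · have : ori a b c / 3 > 0 := by linarith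
    refine lt_of_lt_of_eq this ?_
    simp only [ori, cr, PiLp.sub_apply, PiLp.smul_apply, PiLp.add_apply, smul_eq_mul]
    ring

/-- Moving from inside of the segment `ab` to the side of `c`, one enters the interior. -/
theorem exists_mem_interior_of_openSegment (h : 0 < ori a b c) {z w : Plane}
    (hz : z ∈ openSegment ℝ a b) (hw : 0 < ori a b w) :
    ∃ ε > 0, ∀ δ : ℝ, 0 < δ → δ < ε → z + δ • (w - z) ∈ interior T := by
  obtain ⟨s, t, hs, ht, hst, rfl⟩ := hz
  set z := s • a + t • b with hzdef
  have e1 : ∀ δ : ℝ, ori a b (z + δ • (w - z)) = δ * ori a b w := fun δ => by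
    have : t = 1 - s := by linarith
    subst this
    simp only [hzdef, ori, cr, PiLp.sub_apply, PiLp.smul_apply, PiLp.add_apply, smul_eq_mul]
    ring
  have e2 : ∀ δ : ℝ, ori b c (z + δ • (w - z)) = s * ori a b c + δ * (ori b c w - s * ori a b c) :=
    fun δ => by
    have : t = 1 - s := by linarith
    subst this
    simp only [hzdef, ori, cr, PiLp.sub_apply, PiLp.smul_apply, PiLp.add_apply, smul_eq_mul]
    ring
  have e3 : ∀ δ : ℝ, ori c a (z + δ • (w - z)) = t * ori a b c + δ * (ori c a w - t * ori a b c) :=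
    fun δ => by
    have : s = 1 - t := by linarith
    subst this
    simp only [hzdef, ori, cr, PiLp.sub_apply, PiLp.smul_apply, PiLp.add_apply, smul_eq_mul]
    ring
  have small : ∀ A B : ℝ, 0 < A → ∃ ε > 0, ∀ δ, 0 < δ → δ < ε → 0 < A + δ * B := by
    intro A B hA
    refine ⟨A / (|B| + 1), by positivity, fun δ h0 h1 => ?_⟩
    rw [lt_div_iff₀ (by positivity)] at h1
    nlinarith [neg_abs_le B]
  obtain ⟨ε₂, hε₂, h2⟩ := small _ (ori b c w - s * ori a b c) (mul_pos hs h)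
  obtain ⟨ε₃, hε₃, h3⟩ := small _ (ori c a w - t * ori a b c) (mul_pos ht h)
  refine ⟨min ε₂ ε₃, lt_min hε₂ hε₃, fun δ h0 h1 => ?_⟩
  refine mem_interior_of_ori_pos hT ha hb hc h ?_ ?_ ?_
  · rw [e1]; positivity
  · rw [e2]; exact h2 δ h0 (h1.trans_le (min_le_left _ _))
  · rw [e3]; exact h3 δ h0 (h1.trans_le (min_le_right _ _))

end Triangle

theorem Convex.subset_closure_interior {T : Set Plane} (hT : Convex ℝ T)
    (hne : (interior T).Nonempty) : T ⊆ closure (interior T) := by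
  rw [hT.closure_interior_eq_closure_of_nonempty_interior hne]
  exact subset_closure

/-- A convex set that meets the segment `ab` and does not overlap with the triangle `abc` stays on
the other side of the line `ab`. -/
theorem ori_nonpos_of_disjoint {T T' : Set Plane} (hT : Convex ℝ T) (hT' : Convex ℝ T')
    (hne : (interior T').Nonempty) (hdisj : Disjoint (interior T) (interior T')) {a b c z w : Plane}
    (ha : a ∈ T) (hb : b ∈ T) (hc : c ∈ T) (h : 0 < ori a b c) (hz : z ∈ openSegment ℝ a b)
    (hzT' : z ∈ T') (hw : w ∈ T') : ori a b w ≤ 0 := by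
  -- Move `w` into the interior of `T'`, still beyond the line. Close to `z`, the segment from `z`
  -- to it runs in both interiors.
  by_contra! hpos
  have hcl := hT'.subset_closure_interior hne hw
  obtain ⟨w', hw'1, hw'2⟩ := mem_closure_iff.1 hcl {x | 0 < ori a b x}
    (isOpen_lt continuous_const (continuous_ori a b)) hpos
  obtain ⟨ε, hε, hin⟩ := exists_mem_interior_of_openSegment hT ha hb hc h hz hw'1
  set δ := min (ε / 2) 1 with hδ
  have hδ0 : 0 < δ := lt_min (by linarith) one_pos
  have hδε : δ < ε := (min_le_left _ _).trans_lt (by linarith)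
  have h2 := hT'.add_smul_sub_mem_interior hzT' hw'2 ⟨hδ0, min_le_right _ _⟩
  exact Set.disjoint_left.1 hdisj (hin δ hδ0 hδε) h2

/-- A convex polygon: the convex hull of its finitely many, at least three extreme points. -/
structure IsPolygon (T : Set Plane) : Prop where
  finite : (T.extremePoints ℝ).Finite
  three_le : 3 ≤ (T.extremePoints ℝ).ncard
  eq_hull : T = convexHull ℝ (T.extremePoints ℝ)

/-- If one of the points were not extreme, then by Krein-Milman the hull would be spanned by the
others, against convex independence. -/
theorem IsConvexPolygon.isPoly {n : ℕ} {T : Set Plane} (h : IsConvexPolygon n T) :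
    IsPolygon T ∧ (T.extremePoints ℝ).ncard = n := by
  obtain ⟨hn, A, hA, rfl⟩ := h
  have hext : (convexHull ℝ (Set.range A)).extremePoints ℝ = Set.range A := by
    refine Set.Subset.antisymm extremePoints_convexHull_subset ?_
    have hind : ConvexIndependent ℝ ((↑) : Set.range A → Plane) := hA.range
    rw [convexIndependent_set_iff_notMem_convexHull_sdiff] at hind
    intro x hx
    by_contra hxe
    refine hind x hx ?_
    have h1 := closure_convexHull_extremePoints ((Set.finite_range A).isCompact_convexHull ℝ)
      (convex_convexHull ℝ (Set.range A))
    have h2 : convexHull ℝ ((convexHull ℝ (Set.range A)).extremePoints ℝ) ⊆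
        convexHull ℝ (Set.range A \ {x}) :=
      convexHull_mono fun y hy => ⟨extremePoints_convexHull_subset hy, fun hyx => hxe (hyx ▸ hy)⟩
    have h3 : IsClosed (convexHull ℝ (Set.range A \ {x})) :=
      ((Set.finite_range A).subset Set.sdiff_subset).isCompact_convexHull ℝ |>.isClosed
    refine closure_minimal h2 h3 ?_
    rw [h1]
    exact subset_convexHull ℝ _ hx
  have hcard : (Set.range A).ncard = n := by
    rw [← Set.image_univ, hA.injective.injOn.ncard_image, Set.ncard_univ, Nat.card_fin]
  exact ⟨⟨by rw [hext]; exact Set.finite_range A, by rw [hext, hcard]; exact hn, by rw [hext]⟩,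
    by rw [hext, hcard]⟩

/-- The corner `b` follows the corner `a` in counterclockwise order. -/
def IsNext (T : Set Plane) (a b : Plane) : Prop :=
  IsCornerOf T a ∧ IsCornerOf T b ∧ a ≠ b ∧
    ∀ c, IsCornerOf T c → c ≠ a → c ≠ b → 0 < ori a b c

theorem IsCornerOf.mem {T : Set Plane} {a : Plane} (h : IsCornerOf T a) : a ∈ T := h.1

theorem IsCornerOf.notMem_openSegment {T : Set Plane} {a x y : Plane} (h : IsCornerOf T a)
    (hx : x ∈ T) (hy : y ∈ T) (hxy : x ≠ y) : a ∉ openSegment ℝ x y := by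
  intro hs
  have h1 := h.2 hx hy hs
  rw [openSegment_symm] at hs
  exact hxy (h1.trans (h.2 hy hx hs).symm)

theorem IsCornerOf.mem_segment {T : Set Plane} {a b x : Plane} (ha : IsCornerOf T a)
    (hb : IsCornerOf T b) (hab : a ≠ b) (hx : x ∈ T) (h : ori a b x = 0) : x ∈ segment ℝ a b := by
  by_cases hxa : x = a
  · rw [hxa]; exact left_mem_segment ℝ a b
  by_cases hxb : x = b
  · rw [hxb]; exact right_mem_segment ℝ a b
  exact mem_segment_of_ori_eq_zero hab h (ha.notMem_openSegment hx hb.mem hxb)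
    (hb.notMem_openSegment ha.mem hx (Ne.symm hxa))

theorem IsCornerOf.ori_ne_zero {T : Set Plane} {a b c : Plane} (ha : IsCornerOf T a)
    (hb : IsCornerOf T b) (hc : IsCornerOf T c) (hab : a ≠ b) (hac : a ≠ c) (hbc : b ≠ c) :
    ori a b c ≠ 0 := fun h => by
  have h1 := ha.mem_segment hb hab hc.mem h
  rw [← insert_endpoints_openSegment] at h1
  rcases h1 with h1 | h1 | h1
  · exact hac h1.symm
  · exact hbc h1.symm
  · exact hc.notMem_openSegment ha.mem hb.mem hab h1

/-- Among finitely many directions in an open half-plane, one is the most clockwise. -/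
theorem exists_rightmost {X : Set Plane} (hX : X.Finite) (hne : X.Nonempty) (a : Plane)
    (f : Plane →ₗ[ℝ] ℝ) (hf : ∀ x ∈ X, f a < f x) : ∃ m ∈ X, ∀ x ∈ X, 0 ≤ ori a m x := by
  obtain ⟨u, hu⟩ := hne
  -- Central projection from `a` to a line where `f (x - a)` is constant; the quotient is a
  -- coordinate on it that grows counterclockwise.
  obtain ⟨m, hm, hmin⟩ := Set.exists_min_image X (fun x => cr (u - a) (x - a) / f (x - a)) hX ⟨u, hu⟩
  refine ⟨m, hm, fun x hx => ?_⟩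
  have h1 := hmin x hx
  have hpos : ∀ x ∈ X, 0 < f (x - a) := fun x hx => by
    rw [map_sub]; linarith [hf x hx]
  rw [div_le_div_iff₀ (hpos m hm) (hpos x hx)] at h1
  have key := congrArg f (cr_smul_add (m - a) (x - a) (u - a))
  simp only [map_add, map_smul, smul_eq_mul] at key
  have h2 : 0 ≤ cr (m - a) (x - a) * f (u - a) := by
    rw [key, cr_swap (u - a) (m - a)]; linarith
  exact nonneg_of_mul_nonneg_left h2 (hpos u hu)

theorem exists_leftmost {X : Set Plane} (hX : X.Finite) (hne : X.Nonempty) (a : Plane)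
    (f : Plane →ₗ[ℝ] ℝ) (hf : ∀ x ∈ X, f a < f x) : ∃ m ∈ X, ∀ x ∈ X, ori a m x ≤ 0 := by
  obtain ⟨u, hu⟩ := hne
  obtain ⟨m, hm, hmin⟩ := Set.exists_max_image X (fun x => cr (u - a) (x - a) / f (x - a)) hX ⟨u, hu⟩
  refine ⟨m, hm, fun x hx => ?_⟩
  have h1 := hmin x hx
  have hpos : ∀ x ∈ X, 0 < f (x - a) := fun x hx => by
    rw [map_sub]; linarith [hf x hx]
  rw [div_le_div_iff₀ (hpos x hx) (hpos m hm)] at h1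
  have key := congrArg f (cr_smul_add (m - a) (x - a) (u - a))
  simp only [map_add, map_smul, smul_eq_mul] at key
  have h2 : cr (m - a) (x - a) * f (u - a) ≤ 0 := by
    rw [key, cr_swap (u - a) (m - a)]; linarith
  exact nonpos_of_mul_nonpos_left h2 (hpos u hu)

namespace IsPolygon

variable {T : Set Plane} (hT : IsPolygon T)

include hT

theorem convex : Convex ℝ T := by rw [hT.eq_hull]; exact convex_convexHull ℝ _

theorem isCompact : IsCompact T := by rw [hT.eq_hull]; exact hT.finite.isCompact_convexHull ℝ

/-- By Hahn-Banach the other corners lie in an open half-plane as seen from `a`, as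
`exists_rightmost` and `exists_leftmost` require. -/
theorem exists_functional {a : Plane} (ha : IsCornerOf T a) :
    ∃ f : Plane →ₗ[ℝ] ℝ, ∀ x ∈ T.extremePoints ℝ \ {a}, f a < f x := by
  have h1 : a ∉ convexHull ℝ (T.extremePoints ℝ \ {a}) := by
    have := hT.convex.mem_extremePoints_iff_mem_sdiff_convexHull_sdiff.1 ha
    exact fun h => this.2 (convexHull_mono (Set.sdiff_subset_sdiff_left extremePoints_subset) h)
  obtain ⟨f, u, h2, h3⟩ := geometric_hahn_banach_point_closed (convex_convexHull ℝ _)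
    ((hT.finite.subset Set.sdiff_subset).isCompact_convexHull ℝ).isClosed h1
  exact ⟨f.toLinearMap, fun x hx => h2.trans (h3 x (subset_convexHull ℝ _ hx))⟩

theorem exists_corner_ne (a b : Plane) : ∃ c, IsCornerOf T c ∧ c ≠ a ∧ c ≠ b := by
  by_contra! h
  have h1 : T.extremePoints ℝ ⊆ {a, b} := fun c hc => by
    by_cases hca : c = a
    · exact Or.inl hca
    · exact Or.inr (h c hc hca)
  have := (Set.ncard_le_ncard h1 (by simp)).trans (Set.ncard_insert_le a {b})
  rw [Set.ncard_singleton] at this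
  have := hT.three_le
  omega

theorem exists_next {a : Plane} (ha : IsCornerOf T a) : ∃ b, IsNext T a b := by
  obtain ⟨f, hf⟩ := hT.exists_functional ha
  obtain ⟨c, hc, hca, -⟩ := hT.exists_corner_ne a a
  obtain ⟨m, hm, h⟩ := exists_rightmost (hT.finite.subset Set.sdiff_subset) ⟨c, hc, hca⟩ a f hf
  exact ⟨m, ha, hm.1, fun h => hm.2 h.symm, fun x hx hxa hxm =>
    lt_of_le_of_ne (h x ⟨hx, hxa⟩) (ha.ori_ne_zero hm.1 hx (fun h => hm.2 h.symm) (Ne.symm hxa)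
      (Ne.symm hxm)).symm⟩

theorem exists_prev {a : Plane} (ha : IsCornerOf T a) : ∃ b, IsNext T b a := by
  obtain ⟨f, hf⟩ := hT.exists_functional ha
  obtain ⟨c, hc, hca, -⟩ := hT.exists_corner_ne a a
  obtain ⟨m, hm, h⟩ := exists_leftmost (hT.finite.subset Set.sdiff_subset) ⟨c, hc, hca⟩ a f hf
  refine ⟨m, hm.1, ha, hm.2, fun x hx hxm hxa => ?_⟩
  have h1 := h x ⟨hx, hxa⟩
  have h2 := ha.ori_ne_zero hm.1 hx (fun h => hm.2 h.symm) (Ne.symm hxa) (Ne.symm hxm)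
  rw [ori_swap]
  have := lt_of_le_of_ne h1 h2
  linarith

theorem interior_nonempty : (interior T).Nonempty := by
  obtain ⟨a, ha, -⟩ := hT.exists_corner_ne 0 0
  obtain ⟨b, hb⟩ := hT.exists_next ha
  obtain ⟨c, hc, hca, hcb⟩ := hT.exists_corner_ne a b
  exact interior_nonempty_of_ori_pos hT.convex ha.mem hb.2.1.mem hc.mem (hb.2.2.2 c hc hca hcb)

/-- A closed set of corners under passing to the next one is everything. -/
theorem corner_mem_of_closed {C : Set Plane} (hC : ∀ x ∈ C, IsCornerOf T x)
    (hnext : ∀ a ∈ C, ∀ b, IsNext T a b → b ∈ C) (hne : C.Nonempty) {c : Plane}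
    (hc : IsCornerOf T c) : c ∈ C := by
  by_contra hcC
  obtain ⟨f, hf⟩ := hT.exists_functional hc
  have hCc : C ⊆ T.extremePoints ℝ \ {c} := fun x hx => ⟨hC x hx, fun h => hcC (h ▸ hx)⟩
  -- Seen from the missing corner `c`, the successor of the leftmost corner in `C` would lie still
  -- further left.
  obtain ⟨m, hm, h⟩ := exists_leftmost (hT.finite.subset hC) hne c f fun x hx => hf x (hCc hx)
  obtain ⟨b, hb⟩ := hT.exists_next (hC m hm)
  have hbC := hnext m hm b hb
  have h1 := hb.2.2.2 c hc (fun h => hcC (h ▸ hm)) (fun h => hcC (h ▸ hbC))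
  have h2 := h b hbC
  rw [← ori_rotate] at h2
  linarith

end IsPolygon

theorem IsNext.right_unique {T : Set Plane} {a b b' : Plane} (h : IsNext T a b)
    (h' : IsNext T a b') : b = b' := by
  by_contra hne
  have h1 := h.2.2.2 b' h'.2.1 h'.2.2.1.symm (Ne.symm hne)
  have h2 := h'.2.2.2 b h.2.1 h.2.2.1.symm hne
  rw [ori_swap_right] at h2
  linarith

theorem IsNext.left_unique {T : Set Plane} {a a' b : Plane} (h : IsNext T a b)
    (h' : IsNext T a' b) : a = a' := by
  by_contra hne
  have h1 := h.2.2.2 a' h'.1 (Ne.symm hne) h'.2.2.1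
  have h2 := h'.2.2.2 a h.1 hne h.2.2.1
  have h3 : ori a' b a = -ori a b a' := by simp only [ori, cr, PiLp.sub_apply]; ring
  linarith

theorem IsNext.ori_nonneg {T : Set Plane} (hT : IsPolygon T) {a b x : Plane} (h : IsNext T a b)
    (hx : x ∈ T) : 0 ≤ ori a b x := by
  have h1 : Convex ℝ {x | 0 ≤ ori a b x} := by
    intro x hx y hy s t hs ht hst
    have : ori a b (s • x + t • y) = s * ori a b x + t * ori a b y := by
      have : s = 1 - t := by linarith
      subst this
      simp only [ori, cr, PiLp.sub_apply, PiLp.add_apply, PiLp.smul_apply, smul_eq_mul]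
      ring
    simp only [Set.mem_ofPred_eq] at hx hy ⊢
    rw [this]
    positivity
  rw [hT.eq_hull] at hx
  refine convexHull_min (fun c hc => ?_) h1 hx
  simp only [Set.mem_ofPred_eq]
  by_cases hca : c = a
  · subst hca; simp [ori, cr]
  by_cases hcb : c = b
  · subst hcb; simp [ori, cr_self]
  exact (h.2.2.2 c hc hca hcb).le

theorem IsNext.mem_segment {T : Set Plane} {a b x : Plane} (h : IsNext T a b)
    (hx : x ∈ T) (h0 : ori a b x = 0) : x ∈ segment ℝ a b :=
  h.1.mem_segment h.2.1 h.2.2.1 hx h0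

theorem IsNext.prev_ne_next {T : Set Plane} (hT : IsPolygon T) {a b p : Plane} (h : IsNext T a b)
    (h' : IsNext T p a) : p ≠ b := by
  rintro rfl
  obtain ⟨c, hc, hca, hcb⟩ := hT.exists_corner_ne a p
  have h1 := h.2.2.2 c hc hca hcb
  have h2 := h'.2.2.2 c hc hcb hca
  rw [ori_swap] at h2
  linarith

/-- A polygon is contained in the cone at a corner that is spanned by the adjacent corners. -/
theorem IsNext.exists_cone {T : Set Plane} (hT : IsPolygon T) {a b p x : Plane} (h : IsNext T a b)
    (h' : IsNext T p a) (hx : x ∈ T) :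
    ∃ s t : ℝ, 0 ≤ s ∧ 0 ≤ t ∧ x - a = s • (b - a) + t • (p - a) := by
  have hD : 0 < cr (b - a) (p - a) := h.2.2.2 p h'.1 h'.2.2.1 (h.prev_ne_next hT h')
  have h1 : 0 ≤ cr (b - a) (x - a) := h.ori_nonneg hT hx
  have h2 : 0 ≤ cr (x - a) (p - a) := (h'.ori_nonneg hT hx).trans_eq (ori_rotate p a x).symm
  refine ⟨cr (x - a) (p - a) / cr (b - a) (p - a), cr (b - a) (x - a) / cr (b - a) (p - a),
    by positivity, by positivity, ?_⟩
  have key := congrArg ((1 / cr (b - a) (p - a)) • ·) (cr_smul_add (b - a) (p - a) (x - a))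
  simp only [smul_add, smul_smul, one_div, inv_mul_cancel₀ hD.ne', one_smul] at key
  rw [div_eq_inv_mul, div_eq_inv_mul]
  exact key

/-! ### Local finiteness and the tiles around a point -/

/-- A tiling by hexagons that contain a disc of radius `r` and have diameter at most `D`. -/
structure IsHexTiling (𝒯 : Set (Set Plane)) (D r : ℝ) : Prop where
  cover : ∀ x, ∃ T ∈ 𝒯, x ∈ T
  disj : ∀ T ∈ 𝒯, ∀ T' ∈ 𝒯, T ≠ T' → Disjoint (interior T) (interior T')
  poly : ∀ T ∈ 𝒯, IsPolygon T
  card : ∀ T ∈ 𝒯, (T.extremePoints ℝ).ncard = 6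
  r_pos : 0 < r
  ball : ∀ T ∈ 𝒯, ∃ c, Metric.ball c r ⊆ T
  diam : ∀ T ∈ 𝒯, ∀ x ∈ T, ∀ y ∈ T, dist x y ≤ D

theorem IsTiling.exists_isHexTiling {𝒯 : Set (Set Plane)} (htiling : IsTiling 𝒯)
    (hmono : IsMonohedral 𝒯) (hhex : ∀ T ∈ 𝒯, IsConvexPolygon 6 T) :
    ∃ D r, IsHexTiling 𝒯 D r := by
  have hcover : ∀ x, ∃ T ∈ 𝒯, x ∈ T := fun x => by
    have : x ∈ ⋃₀ 𝒯 := by rw [htiling.1]; trivial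
    exact this
  obtain ⟨T₀, hT₀, -⟩ := hcover 0
  have hP := (hhex T₀ hT₀).isPoly.1
  obtain ⟨c, hc⟩ := hP.interior_nonempty
  obtain ⟨r, hr, hball⟩ := Metric.isOpen_iff.1 isOpen_interior c hc
  refine ⟨Metric.diam T₀, r, hcover, htiling.2, fun T hT => (hhex T hT).isPoly.1,
    fun T hT => (hhex T hT).isPoly.2, hr, ?_, ?_⟩
  · intro T hT
    obtain ⟨e, rfl⟩ := hmono T₀ hT₀ T hT
    refine ⟨e c, ?_⟩
    rw [← e.image_ball]
    exact Set.image_mono (hball.trans interior_subset)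
  · intro T hT
    obtain ⟨e, rfl⟩ := hmono T₀ hT₀ T hT
    rintro _ ⟨x, hx, rfl⟩ _ ⟨y, hy, rfl⟩
    rw [e.dist_eq]
    exact Metric.dist_le_diam_of_mem hP.isCompact.isBounded hx hy

namespace IsHexTiling

variable {𝒯 : Set (Set Plane)} {D r : ℝ} (h : IsHexTiling 𝒯 D r)

include h

open MeasureTheory in
-- By volume: the tiles that meet a ball of radius `R` contain disjoint discs of radius `r`, all
-- within the concentric ball of radius `R + D + r`.
theorem exists_packing (R : ℝ) : ∃ N : ℕ, ∀ x,
    {T | T ∈ 𝒯 ∧ (T ∩ Metric.ball x R).Nonempty}.Finite ∧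
    {T | T ∈ 𝒯 ∧ (T ∩ Metric.ball x R).Nonempty}.ncard ≤ N := by
  set m := volume (Metric.ball (0 : Plane) r) with hm
  set M := volume (Metric.ball (0 : Plane) (R + D + r)) with hM
  have hm0 : 0 < m := Metric.measure_ball_pos _ _ h.r_pos
  have hmtop : m ≠ ⊤ := measure_ball_lt_top.ne
  have hMtop : M ≠ ⊤ := measure_ball_lt_top.ne
  have hmr : 0 < m.toReal := ENNReal.toReal_pos hm0.ne' hmtop
  have key : ∀ x, ∀ F : Finset (Set Plane),
      (↑F ⊆ {T | T ∈ 𝒯 ∧ (T ∩ Metric.ball x R).Nonempty}) → F.card ≤ ⌊M.toReal / m.toReal⌋₊ := by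
    intro x F hF
    choose! c hc using h.ball
    have hdisj : (F : Set (Set Plane)).PairwiseDisjoint fun T => Metric.ball (c T) r := by
      intro T hT T' hT' hne
      refine (h.disj T (hF hT).1 T' (hF hT').1 hne).mono ?_ ?_
      · exact interior_maximal (hc T (hF hT).1) Metric.isOpen_ball
      · exact interior_maximal (hc T' (hF hT').1) Metric.isOpen_ball
    have hsub : (⋃ T ∈ F, Metric.ball (c T) r) ⊆ Metric.ball x (R + D + r) := by
      refine Set.iUnion₂_subset fun T hT y hy => ?_
      obtain ⟨hT𝒯, z, hzT, hzx⟩ := hF hT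
      have h1 := h.diam T hT𝒯 (c T) (hc T hT𝒯 (Metric.mem_ball_self h.r_pos)) z hzT
      have h2 := dist_triangle4 y (c T) z x
      simp only [Metric.mem_ball] at hy hzx ⊢
      linarith
    have h1 := measure_mono (μ := volume) hsub
    rw [measure_biUnion_finset hdisj fun T _ => Metric.isOpen_ball.measurableSet] at h1
    simp only [Measure.addHaar_ball_center volume _] at h1
    rw [← hm, ← hM, Finset.sum_const, nsmul_eq_mul] at h1
    have h2 := ENNReal.toReal_mono hMtop h1
    rw [ENNReal.toReal_mul, ENNReal.toReal_natCast] at h2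
    exact Nat.le_floor ((le_div_iff₀ hmr).2 h2)
  refine ⟨⌊M.toReal / m.toReal⌋₊, fun x => ?_⟩
  have hfin : {T | T ∈ 𝒯 ∧ (T ∩ Metric.ball x R).Nonempty}.Finite := by
    by_contra hinf
    obtain ⟨F, hF, hcard⟩ := Set.Infinite.exists_subset_card_eq hinf (⌊M.toReal / m.toReal⌋₊ + 1)
    have := key x F hF
    omega
  refine ⟨hfin, ?_⟩
  rw [Set.ncard_eq_toFinset_card _ hfin]
  exact key x _ (by simp)

theorem finite_mem (p : Plane) : {T | T ∈ 𝒯 ∧ p ∈ T}.Finite := by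
  obtain ⟨N, hN⟩ := h.exists_packing 1
  exact (hN p).1.subset fun T hT => ⟨hT.1, p, hT.2, by simp⟩

/-- Tiles that come close to a point contain it. -/
theorem exists_local (p : Plane) :
    ∃ ε > 0, ∀ T ∈ 𝒯, ∀ x ∈ T, dist x p < ε → p ∈ T := by
  obtain ⟨N, hN⟩ := h.exists_packing 1
  set F := {T | (T ∈ 𝒯 ∧ (T ∩ Metric.ball p 1).Nonempty) ∧ p ∉ T} with hF
  have hFfin : F.Finite := (hN p).1.subset fun T hT => hT.1
  have hclosed : IsClosed (⋃ T ∈ F, T) :=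
    hFfin.isClosed_biUnion fun T hT => (h.poly T hT.1.1).isCompact.isClosed
  have hp : p ∈ (⋃ T ∈ F, T)ᶜ := by
    simp only [Set.mem_compl_iff, Set.mem_iUnion, not_exists]
    exact fun T hT hpT => hT.2 hpT
  obtain ⟨ε, hε, hsub⟩ := Metric.isOpen_iff.1 hclosed.isOpen_compl p hp
  refine ⟨min ε 1, lt_min hε one_pos, fun T hT x hx hd => ?_⟩
  by_contra hpT
  have h1 : x ∈ (⋃ T ∈ F, T)ᶜ := hsub (hd.trans_le (min_le_left _ _))
  exact h1 (Set.mem_biUnion (x := T) ⟨⟨hT, x, hx, hd.trans_le (min_le_right _ _)⟩, hpT⟩ hx)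

theorem exists_tile_direction (p d : Plane) (hd : d ≠ 0) :
    ∃ T ∈ 𝒯, p ∈ T ∧ ∃ ε : ℝ, 0 < ε ∧ p + ε • d ∈ T := by
  obtain ⟨ε, hε, hloc⟩ := h.exists_local p
  have hd' : 0 < ‖d‖ := norm_pos_iff.2 hd
  obtain ⟨T, hT, hmem⟩ := h.cover (p + (ε / (2 * ‖d‖)) • d)
  refine ⟨T, hT, hloc T hT _ hmem ?_, _, by positivity, hmem⟩
  rw [dist_eq_norm, add_sub_cancel_left, norm_smul, Real.norm_of_nonneg (by positivity)]
  have : ε / (2 * ‖d‖) * ‖d‖ = ε / 2 := by field_simp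
  linarith

theorem notMem_interior {p : Plane} {T T' : Set Plane} (hT : T ∈ 𝒯) (hT' : T' ∈ 𝒯) (hne : T ≠ T')
    (hp : p ∈ T) : p ∉ interior T' := fun hp' => by
  have h1 := (h.poly T hT).convex.subset_closure_interior (h.poly T hT).interior_nonempty hp
  obtain ⟨x, hx, hx'⟩ := mem_closure_iff.1 h1 _ isOpen_interior hp'
  exact Set.disjoint_left.1 (h.disj T hT T' hT' hne) hx' hx

/-- Around a corner of a tile there are at least three tiles. -/
theorem exists_third {p : Plane} {T₁ T₂ : Set Plane} (hT₁ : T₁ ∈ 𝒯) (hT₂ : T₂ ∈ 𝒯)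
    (hne : T₁ ≠ T₂) (hp : IsCornerOf T₁ p) (hp₂ : p ∈ T₂) :
    ∃ T₃ ∈ 𝒯, T₃ ≠ T₁ ∧ T₃ ≠ T₂ ∧ p ∈ T₃ := by
  have hP₁ := h.poly T₁ hT₁
  have hP₂ := h.poly T₂ hT₂
  obtain ⟨f, hf⟩ := geometric_hahn_banach_open_point hP₂.convex.interior isOpen_interior
    (h.notMem_interior hT₁ hT₂ hne hp.mem)
  have hfle : ∀ x ∈ T₂, f x ≤ f p := by
    have : closure (interior T₂) ⊆ {x | f x ≤ f p} :=
      closure_minimal (fun x hx => (hf x hx).le) (isClosed_le f.continuous continuous_const)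
    exact fun x hx => this (hP₂.convex.subset_closure_interior hP₂.interior_nonempty hx)
  obtain ⟨b, hb⟩ := hP₁.exists_next hp
  obtain ⟨q, hq⟩ := hP₁.exists_prev hp
  have hD : 0 < cr (b - p) (q - p) := hb.2.2.2 q hq.1 hq.2.2.1 (hb.prev_ne_next hP₁ hq)
  set u := b - p with hu
  set w := q - p with hw
  obtain ⟨y, hy⟩ := hP₂.interior_nonempty
  have hfne : ¬ (f u = 0 ∧ f w = 0) := by
    rintro ⟨h1, h2⟩
    have key := congrArg f (cr_smul_add u w (y - p))
    simp only [map_add, map_smul, smul_eq_mul, h1, h2, map_sub] at key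
    have := hf y hy
    have h3 : f y - f p ≠ 0 := by linarith
    exact mul_ne_zero hD.ne' h3 (by rw [key]; ring)
  -- `T₁` lies in the cone spanned by `u` and `w`, of angle less than π, and `T₂` in the half-plane
  -- `f ≤ f p`. Some direction avoids both.
  obtain ⟨s, t, hst, hpos⟩ : ∃ s t : ℝ, (s < 0 ∨ t < 0) ∧ 0 < s * f u + t * f w := by
    rcases lt_trichotomy (f u) 0 with h1 | h1 | h1
    · exact ⟨-1, 0, by norm_num, by linarith⟩
    · have h2 : f w ≠ 0 := fun h2 => hfne ⟨h1, h2⟩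
      rcases lt_or_gt_of_ne h2 with h2 | h2
      · exact ⟨0, -1, by norm_num, by linarith⟩
      · exact ⟨-1, 1, by norm_num, by rw [h1]; linarith⟩
    · refine ⟨(f w + 1) / f u, -1, by norm_num, ?_⟩
      field_simp
      linarith
  set d := s • u + t • w with hd
  have hfd : 0 < f d := by simpa [hd] using hpos
  obtain ⟨T₃, hT₃, hpT₃, ε, hε, hmem⟩ := h.exists_tile_direction p d (fun h0 => by
    rw [h0, map_zero] at hfd; exact lt_irrefl _ hfd)
  refine ⟨T₃, hT₃, ?_, ?_, hpT₃⟩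
  · rintro rfl
    have h1 : 0 ≤ cr u (p + ε • d - p) := hb.ori_nonneg hP₁ hmem
    have h2 : 0 ≤ cr (p + ε • d - p) w :=
      (hq.ori_nonneg hP₁ hmem).trans_eq (ori_rotate q p _).symm
    rw [add_sub_cancel_left, cr_smul_right, hd, cr_add_right, cr_smul_right, cr_smul_right,
      cr_self] at h1
    rw [add_sub_cancel_left, cr_smul_left, hd, cr_add_left, cr_smul_left, cr_smul_left,
      cr_self] at h2
    rcases hst with h3 | h3
    · have := mul_pos hε (mul_pos_of_neg_of_neg h3 (neg_lt_zero.2 hD)); nlinarith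
    · have := mul_pos hε (mul_pos_of_neg_of_neg h3 (neg_lt_zero.2 hD)); nlinarith
  · rintro rfl
    have h1 := hfle _ hmem
    rw [map_add, map_smul, smul_eq_mul] at h1
    have := mul_pos hε hfd
    linarith

end IsHexTiling

/-! ### Weights around a corner -/

/-- The scalar product with `w`. -/
def along (w x : Plane) : ℝ := w 0 * x 0 + w 1 * x 1

/-- The order of the plane by height above the direction `w`, ties being broken along `w`. -/
def LexLT (w p q : Plane) : Prop := cr w p < cr w q ∨ (cr w p = cr w q ∧ along w p < along w q)

/-- A thin wedge with apex `p` just above the direction `-w`. -/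
def wedge (w p : Plane) (ε : ℝ) : Set Plane :=
  {x | 0 < cr w (x - p) ∧ cr w (x - p) < ε * along w (p - x) ∧ along w (p - x) < ε}

theorem along_self_pos {w : Plane} (hw : w ≠ 0) : 0 < along w w := by
  have h1 : w 0 ≠ 0 ∨ w 1 ≠ 0 := by
    by_contra! hc
    exact hw (by ext i; fin_cases i <;> simp [hc])
  unfold along
  rcases h1 with h1 | h1
  · have := mul_self_pos.2 h1; nlinarith [mul_self_nonneg (w 1)]
  · have := mul_self_pos.2 h1; nlinarith [mul_self_nonneg (w 0)]

theorem along_mul_cr (w x y : Plane) :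
    along w w * cr x y = along w x * cr w y - cr w x * along w y := by
  simp only [along, cr]; ring

theorem LexLT.irrefl (w p : Plane) : ¬ LexLT w p p := by simp [LexLT]

theorem LexLT.trans {w p q s : Plane} (h : LexLT w p q) (h' : LexLT w q s) : LexLT w p s := by
  unfold LexLT at *
  rcases h with h | ⟨h1, h2⟩ <;> rcases h' with h' | ⟨h1', h2'⟩
  · exact Or.inl (h.trans h')
  · exact Or.inl (h1' ▸ h)
  · exact Or.inl (h1 ▸ h')
  · exact Or.inr ⟨h1.trans h1', h2.trans h2'⟩

theorem LexLT.total {w p q : Plane} (hw : w ≠ 0) (hne : p ≠ q) : LexLT w p q ∨ LexLT w q p := by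
  unfold LexLT
  rcases lt_trichotomy (cr w p) (cr w q) with h | h | h
  · tauto
  · rcases lt_trichotomy (along w p) (along w q) with h' | h' | h'
    · tauto
    · refine absurd ?_ (sub_ne_zero.2 hne.symm)
      have h1 : cr w (q - p) = 0 := by rw [cr_sub_right]; linarith
      obtain ⟨t, ht⟩ := eq_smul_of_cr_eq_zero hw h1
      have h2 : along w (q - p) = t * along w w := by rw [ht]; simp [along]; ring
      have h3 : along w (q - p) = 0 := by
        have : along w (q - p) = along w q - along w p := by simp [along]; ring
        linarith
      have : t = 0 := by
        rw [h3] at h2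
        exact (mul_eq_zero.1 h2.symm).resolve_right (along_self_pos hw).ne'
      rw [ht, this, zero_smul]
    · tauto
  · tauto

theorem lexLT_neg {w p q : Plane} : LexLT (-w) p q ↔ LexLT w q p := by
  have h1 : ∀ x, cr (-w) x = -cr w x := fun x => cr_neg_left w x
  have h2 : ∀ x, along (-w) x = -along w x := fun x => by simp [along]; ring
  simp only [LexLT, h1, h2, neg_lt_neg_iff, neg_inj]
  constructor <;> rintro (h | ⟨h, h'⟩)
  · exact Or.inl h
  · exact Or.inr ⟨h.symm, h'⟩
  · exact Or.inl h
  · exact Or.inr ⟨h.symm, h'⟩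

theorem lexLT_add {w p q a : Plane} : LexLT w (p + a) (q + a) ↔ LexLT w p q := by
  have h2 : ∀ x, along w (x + a) = along w x + along w a := fun x => by simp [along]; ring
  simp only [LexLT, cr_add_right, h2, add_lt_add_iff_right, add_left_inj]

/-- `LexLT` compares points with an infinitesimally tilted line through `p`, and the wedge is the
germ of its half towards `-w`. By `hD` this half enters the angle at `p` of the triangle `p q₂ q₁`.
-/
theorem wedge_subset_of_cr_pos {w : Plane} (hw : w ≠ 0) {T : Set Plane} (hT : Convex ℝ T)
    {p q₁ q₂ : Plane} (hp : p ∈ T) (hq₁ : q₁ ∈ T) (hq₂ : q₂ ∈ T) (h₁ : LexLT w q₁ p)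
    (h₂ : LexLT w p q₂) (hD : 0 < cr (q₂ - p) (q₁ - p)) : ∃ ε > 0, wedge w p ε ⊆ T := by
  have hK := along_self_pos hw
  have small : ∀ X Y : ℝ, ∃ ε > 0, Y = 0 ∨ ε * |X| ≤ |Y| := by
    intro X Y
    by_cases hY : Y = 0
    · exact ⟨1, one_pos, Or.inl hY⟩
    · have := abs_pos.2 hY
      refine ⟨|Y| / (|X| + 1), by positivity, Or.inr ?_⟩
      rw [div_mul_eq_mul_div, div_le_iff₀ (by positivity)]
      nlinarith [abs_nonneg X]
  set X₁ := along w (q₁ - p) with hX₁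
  set Y₁ := cr w (q₁ - p) with hY₁
  set X₂ := along w (q₂ - p) with hX₂
  set Y₂ := cr w (q₂ - p) with hY₂
  have hal : ∀ x y, along w (x - y) = along w x - along w y := fun x y => by simp [along]; ring
  have l₁ : Y₁ < 0 ∨ (Y₁ = 0 ∧ X₁ < 0) := by
    rw [hX₁, hY₁, cr_sub_right, hal, sub_neg, sub_neg, sub_eq_zero]; exact h₁
  have l₂ : 0 < Y₂ ∨ (Y₂ = 0 ∧ 0 < X₂) := by
    rw [hX₂, hY₂, cr_sub_right, hal, sub_pos, sub_pos, sub_eq_zero]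
    exact h₂.imp_right fun h => ⟨h.1.symm, h.2⟩
  obtain ⟨ε₁, hε₁, s₁⟩ := small X₁ Y₁
  obtain ⟨ε₂, hε₂, s₂⟩ := small X₂ Y₂
  set C := |X₁| + |Y₁| + |X₂| + |Y₂| + 1 with hC
  have hCpos : 0 < C := by positivity
  set d := along w w * cr (q₂ - p) (q₁ - p) with hd
  have hdpos : 0 < d := mul_pos hK hD
  -- `ε₁` and `ε₂` make the wedge flatter than the rays to `q₁` and `q₂`, unless these are
  -- horizontal; `d / C` keeps it short enough for the triangle.
  refine ⟨min (min ε₁ ε₂) (min 1 (d / C)), by positivity, ?_⟩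
  set ε := min (min ε₁ ε₂) (min 1 (d / C)) with hε
  have e1 : ε ≤ ε₁ := (min_le_left _ _).trans (min_le_left _ _)
  have e2 : ε ≤ ε₂ := (min_le_left _ _).trans (min_le_right _ _)
  have e3 : ε ≤ 1 := (min_le_right _ _).trans (min_le_left _ _)
  have e4 : ε * C ≤ d := by
    rw [← le_div_iff₀ hCpos]; exact (min_le_right _ _).trans (min_le_right _ _)
  have e0 : 0 < ε := by positivity
  rintro x ⟨hx1, hx2, hx3⟩
  set y := cr w (x - p) with hy
  set s := along w (p - x) with hs
  have hxs : along w (x - p) = -s := by rw [hs, hal, hal]; ring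
  have hs0 : 0 < s := by
    by_contra! hc
    nlinarith
  have hys : y < s := by nlinarith
  have a1 : along w w * cr (x - p) (q₁ - p) = -s * Y₁ - y * X₁ := by
    rw [along_mul_cr, hxs]
  have a2 : along w w * cr (q₂ - p) (x - p) = X₂ * y + Y₂ * s := by
    rw [along_mul_cr, hxs]; ring
  have b1 : 0 ≤ -s * Y₁ - y * X₁ := by
    rcases l₁ with l | ⟨l, l'⟩
    · have h1 : ε * |X₁| ≤ -Y₁ := by
        rw [← abs_of_neg l]
        rcases s₁ with s₁ | s₁
        · exact absurd s₁ l.ne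
        · exact (mul_le_mul_of_nonneg_right e1 (abs_nonneg _)).trans s₁
      have h2 : y * X₁ ≤ ε * s * |X₁| :=
        (mul_le_mul_of_nonneg_left (le_abs_self _) hx1.le).trans
          (mul_le_mul_of_nonneg_right hx2.le (abs_nonneg _))
      nlinarith
    · rw [l]; nlinarith
  have b2 : 0 ≤ X₂ * y + Y₂ * s := by
    rcases l₂ with l | ⟨l, l'⟩
    · have h1 : ε * |X₂| ≤ Y₂ := by
        rw [← abs_of_pos l]
        rcases s₂ with s₂ | s₂
        · exact absurd s₂ l.ne'
        · exact (mul_le_mul_of_nonneg_right e2 (abs_nonneg _)).trans s₂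
      have h2 : y * (-X₂) ≤ ε * s * |X₂| :=
        (mul_le_mul_of_nonneg_left (neg_le_abs _) hx1.le).trans
          (mul_le_mul_of_nonneg_right hx2.le (abs_nonneg _))
      nlinarith
    · rw [l]; nlinarith
  have b3 : (-s * Y₁ - y * X₁) + (X₂ * y + Y₂ * s) ≤ d := by
    have h1 : -s * Y₁ ≤ ε * |Y₁| := by
      have := mul_le_mul_of_nonneg_left (neg_le_abs Y₁) hs0.le
      have := mul_le_mul_of_nonneg_right hx3.le (abs_nonneg Y₁)
      linarith
    have h2 : Y₂ * s ≤ ε * |Y₂| := by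
      have := mul_le_mul_of_nonneg_left (le_abs_self Y₂) hs0.le
      have := mul_le_mul_of_nonneg_right hx3.le (abs_nonneg Y₂)
      linarith
    have h3 : -(y * X₁) ≤ ε * |X₁| := by
      have := mul_le_mul_of_nonneg_left (neg_le_abs X₁) hx1.le
      have := mul_le_mul_of_nonneg_right (hys.trans hx3).le (abs_nonneg X₁)
      linarith
    have h4 : X₂ * y ≤ ε * |X₂| := by
      have := mul_le_mul_of_nonneg_left (le_abs_self X₂) hx1.le
      have := mul_le_mul_of_nonneg_right (hys.trans hx3).le (abs_nonneg X₂)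
      linarith
    have h5 : ε * C = ε * |X₁| + ε * |Y₁| + ε * |X₂| + ε * |Y₂| + ε := by rw [hC]; ring
    linarith
  set E := cr (q₂ - p) (q₁ - p) with hE
  have c1 : 0 ≤ cr (x - p) (q₁ - p) := by rw [← a1] at b1; exact nonneg_of_mul_nonneg_right b1 hK
  have c2 : 0 ≤ cr (q₂ - p) (x - p) := by rw [← a2] at b2; exact nonneg_of_mul_nonneg_right b2 hK
  have c3 : cr (x - p) (q₁ - p) + cr (q₂ - p) (x - p) ≤ E := by
    rw [← a1, ← a2, ← mul_add] at b3
    exact le_of_mul_le_mul_left b3 hK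
  set A := cr (x - p) (q₁ - p) / E with hA
  set B := cr (q₂ - p) (x - p) / E with hB
  have hA0 : 0 ≤ A := by positivity
  have hB0 : 0 ≤ B := by positivity
  have hAB : A + B ≤ 1 := by rw [hA, hB, ← add_div, div_le_one hD]; exact c3
  have key := congrArg (E⁻¹ • ·) (cr_smul_add (q₂ - p) (q₁ - p) (x - p))
  simp only [smul_add, smul_smul] at key
  rw [← hE, inv_mul_cancel₀ hD.ne', one_smul, ← div_eq_inv_mul, ← div_eq_inv_mul, ← hA, ← hB] at key
  have hx : x = (1 - A - B) • p + A • q₂ + B • q₁ := by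
    have : x = p + (x - p) := by abel
    rw [this, key]; module
  rw [hx]
  have := hT.sum_mem (t := Finset.univ) (w := ![1 - A - B, A, B]) (z := ![p, q₂, q₁])
    (by intro i _; fin_cases i <;> simp <;> linarith)
    (by simp [Fin.sum_univ_three]; ring)
    (by intro i _; fin_cases i <;> simpa)
  simpa [Fin.sum_univ_three] using this

/-- A polygon that extends to both sides of `p` contains one of the two opposite wedges at `p`. -/
theorem IsPolygon.wedge_subset {w : Plane} (hw : w ≠ 0) {T : Set Plane} (hT : IsPolygon T)
    {p q₁ q₂ : Plane} (hp : p ∈ T) (hq₁ : q₁ ∈ T) (hq₂ : q₂ ∈ T) (h₁ : LexLT w q₁ p)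
    (h₂ : LexLT w p q₂) : (∃ ε > 0, wedge w p ε ⊆ T) ∨ ∃ ε > 0, wedge (-w) p ε ⊆ T := by
  have main : ∀ q₁ ∈ T, ∀ q₂ ∈ T, LexLT w q₁ p → LexLT w p q₂ → cr (q₂ - p) (q₁ - p) ≠ 0 →
      (∃ ε > 0, wedge w p ε ⊆ T) ∨ ∃ ε > 0, wedge (-w) p ε ⊆ T := by
    intro q₁ hq₁ q₂ hq₂ h₁ h₂ hne
    rcases lt_or_gt_of_ne hne with hlt | hgt
    · right
      refine wedge_subset_of_cr_pos (neg_ne_zero.2 hw) hT.convex hp hq₂ hq₁ (lexLT_neg.2 h₂)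
        (lexLT_neg.2 h₁) ?_
      rw [cr_swap]; linarith
    · exact Or.inl (wedge_subset_of_cr_pos hw hT.convex hp hq₁ hq₂ h₁ h₂ hgt)
  -- If `q₁`, `p`, `q₂` are collinear, a point of `T` off their line replaces one of `q₁`, `q₂`.
  by_cases hne : cr (q₂ - p) (q₁ - p) = 0
  swap
  · exact main q₁ hq₁ q₂ hq₂ h₁ h₂ hne
  have hq₂p : q₂ - p ≠ 0 := fun h => LexLT.irrefl w p (by rwa [sub_eq_zero.1 h] at h₂)
  obtain ⟨t, ht⟩ := eq_smul_of_cr_eq_zero hq₂p hne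
  have ht0 : t ≠ 0 := by
    rintro rfl
    rw [zero_smul, sub_eq_zero] at ht
    exact LexLT.irrefl w p (by rwa [ht] at h₁)
  obtain ⟨m, hm, hmne⟩ : ∃ m ∈ T, cr (q₂ - p) (m - p) ≠ 0 := by
    by_contra! hall
    obtain ⟨a, ha, -⟩ := hT.exists_corner_ne 0 0
    obtain ⟨b, hb⟩ := hT.exists_next ha
    obtain ⟨c, hc, hca, hcb⟩ := hT.exists_corner_ne a b
    obtain ⟨i, hi⟩ := eq_smul_of_cr_eq_zero hq₂p (hall a ha.mem)
    obtain ⟨j, hj⟩ := eq_smul_of_cr_eq_zero hq₂p (hall b hb.2.1.mem)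
    obtain ⟨k, hk⟩ := eq_smul_of_cr_eq_zero hq₂p (hall c hc.mem)
    have h := hb.2.2.2 c hc hca hcb
    have e1 : b - a = (j - i) • (q₂ - p) := by rw [sub_smul, ← hi, ← hj]; abel
    have e2 : c - a = (k - i) • (q₂ - p) := by rw [sub_smul, ← hi, ← hk]; abel
    rw [ori, e1, e2, cr_smul_left, cr_smul_right, cr_self] at h
    simp at h
  have hmp : p ≠ m := by
    rintro rfl
    simp [cr] at hmne
  rcases LexLT.total hw hmp with h | h
  · refine main q₁ hq₁ m hm h₁ h ?_
    rw [ht, cr_smul_right, cr_swap]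
    exact mul_ne_zero ht0 (neg_ne_zero.2 hmne)
  · exact main m hm q₂ hq₂ h h₂ hmne

theorem wedge_inter {w : Plane} (hw : w ≠ 0) {p : Plane} {ε ε' : ℝ} (hε : 0 < ε) (hε' : 0 < ε')
    {T T' : Set Plane} (hT : wedge w p ε ⊆ T) (hT' : wedge w p ε' ⊆ T') :
    ¬ Disjoint (interior T) (interior T') := by
  set δ := min ε ε' with hδ
  have hδ0 : 0 < δ := lt_min hε hε'
  have hmono : ∀ ε, δ ≤ ε → wedge w p δ ⊆ wedge w p ε := by
    rintro ε h x ⟨h1, h2, h3⟩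
    have : 0 < along w (p - x) := by
      by_contra! hc
      nlinarith
    exact ⟨h1, h2.trans_le (mul_le_mul_of_nonneg_right h this.le), h3.trans_le h⟩
  have hopen : IsOpen (wedge w p δ) := by
    have c1 : Continuous fun x : Plane => cr w (x - p) := by unfold cr; fun_prop
    have c2 : Continuous fun x : Plane => along w (p - x) := by unfold along; fun_prop
    exact (isOpen_lt continuous_const c1).inter ((isOpen_lt c1 (continuous_const.mul c2)).inter
      (isOpen_lt c2 continuous_const))
  have hK := along_self_pos hw
  have hne : (wedge w p δ).Nonempty := by
    set K := along w w with hKdef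
    set n : Plane := !₂[-(w 1), w 0] with hn
    refine ⟨p + (-(δ / 2) / K) • w + (δ * δ / 4 / K) • n, ?_⟩
    have e1 : cr w n = K := by simp [cr, hn, hKdef, along]
    have e2 : along w n = 0 := by simp [along, hn]; ring
    have e3 : cr w (p + (-(δ / 2) / K) • w + (δ * δ / 4 / K) • n - p) = δ * δ / 4 := by
      rw [cr_sub_right, cr_add_right, cr_add_right, cr_smul_right, cr_smul_right, cr_self, e1]
      field_simp
      ring
    have e4 : along w (p - (p + (-(δ / 2) / K) • w + (δ * δ / 4 / K) • n)) = δ / 2 := by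
      have : along w (p - (p + (-(δ / 2) / K) • w + (δ * δ / 4 / K) • n)) =
          (δ / 2 / K) * K - (δ * δ / 4 / K) * along w n := by
        rw [hKdef]; simp only [along, PiLp.add_apply, PiLp.sub_apply, PiLp.smul_apply, smul_eq_mul]
        ring
      rw [this, e2]; field_simp; ring
    refine ⟨?_, ?_, ?_⟩
    · rw [e3]; positivity
    · rw [e3, e4]; nlinarith
    · rw [e4]; linarith
  obtain ⟨x, hx⟩ := hne
  rw [Set.not_disjoint_iff]
  exact ⟨x, interior_maximal ((hmono ε (min_le_left _ _)).trans hT) hopen hx,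
    interior_maximal ((hmono ε' (min_le_right _ _)).trans hT') hopen hx⟩

open Classical in
/-- The weight of a point in a tile: `-2` at the lowest and the highest point. -/
noncomputable def weight (w : Plane) (T : Set Plane) (p : Plane) : ℤ :=
  if (∃ q ∈ T, LexLT w q p) ∧ ∃ q ∈ T, LexLT w p q then 1 else -2

/-- `p` is inside a segment of `T`, and `LexLT` is compatible with convex combinations, so the ends
lie on different sides of `p`. -/
theorem exists_lexLT_of_not_isCornerOf {w : Plane} (hw : w ≠ 0) {T : Set Plane} {p : Plane}
    (hp : p ∈ T) (hc : ¬ IsCornerOf T p) : (∃ q ∈ T, LexLT w q p) ∧ ∃ q ∈ T, LexLT w p q := by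
  have : ∃ x ∈ T, ∃ y ∈ T, p ∈ openSegment ℝ x y ∧ x ≠ p := by
    by_contra! h
    exact hc ⟨hp, fun x hx y hy hxy => h x hx y hy hxy⟩
  obtain ⟨x, hx, y, hy, ⟨s, t, hs, ht, hst, hxy⟩, hne⟩ := this
  have e1 : s * cr w x + t * cr w y = cr w p := by
    rw [← hxy, cr_add_right, cr_smul_right, cr_smul_right]
  have e2 : s * along w x + t * along w y = along w p := by
    rw [← hxy]; simp [along]; ring
  have hs' : s = 1 - t := by linarith
  rw [hs'] at e1 e2 hs
  have flip1 : LexLT w x p → LexLT w p y := by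
    rintro (h | ⟨h, h'⟩)
    · left; nlinarith
    · right; exact ⟨by rw [h] at e1; nlinarith, by nlinarith⟩
  have flip2 : LexLT w p x → LexLT w y p := by
    rintro (h | ⟨h, h'⟩)
    · left; nlinarith
    · right; exact ⟨by rw [← h] at e1; nlinarith, by nlinarith⟩
  rcases LexLT.total hw hne with h | h
  · exact ⟨⟨x, hx, h⟩, y, hy, flip1 h⟩
  · exact ⟨⟨y, hy, flip2 h⟩, x, hx, h⟩

namespace IsHexTiling

variable {𝒯 : Set (Set Plane)} {D r : ℝ} (h : IsHexTiling 𝒯 D r)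

include h

theorem exists_second {p : Plane} {T : Set Plane} (hT : T ∈ 𝒯) (hp : IsCornerOf T p) :
    ∃ T' ∈ 𝒯, T' ≠ T ∧ p ∈ T' := by
  have hP := h.poly T hT
  obtain ⟨b, hb⟩ := hP.exists_next hp
  obtain ⟨q, hq⟩ := hP.exists_prev hp
  have hD : 0 < cr (b - p) (q - p) := hb.2.2.2 q hq.1 hq.2.2.1 (hb.prev_ne_next hP hq)
  obtain ⟨T', hT', hpT', ε, hε, hmem⟩ := h.exists_tile_direction p (p - b)
    (sub_ne_zero.2 hb.2.2.1)
  refine ⟨T', hT', ?_, hpT'⟩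
  rintro rfl
  have h2 : 0 ≤ cr (p + ε • (p - b) - p) (q - p) :=
    (hq.ori_nonneg hP hmem).trans_eq (ori_rotate q p _).symm
  rw [add_sub_cancel_left, cr_smul_left, ← neg_sub b p, cr_neg_left] at h2
  have := mul_pos hε hD
  linarith

/-- The weights around a corner add up to at most `0`, with equality only if exactly three corners
of tiles, and no sides, meet there. -/
theorem sum_weight {w : Plane} (hw : w ≠ 0) {p : Plane} {T : Set Plane} (hT : T ∈ 𝒯)
    (hp : IsCornerOf T p) :
    ∑ᶠ T' ∈ {T' | T' ∈ 𝒯 ∧ IsCornerOf T' p}, weight w T' p ≤ 0 ∧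
    (∑ᶠ T' ∈ {T' | T' ∈ 𝒯 ∧ IsCornerOf T' p}, weight w T' p = 0 →
      (∀ T' ∈ 𝒯, p ∈ T' → IsCornerOf T' p) ∧ {T' | T' ∈ 𝒯 ∧ p ∈ T'}.ncard = 3) := by
  classical
  set A := (h.finite_mem p).toFinset with hA
  have hmem : ∀ T', T' ∈ A ↔ T' ∈ 𝒯 ∧ p ∈ T' := fun T' => by simp [hA]
  set both : Set Plane → Prop := fun T' => (∃ q ∈ T', LexLT w q p) ∧ ∃ q ∈ T', LexLT w p q
    with hboth
  have hsum : ∑ᶠ T' ∈ {T' | T' ∈ 𝒯 ∧ IsCornerOf T' p}, weight w T' p =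
      3 * ((A.filter fun T' => IsCornerOf T' p).filter both).card
        - 2 * (A.filter fun T' => IsCornerOf T' p).card := by
    have : {T' | T' ∈ 𝒯 ∧ IsCornerOf T' p} =
        ((A.filter fun T' => IsCornerOf T' p : Finset (Set Plane)) : Set (Set Plane)) := by
      ext T'
      simp only [Finset.coe_filter, Set.mem_ofPred_eq, hmem]
      exact ⟨fun h => ⟨⟨h.1, h.2.mem⟩, h.2⟩, fun h => ⟨h.1.1, h.2⟩⟩
    rw [this, finsum_mem_coe_finset, Finset.card_filter both]
    have e : ∀ T', weight w T' p = 3 * (if both T' then 1 else 0) - 2 := fun T' => by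
      unfold weight; split_ifs <;> rfl
    simp only [e, Finset.sum_sub_distrib, ← Finset.mul_sum, Finset.sum_const]
    push_cast
    ring
  set K := A.filter fun T' => IsCornerOf T' p with hK
  set F := A.filter fun T' => ¬ IsCornerOf T' p with hF
  have hKF : K.card + F.card = A.card := Finset.card_filter_add_card_filter_not _
  have hFb : F.filter both = F := Finset.filter_true_of_mem fun T' hT' =>
    exists_lexLT_of_not_isCornerOf hw ((hmem T').1 (Finset.mem_filter.1 hT').1).2
      (Finset.mem_filter.1 hT').2
  have hAb : (K.filter both).card + F.card = (A.filter both).card := by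
    have e1 : (A.filter both).filter (fun T' => IsCornerOf T' p) = K.filter both :=
      Finset.filter_comm ..
    have e2 : (A.filter both).filter (fun T' => ¬ IsCornerOf T' p) = F.filter both :=
      Finset.filter_comm ..
    rw [← Finset.card_filter_add_card_filter_not (s := A.filter both)
      (fun T' => IsCornerOf T' p), e1, e2, hFb]
  have hthree : 3 ≤ A.card := by
    obtain ⟨T₂, hT₂, hne₂, hp₂⟩ := h.exists_second hT hp
    obtain ⟨T₃, hT₃, hne₃, hne₃', hp₃⟩ := h.exists_third hT hT₂ hne₂.symm hp hp₂
    exact Finset.two_lt_card.2 ⟨T, (hmem T).2 ⟨hT, hp.mem⟩, T₂, (hmem T₂).2 ⟨hT₂, hp₂⟩, T₃,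
      (hmem T₃).2 ⟨hT₃, hp₃⟩, hne₂.symm, hne₃.symm, hne₃'.symm⟩
  have hone : ∀ w' : Plane, w' ≠ 0 → (A.filter fun T' => ∃ ε > 0, wedge w' p ε ⊆ T').card ≤ 1 := by
    intro w' hw'
    rw [Finset.card_le_one]
    intro T₁ h₁ T₂ h₂
    obtain ⟨hA₁, ε₁, hε₁, hs₁⟩ := Finset.mem_filter.1 h₁
    obtain ⟨hA₂, ε₂, hε₂, hs₂⟩ := Finset.mem_filter.1 h₂
    by_contra hne
    exact wedge_inter hw' hε₁ hε₂ hs₁ hs₂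
      (h.disj T₁ ((hmem T₁).1 hA₁).1 T₂ ((hmem T₂).1 hA₂).1 hne)
  -- Each such tile contains one of the two opposite wedges at `p`, and tiles without common
  -- interior points cannot share one.
  have htwo : (A.filter both).card ≤ 2 := by
    have hsub : A.filter both ⊆ (A.filter fun T' => ∃ ε > 0, wedge w p ε ⊆ T') ∪
        (A.filter fun T' => ∃ ε > 0, wedge (-w) p ε ⊆ T') := by
      intro T' hT'
      obtain ⟨hTA, ⟨q₁, hq₁, hl₁⟩, q₂, hq₂, hl₂⟩ := Finset.mem_filter.1 hT'
      obtain ⟨hT𝒯, hpT'⟩ := (hmem T').1 hTA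
      rw [Finset.mem_union, Finset.mem_filter, Finset.mem_filter]
      exact ((h.poly T' hT𝒯).wedge_subset hw hpT' hq₁ hq₂ hl₁ hl₂).imp
        (fun h => ⟨hTA, h⟩) (fun h => ⟨hTA, h⟩)
    have h1 := Finset.card_le_card hsub
    have h2 := Finset.card_union_le (A.filter fun T' => ∃ ε > 0, wedge w p ε ⊆ T')
      (A.filter fun T' => ∃ ε > 0, wedge (-w) p ε ⊆ T')
    have h3 := hone w hw
    have h4 := hone (-w) (neg_ne_zero.2 hw)
    omega
  -- Let `k` tiles have a corner at `p`, `m` of them reaching to both sides, and let `f` tiles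
  -- contain `p` otherwise. Then `k + f ≥ 3` and `m + f ≤ 2`, so `3m - 2k ≤ -f`.
  rw [hsum]
  refine ⟨by omega, fun h0 => ?_⟩
  have hF0 : F.card = 0 := by omega
  have hK3 : A.card = 3 := by omega
  refine ⟨fun T' hT' hpT' => ?_, ?_⟩
  · by_contra hc
    have : T' ∈ F := Finset.mem_filter.2 ⟨(hmem T').2 ⟨hT', hpT'⟩, hc⟩
    rw [Finset.card_eq_zero.1 hF0] at this
    simp at this
  · rw [Set.ncard_eq_toFinset_card _ (h.finite_mem p)]
    exact hK3

end IsHexTiling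

/-! ### Intersections of tiles where only corners meet -/

/-- If `x` is a corner of a tile, then it is a corner of each tile that contains it. -/
def OnlyCorners (𝒯 : Set (Set Plane)) (x : Plane) : Prop :=
  ∀ T ∈ 𝒯, IsCornerOf T x → ∀ T' ∈ 𝒯, x ∈ T' → IsCornerOf T' x

theorem exists_openSegment_of_not_isCornerOf {T : Set Plane} {p : Plane} (hp : p ∈ T)
    (hc : ¬ IsCornerOf T p) :
    ∃ a ∈ T, ∃ d : Plane, ∃ t : ℝ, d ≠ 0 ∧ 0 < t ∧ t < 1 ∧ a + d ∈ T ∧ p = a + t • d := by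
  have : ∃ x ∈ T, ∃ y ∈ T, p ∈ openSegment ℝ x y ∧ x ≠ p := by
    by_contra! h
    exact hc ⟨hp, fun x hx y hy hxy => h x hx y hy hxy⟩
  obtain ⟨x, hx, y, hy, ⟨s, t, hs, ht, hst, hxy⟩, hne⟩ := this
  have hs' : s = 1 - t := by linarith
  have hp : p = x + t • (y - x) := by rw [← hxy, hs']; module
  refine ⟨x, hx, y - x, t, ?_, ht, by linarith, by simpa, hp⟩
  intro h0
  rw [h0, smul_zero, add_zero] at hp
  exact hne hp.symm

theorem mem_of_small_smul {T : Set Plane} (hT : Convex ℝ T) {a d : Plane} {t : ℝ} (ha : a ∈ T)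
    (had : a + d ∈ T) {ε : ℝ} (h1 : 0 ≤ t + ε) (h2 : t + ε ≤ 1) : a + t • d + ε • d ∈ T := by
  have := hT.add_smul_mem ha had ⟨h1, h2⟩
  rwa [add_smul, ← add_assoc] at this

theorem IsPolygon.exists_ori_ne_zero {T : Set Plane} (hT : IsPolygon T) {p q : Plane}
    (hpq : p ≠ q) : ∃ c ∈ T, ori p q c ≠ 0 := by
  by_contra! hc
  obtain ⟨a, ha, -⟩ := hT.exists_corner_ne 0 0
  obtain ⟨b, hb⟩ := hT.exists_next ha
  obtain ⟨c, hcc, hca, hcb⟩ := hT.exists_corner_ne a b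
  have h0 := hb.2.2.2 c hcc hca hcb
  have hd : q - p ≠ 0 := sub_ne_zero.2 hpq.symm
  obtain ⟨s, hs⟩ := eq_smul_of_cr_eq_zero hd (hc a ha.mem)
  obtain ⟨t, ht⟩ := eq_smul_of_cr_eq_zero hd (hc b hb.2.1.mem)
  obtain ⟨u, hu⟩ := eq_smul_of_cr_eq_zero hd (hc c hcc.mem)
  have e1 : b - a = (t - s) • (q - p) := by rw [sub_smul, ← hs, ← ht]; abel
  have e2 : c - a = (u - s) • (q - p) := by rw [sub_smul, ← hs, ← hu]; abel
  rw [ori, e1, e2, cr_smul_left, cr_smul_right, cr_self] at h0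
  simp at h0

namespace IsHexTiling

variable {𝒯 : Set (Set Plane)} {D r : ℝ} (h : IsHexTiling 𝒯 D r)

include h

theorem ori_nonpos {T T' : Set Plane} (hT : T ∈ 𝒯) (hT' : T' ∈ 𝒯) (hne : T ≠ T') {a b c z w : Plane}
    (ha : a ∈ T) (hb : b ∈ T) (hc : c ∈ T) (h0 : 0 < ori a b c) (hz : z ∈ openSegment ℝ a b)
    (hzT' : z ∈ T') (hw : w ∈ T') : ori a b w ≤ 0 :=
  ori_nonpos_of_disjoint (h.poly T hT).convex (h.poly T' hT').convex
    (h.poly T' hT').interior_nonempty (h.disj T hT T' hT' hne) ha hb hc h0 hz hzT' hw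

theorem midpoint_mem {T : Set Plane} (hT : T ∈ 𝒯) {a b : Plane} (ha : a ∈ T) (hb : b ∈ T) :
    midpoint ℝ a b ∈ T := (h.poly T hT).convex.midpoint_mem ha hb

/-- An extreme point of the intersection of two tiles is a corner of one of them. -/
theorem isCornerOf_or {T T' : Set Plane} (hT : T ∈ 𝒯) (hT' : T' ∈ 𝒯) (hne : T ≠ T') {x : Plane}
    (hx : x ∈ (T ∩ T').extremePoints ℝ) : IsCornerOf T x ∨ IsCornerOf T' x := by
  by_contra! hc
  obtain ⟨a, ha, d, t, hd, ht0, ht1, had, hxa⟩ :=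
    exists_openSegment_of_not_isCornerOf hx.1.1 hc.1
  obtain ⟨a', ha', d', t', hd', ht0', ht1', had', hxa'⟩ :=
    exists_openSegment_of_not_isCornerOf hx.1.2 hc.2
  have hC := (h.poly T hT).convex
  have hC' := (h.poly T' hT').convex
  -- Each tile contains a segment with `x` inside. Parallel segments overlap around `x`, which is
  -- then not extreme; crossing ones put points of `T'` on both sides of a segment of `T`.
  by_cases hcr : cr d d' = 0
  · obtain ⟨k, rfl⟩ := eq_smul_of_cr_eq_zero hd hcr
    have hk : k ≠ 0 := fun hk => hd' (by rw [hk, zero_smul])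
    have hk' : 0 < |k| := abs_pos.2 hk
    set ε := min (min t (1 - t)) (|k| * min t' (1 - t')) with hε
    have hε0 : 0 < ε := lt_min (lt_min ht0 (by linarith)) (mul_pos hk' (lt_min ht0' (by linarith)))
    have hmem : ∀ δ : ℝ, |δ| ≤ ε → x + δ • d ∈ T ∩ T' := by
      intro δ hδ
      have h1 := hδ.trans (min_le_left _ _)
      have h2 := hδ.trans (min_le_right _ _)
      have h3 := abs_le.1 (h1.trans (min_le_left _ _))
      have h4 := abs_le.1 (h1.trans (min_le_right _ _))
      rw [← div_le_iff₀' hk', ← abs_div] at h2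
      have h5 := abs_le.1 (h2.trans (min_le_left _ _))
      have h6 := abs_le.1 (h2.trans (min_le_right _ _))
      constructor
      · rw [hxa]
        exact mem_of_small_smul hC ha had (by linarith) (by linarith)
      · have := mem_of_small_smul hC' ha' had' (t := t') (ε := δ / k) (by linarith) (by linarith)
        rwa [← hxa', smul_smul, div_mul_cancel₀ _ hk] at this
    have h1 := hx.2 (hmem (-ε) (by rw [abs_neg, abs_of_pos hε0])) (hmem ε (by rw [abs_of_pos hε0]))
      ⟨1 / 2, 1 / 2, by norm_num, by norm_num, by norm_num, by module⟩
    rw [add_eq_left, smul_eq_zero] at h1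
    rcases h1 with h1 | h1
    · linarith
    · exact hd h1
  · have hxs : x ∈ openSegment ℝ a (a + d) := by
      rw [hxa]; simpa using mem_openSegment_of_smul (a := a) (b := a + d) ht0 ht1
    obtain ⟨c, hcT, hcne⟩ :=
      (h.poly T hT).exists_ori_ne_zero (p := a) (q := a + d) (by simpa using hd)
    have e1 : ori a (a + d) (a' + d') = ori a (a + d) a' + cr d d' := by
      simp only [ori, add_sub_cancel_left]; rw [← cr_add_right]; congr 1; abel
    have e2 : ori a (a + d) a' + t' * cr d d' = 0 := by
      have : ori a (a + d) x = ori a (a + d) a' + t' * cr d d' := by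
        rw [hxa']
        simp only [ori, add_sub_cancel_left]; rw [← cr_smul_right, ← cr_add_right]; congr 1; abel
      rw [← this, hxa]
      simp [ori, cr_smul_right, cr_self]
    rcases lt_or_gt_of_ne hcne with h0 | h0
    · have h0' : 0 < ori (a + d) a c := by rw [ori_swap]; linarith
      rw [openSegment_symm] at hxs
      have k1 := h.ori_nonpos hT hT' hne had ha hcT h0' hxs hx.1.2 ha'
      have k2 := h.ori_nonpos hT hT' hne had ha hcT h0' hxs hx.1.2 had'
      rw [ori_swap] at k1 k2
      rcases lt_or_gt_of_ne hcr with h3 | h3 <;> nlinarith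
    · have k1 := h.ori_nonpos hT hT' hne ha had hcT h0 hxs hx.1.2 ha'
      have k2 := h.ori_nonpos hT hT' hne ha had hcT h0 hxs hx.1.2 had'
      rcases lt_or_gt_of_ne hcr with h3 | h3 <;> nlinarith

/-- Where only corners meet, the intersection of two tiles is a common corner or a common side. -/
theorem inter_eq {T T' : Set Plane} (hT : T ∈ 𝒯) (hT' : T' ∈ 𝒯) (hne : T ≠ T')
    (hne' : (T ∩ T').Nonempty) (hreg : ∀ x ∈ T ∩ T', OnlyCorners 𝒯 x) :
    (∃ p, IsCornerOf T p ∧ IsCornerOf T' p ∧ T ∩ T' = {p}) ∨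
      ∃ a b, IsNext T a b ∧ IsNext T' b a ∧ T ∩ T' = segment ℝ a b := by
  have hP := h.poly T hT
  have hP' := h.poly T' hT'
  have hcompact : IsCompact (T ∩ T') := hP.isCompact.inter hP'.isCompact
  have hconv : Convex ℝ (T ∩ T') := hP.convex.inter hP'.convex
  set E := (T ∩ T').extremePoints ℝ with hE
  have hcor : ∀ x ∈ E, IsCornerOf T x ∧ IsCornerOf T' x := by
    intro x hx
    rcases h.isCornerOf_or hT hT' hne hx with hc | hc
    · exact ⟨hc, hreg x hx.1 T hT hc T' hT' hx.1.2⟩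
    · exact ⟨hreg x hx.1 T' hT' hc T hT hx.1.1, hc⟩
  have hEfin : E.Finite := hP.finite.subset fun x hx => (hcor x hx).1
  have hhull : T ∩ T' = convexHull ℝ E := by
    have h1 := closure_convexHull_extremePoints hcompact hconv
    rw [(hEfin.isCompact_convexHull ℝ).isClosed.closure_eq] at h1
    exact h1.symm
  -- Three common corners span a triangle, whose interior would lie in both tiles.
  have hthree : ∀ a ∈ E, ∀ b ∈ E, ∀ c ∈ E, a ≠ b → a ≠ c → b ≠ c → False := by
    intro a ha b hb c hc hab hac hbc
    have key : ∀ a ∈ E, ∀ b ∈ E, ∀ c ∈ E, ¬ 0 < ori a b c := by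
      intro a ha b hb c hc hpos
      obtain ⟨y, hy⟩ := interior_nonempty_of_ori_pos hconv ha.1 hb.1 hc.1 hpos
      rw [interior_inter] at hy
      exact Set.disjoint_left.1 (h.disj T hT T' hT' hne) hy.1 hy.2
    have h1 := (hcor a ha).1.ori_ne_zero (hcor b hb).1 (hcor c hc).1 hab hac hbc
    rcases lt_or_gt_of_ne h1 with h2 | h2
    · exact key b hb a ha c hc (by rw [ori_swap]; linarith)
    · exact key a ha b hb c hc h2
  obtain ⟨a, ha⟩ := hcompact.extremePoints_nonempty (E := Plane) hne'
  by_cases hex : ∃ b ∈ E, b ≠ a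
  · right
    obtain ⟨b, hb, hba⟩ := hex
    have hEab : E = {a, b} := by
      ext c
      refine ⟨fun hc => ?_, ?_⟩
      · by_contra hcn
        simp only [Set.mem_insert_iff, Set.mem_singleton_iff, not_or] at hcn
        exact hthree a ha b hb c hc hba.symm (Ne.symm hcn.1) (Ne.symm hcn.2)
      · rintro (rfl | rfl) <;> assumption
    have hseg : T ∩ T' = segment ℝ a b := by rw [hhull, hEab, convexHull_pair]
    -- A corner of `T'` to the right of `ab` forces `T` to the left, and this in turn forces all of
    -- `T'` to the right.
    have main : ∀ a ∈ E, ∀ b ∈ E, b ≠ a → (∃ c, IsCornerOf T' c ∧ c ≠ a ∧ c ≠ b ∧ 0 < ori b a c) →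
        IsNext T a b ∧ IsNext T' b a := by
      rintro a ha b hb hba ⟨c', hc', hca', hcb', hpos'⟩
      have hz : midpoint ℝ a b ∈ openSegment ℝ b a := by
        rw [openSegment_symm]; exact midpoint_mem_openSegment a b
      have k1 : ∀ c, IsCornerOf T c → c ≠ a → c ≠ b → 0 < ori a b c := by
        intro c hc hca hcb
        have := h.ori_nonpos hT' hT hne.symm hb.1.2 ha.1.2 hc'.mem hpos' hz
          (h.midpoint_mem hT ha.1.1 hb.1.1) hc.mem
        rw [ori_swap] at this
        exact lt_of_le_of_ne (by linarith)
          ((hcor a ha).1.ori_ne_zero (hcor b hb).1 hc hba.symm (Ne.symm hca) (Ne.symm hcb)).symm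
      obtain ⟨c, hc, hca, hcb⟩ := hP.exists_corner_ne a b
      refine ⟨⟨(hcor a ha).1, (hcor b hb).1, hba.symm, k1⟩, (hcor b hb).2, (hcor a ha).2, hba, ?_⟩
      intro c₁ hc₁ hcb₁ hca₁
      have := h.ori_nonpos hT hT' hne ha.1.1 hb.1.1 hc.mem (k1 c hc hca hcb)
        (midpoint_mem_openSegment a b) (h.midpoint_mem hT' ha.1.2 hb.1.2) hc₁.mem
      rw [ori_swap]
      have := lt_of_le_of_ne this
        ((hcor a ha).2.ori_ne_zero (hcor b hb).2 hc₁ hba.symm (Ne.symm hca₁) (Ne.symm hcb₁))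
      linarith
    obtain ⟨c, hc, hca, hcb⟩ := hP'.exists_corner_ne a b
    have h1 := (hcor b hb).2.ori_ne_zero (hcor a ha).2 hc hba (Ne.symm hcb) (Ne.symm hca)
    rcases lt_or_gt_of_ne h1 with h2 | h2
    · obtain ⟨k1, k2⟩ := main b hb a ha hba.symm ⟨c, hc, hcb, hca, by rw [ori_swap]; linarith⟩
      exact ⟨b, a, k1, k2, by rw [hseg, segment_symm]⟩
    · obtain ⟨k1, k2⟩ := main a ha b hb hba ⟨c, hc, hca, hcb, h2⟩
      exact ⟨a, b, k1, k2, hseg⟩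
  · left
    push Not at hex
    refine ⟨a, (hcor a ha).1, (hcor a ha).2, ?_⟩
    have : E = {a} := Set.eq_singleton_iff_unique_mem.2 ⟨ha, hex⟩
    rw [hhull, this, convexHull_singleton]

theorem neighbour_unique {T T' : Set Plane} (hT : T ∈ 𝒯) (hT' : T' ∈ 𝒯) {a b : Plane}
    (h1 : IsNext T a b) (h2 : IsNext T' a b) : T = T' := by
  by_contra hne
  obtain ⟨c, hc, hca, hcb⟩ := (h.poly T hT).exists_corner_ne a b
  obtain ⟨c', hc', hca', hcb'⟩ := (h.poly T' hT').exists_corner_ne a b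
  have := h.ori_nonpos hT hT' hne h1.1.mem h1.2.1.mem hc.mem (h1.2.2.2 c hc hca hcb)
    (midpoint_mem_openSegment a b) (h.midpoint_mem hT' h2.1.mem h2.2.1.mem) hc'.mem
  have := h2.2.2.2 c' hc' hca' hcb'
  linarith

theorem ne_of_isNext {T T' : Set Plane} (hT : T ∈ 𝒯) {a b : Plane}
    (h1 : IsNext T a b) (h2 : IsNext T' b a) : T ≠ T' := by
  rintro rfl
  exact h1.prev_ne_next (h.poly T hT) h2 rfl

/-- Where only corners meet, each side of a tile is a side of another tile. -/
theorem exists_neighbour {T : Set Plane} (hT : T ∈ 𝒯) {a b : Plane} (hab : IsNext T a b)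
    (hreg : ∀ x ∈ segment ℝ a b, OnlyCorners 𝒯 x) : ∃ T' ∈ 𝒯, IsNext T' b a := by
  have hP := h.poly T hT
  obtain ⟨c, hc, hca, hcb⟩ := hP.exists_corner_ne a b
  have hpos := hab.2.2.2 c hc hca hcb
  have hz := midpoint_mem_openSegment (𝕜 := ℝ) a b
  set z := midpoint ℝ a b with hzdef
  have hz0 : ori a b z = 0 := by
    obtain ⟨s, t, hs, ht, hst, hzz⟩ := hz
    have : s = 1 - t := by linarith
    rw [← hzz, this]
    simp only [ori, cr, PiLp.sub_apply, PiLp.add_apply, PiLp.smul_apply, smul_eq_mul]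
    ring
  have hzc : z - c ≠ 0 := by
    rw [sub_ne_zero]; intro hzc; rw [hzc] at hz0; exact hpos.ne' hz0
  -- The tile just beyond the midpoint of the side, away from `c`.
  obtain ⟨T', hT', hzT', ε, hε, hmem⟩ := h.exists_tile_direction z (z - c) hzc
  have hne : T ≠ T' := by
    rintro rfl
    have h1 := hab.ori_nonneg hP hmem
    have h2 : ori a b (z + ε • (z - c)) = ori a b z + ε * (ori a b z - ori a b c) := by
      simp only [ori, cr, PiLp.sub_apply, PiLp.add_apply, PiLp.smul_apply, smul_eq_mul]
      ring
    rw [h2, hz0] at h1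
    have := mul_pos hε hpos
    linarith
  have hsub : T ∩ T' ⊆ segment ℝ a b := by
    rintro x ⟨hx, hx'⟩
    have h1 := hab.ori_nonneg hP hx
    have h2 := h.ori_nonpos hT hT' hne hab.1.mem hab.2.1.mem hc.mem hpos hz hzT' hx'
    exact hab.mem_segment hx (le_antisymm h2 h1)
  have hzT : z ∈ T := h.midpoint_mem hT hab.1.mem hab.2.1.mem
  have hends : ∀ x ∈ T ∩ T', IsCornerOf T x → x = a ∨ x = b := by
    intro x hx hxc
    have h1 := hsub hx
    rw [← insert_endpoints_openSegment] at h1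
    rcases h1 with h1 | h1 | h1
    · exact Or.inl h1
    · exact Or.inr h1
    · exact absurd h1 (hxc.notMem_openSegment hab.1.mem hab.2.1.mem hab.2.2.1)
  rcases h.inter_eq hT hT' hne ⟨z, hzT, hzT'⟩ (fun x hx => hreg x (hsub hx)) with
    ⟨p, hp, -, hpe⟩ | ⟨a', b', h1, h2, h3⟩
  · have : z = p := by
      have : z ∈ T ∩ T' := ⟨hzT, hzT'⟩
      rwa [hpe] at this
    rw [← this] at hp
    exact absurd hz (hp.notMem_openSegment hab.1.mem hab.2.1.mem hab.2.2.1)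
  · refine ⟨T', hT', ?_⟩
    have ha' := hends a' ⟨h1.1.mem, h2.2.1.mem⟩ h1.1
    have hb' := hends b' ⟨h1.2.1.mem, h2.1.mem⟩ h1.2.1
    rcases ha' with rfl | rfl <;> rcases hb' with rfl | rfl
    · exact absurd rfl h1.2.2.1
    · exact h2
    · exact absurd rfl (hab.prev_ne_next hP h1)
    · exact absurd rfl h1.2.2.1

/-- The three tiles around a point of valence `3`. -/
theorem turn_around {a b₀ b₁ b₂ : Plane} (hval : {T | T ∈ 𝒯 ∧ a ∈ T}.ncard = 3)
    {T₀ T₁ T₂ T₃ : Set Plane} (hT₀ : T₀ ∈ 𝒯) (hT₁ : T₁ ∈ 𝒯) (hT₂ : T₂ ∈ 𝒯) (hT₃ : T₃ ∈ 𝒯)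
    (n₀ : IsNext T₀ a b₀) (p₁ : IsNext T₁ b₀ a) (n₁ : IsNext T₁ a b₁) (p₂ : IsNext T₂ b₁ a)
    (n₂ : IsNext T₂ a b₂) (p₃ : IsNext T₃ b₂ a) :
    T₃ = T₀ ∧ ∀ T ∈ 𝒯, a ∈ T → T = T₀ ∨ T = T₁ ∨ T = T₂ := by
  -- Were `S'' = S`, the angles at `a` from `c` to `c'` in `S` and back from `c'` to `c` in `S'`
  -- would both be positive and less than π.
  have step : ∀ {S S' S'' : Set Plane} {c c' : Plane}, S ∈ 𝒯 → S' ∈ 𝒯 → IsNext S a c →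
      IsNext S' c a → IsNext S' a c' → IsNext S'' c' a → S ≠ S'' := by
    rintro S S' S'' c c' hS hS' k1 k2 k3 k4 rfl
    have hne := k1.prev_ne_next (h.poly S hS) k4
    have l1 := k1.2.2.2 c' k4.1 k3.2.2.1.symm hne
    have l2 := k3.2.2.2 c k2.1 k1.2.2.1.symm hne.symm
    rw [ori_swap_right] at l2
    linarith
  have d01 : T₀ ≠ T₁ := h.ne_of_isNext hT₀ n₀ p₁
  have d12 : T₁ ≠ T₂ := h.ne_of_isNext hT₁ n₁ p₂
  have d23 : T₂ ≠ T₃ := h.ne_of_isNext hT₂ n₂ p₃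
  have d02 : T₀ ≠ T₂ := step hT₀ hT₁ n₀ p₁ n₁ p₂
  have d13 : T₁ ≠ T₃ := step hT₁ hT₂ n₁ p₂ n₂ p₃
  have heq : ({T₀, T₁, T₂} : Set (Set Plane)) = {T | T ∈ 𝒯 ∧ a ∈ T} := by
    refine Set.eq_of_subset_of_ncard_le ?_ ?_ (h.finite_mem a)
    · rintro T (rfl | rfl | rfl)
      exacts [⟨hT₀, n₀.1.mem⟩, ⟨hT₁, n₁.1.mem⟩, ⟨hT₂, n₂.1.mem⟩]
    · rw [hval, Set.ncard_eq_three.2 ⟨T₀, T₁, T₂, d01, d02, d12, rfl⟩]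
  have hall : ∀ T ∈ 𝒯, a ∈ T → T = T₀ ∨ T = T₁ ∨ T = T₂ := by
    intro T hT haT
    have : T ∈ ({T₀, T₁, T₂} : Set (Set Plane)) := by rw [heq]; exact ⟨hT, haT⟩
    simpa using this
  refine ⟨?_, hall⟩
  rcases hall T₃ hT₃ p₃.2.1.mem with h1 | h1 | h1
  · exact h1
  · exact absurd h1.symm d13
  · exact absurd h1.symm d23

/-- A tile with the corner `a` that reaches below `a` has a side going down from `a`. -/
theorem exists_descending {w : Plane} (hw : w ≠ 0) {a : Plane} (hreg : ∀ T ∈ 𝒯, a ∈ T → IsCornerOf T a) :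
    ∃ T ∈ 𝒯, a ∈ T ∧ ∃ b, (IsNext T a b ∨ IsNext T b a) ∧ cr w b < cr w a := by
  -- Straight down: the tile in this direction lies in the cone of its two sides at `a`, so one of
  -- them descends.
  set d : Plane := !₂[w 1, -(w 0)] with hd
  have hcr : cr w d < 0 := by
    have : cr w d = -along w w := by simp [cr, along, hd]; ring
    rw [this, neg_lt_zero]
    exact along_self_pos hw
  have hd0 : d ≠ 0 := by
    intro h0; rw [h0] at hcr; simp [cr] at hcr
  obtain ⟨T, hT, haT, ε, hε, hmem⟩ := h.exists_tile_direction a d hd0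
  have hP := h.poly T hT
  refine ⟨T, hT, haT, ?_⟩
  obtain ⟨b, hb⟩ := hP.exists_next (hreg T hT haT)
  obtain ⟨q, hq⟩ := hP.exists_prev (hreg T hT haT)
  obtain ⟨s, t, hs, ht, hst⟩ := hb.exists_cone hP hq hmem
  rw [add_sub_cancel_left] at hst
  have h1 := congrArg (cr w) hst
  rw [cr_smul_right, cr_add_right, cr_smul_right, cr_smul_right, cr_sub_right, cr_sub_right] at h1
  by_contra! hc
  have h2 := hc b (Or.inl hb)
  have h3 := hc q (Or.inr hq)
  have h4 := mul_pos hε (neg_pos.2 hcr)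
  have h5 := mul_nonneg hs (sub_nonneg.2 h2)
  have h6 := mul_nonneg ht (sub_nonneg.2 h3)
  linarith

end IsHexTiling

/-! ### The quotient by the period and its face system -/

open scoped Pointwise

theorem ori_add (t a b c : Plane) : ori (t + a) (t + b) (t + c) = ori a b c := by
  simp only [ori, add_sub_add_left_eq_sub]

theorem mem_vadd_iff {t x : Plane} {T : Set Plane} : t + x ∈ t +ᵥ T ↔ x ∈ T :=
  Set.vadd_mem_vadd_set_iff

theorem IsCornerOf.vadd {T : Set Plane} {p : Plane} (hp : IsCornerOf T p) (t : Plane) :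
    IsCornerOf (t +ᵥ T) (t + p) := by
  refine ⟨mem_vadd_iff.2 hp.mem, ?_⟩
  rintro _ ⟨x, hx, rfl⟩ _ ⟨y, hy, rfl⟩ hxy
  change t + x = t + p
  have : p ∈ openSegment ℝ x y := by
    obtain ⟨r, s, hr, hs, hrs, hrp⟩ := hxy
    refine ⟨r, s, hr, hs, hrs, ?_⟩
    have hr' : r = 1 - s := by linarith
    subst hr'
    refine add_left_cancel (a := t) (Eq.trans ?_ hrp)
    simp only [vadd_eq_add]
    module
  rw [hp.2 hx hy this]

theorem isCornerOf_vadd {T : Set Plane} {t p : Plane} :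
    IsCornerOf (t +ᵥ T) (t + p) ↔ IsCornerOf T p :=
  ⟨fun h => by simpa using h.vadd (-t), fun h => h.vadd t⟩

theorem IsNext.vadd {T : Set Plane} {a b : Plane} (h : IsNext T a b) (t : Plane) :
    IsNext (t +ᵥ T) (t + a) (t + b) := by
  refine ⟨h.1.vadd t, h.2.1.vadd t, by simpa using h.2.2.1, fun c hc hca hcb => ?_⟩
  obtain ⟨c, rfl⟩ : ∃ c', c = t + c' := ⟨-t + c, by simp⟩
  rw [ori_add]
  exact h.2.2.2 c (isCornerOf_vadd.1 hc) (by simpa using hca) (by simpa using hcb)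

theorem weight_vadd (w t : Plane) (T : Set Plane) (p : Plane) :
    weight w (t +ᵥ T) (t + p) = weight w T p := by
  have h1 : (∃ q ∈ t +ᵥ T, LexLT w q (t + p)) ↔ ∃ q ∈ T, LexLT w q p := by
    constructor
    · rintro ⟨_, ⟨q, hq, rfl⟩, hl⟩
      refine ⟨q, hq, ?_⟩
      rw [← lexLT_add (a := t), add_comm q, add_comm p]; exact hl
    · rintro ⟨q, hq, hl⟩
      refine ⟨t + q, mem_vadd_iff.2 hq, ?_⟩
      rw [add_comm t, add_comm t, lexLT_add]; exact hl
  have h2 : (∃ q ∈ t +ᵥ T, LexLT w (t + p) q) ↔ ∃ q ∈ T, LexLT w p q := by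
    constructor
    · rintro ⟨_, ⟨q, hq, rfl⟩, hl⟩
      refine ⟨q, hq, ?_⟩
      rw [← lexLT_add (a := t), add_comm q, add_comm p]; exact hl
    · rintro ⟨q, hq, hl⟩
      refine ⟨t + q, mem_vadd_iff.2 hq, ?_⟩
      rw [add_comm t, add_comm t, lexLT_add]; exact hl
  unfold weight
  split_ifs with k k' k'
  · rfl
  · exact absurd ⟨h1.1 k.1, h2.1 k.2⟩ k'
  · exact absurd ⟨h1.2 k'.1, h2.2 k'.2⟩ k
  · rfl

/-- A tiling by hexagons that is invariant under the multiples of `v`. -/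
structure IsPeriodicHexTiling (𝒯 : Set (Set Plane)) (D r : ℝ) (v : Plane) : Prop
    extends IsHexTiling 𝒯 D r where
  ne_zero : v ≠ 0
  vadd_mem : ∀ n : ℤ, ∀ T ∈ 𝒯, n • v +ᵥ T ∈ 𝒯

theorem IsPeriodic.vadd_mem {𝒯 : Set (Set Plane)} {v : Plane}
    (hv : (fun T : Set Plane => (fun x : Plane => v + x) '' T) '' 𝒯 = 𝒯) (n : ℤ) :
    ∀ T ∈ 𝒯, n • v +ᵥ T ∈ 𝒯 := by
  have h1 : ∀ T ∈ 𝒯, v +ᵥ T ∈ 𝒯 := fun T hT => by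
    rw [← hv]; exact ⟨T, hT, rfl⟩
  have h2 : ∀ T ∈ 𝒯, -v +ᵥ T ∈ 𝒯 := fun T hT => by
    rw [← hv] at hT
    obtain ⟨S, hS, rfl⟩ := hT
    have : (-v +ᵥ (fun x => v + x) '' S : Set Plane) = S := neg_vadd_vadd v S
    rwa [this]
  induction n with
  | zero => simp
  | succ n ih =>
    intro T hT
    rw [add_smul, one_smul, add_comm, add_vadd]
    exact h1 _ (ih T hT)
  | pred n ih =>
    intro T hT
    rw [sub_smul, one_smul, sub_eq_neg_add, add_vadd]
    exact h2 _ (ih T hT)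

/-- Pairs of a tile and a corner of it. -/
abbrev Dart (𝒯 : Set (Set Plane)) : Type :=
  {d : Set Plane × Plane // d.1 ∈ 𝒯 ∧ IsCornerOf d.1 d.2}

/-- Tiles up to translation by multiples of `v`. -/
def tileSetoid (𝒯 : Set (Set Plane)) (v : Plane) : Setoid 𝒯 where
  r T T' := ∃ n : ℤ, T'.1 = n • v +ᵥ T.1
  iseqv :=
    { refl := fun T => ⟨0, by simp⟩
      symm := by
        rintro T T' ⟨n, hn⟩
        exact ⟨-n, by rw [hn, vadd_vadd, ← add_smul]; simp⟩
      trans := by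
        rintro T T' T'' ⟨n, hn⟩ ⟨m, hm⟩
        exact ⟨m + n, by rw [hm, hn, vadd_vadd, ← add_smul]⟩ }

/-- Darts up to translation by multiples of `v`. -/
def dartSetoid (𝒯 : Set (Set Plane)) (v : Plane) : Setoid (Dart 𝒯) where
  r d e := ∃ n : ℤ, e.1.1 = n • v +ᵥ d.1.1 ∧ e.1.2 = n • v + d.1.2
  iseqv :=
    { refl := fun T => ⟨0, by simp⟩
      symm := by
        rintro T T' ⟨n, hn, hn'⟩
        refine ⟨-n, by rw [hn, vadd_vadd, ← add_smul]; simp, ?_⟩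
        rw [hn', ← add_assoc, ← add_smul]; simp
      trans := by
        rintro T T' T'' ⟨n, hn, hn'⟩ ⟨m, hm, hm'⟩
        refine ⟨m + n, by rw [hm, hn, vadd_vadd, ← add_smul], ?_⟩
        rw [hm', hn', ← add_assoc, ← add_smul] }

/-- Points up to translation by multiples of `v`. -/
def pointSetoid (v : Plane) : Setoid Plane where
  r p q := ∃ n : ℤ, q = n • v + p
  iseqv :=
    { refl := fun T => ⟨0, by simp⟩
      symm := by
        rintro T T' ⟨n, hn'⟩
        exact ⟨-n, by rw [hn', ← add_assoc, ← add_smul]; simp⟩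
      trans := by
        rintro T T' T'' ⟨n, hn'⟩ ⟨m, hm'⟩
        exact ⟨m + n, by rw [hm', hn', ← add_assoc, ← add_smul]⟩ }

abbrev TileClass (𝒯 : Set (Set Plane)) (v : Plane) : Type := Quotient (tileSetoid 𝒯 v)

abbrev DartClass (𝒯 : Set (Set Plane)) (v : Plane) : Type := Quotient (dartSetoid 𝒯 v)

abbrev PointClass (v : Plane) : Type := Quotient (pointSetoid v)

/-- The class of the corner `p` of the tile `T`. -/
def dartClass (v : Plane) {𝒯 : Set (Set Plane)} {T : Set Plane} {p : Plane} (hT : T ∈ 𝒯)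
    (hp : IsCornerOf T p) : DartClass 𝒯 v := Quotient.mk (dartSetoid 𝒯 v) ⟨(T, p), hT, hp⟩

def tileClass (v : Plane) {𝒯 : Set (Set Plane)} {T : Set Plane} (hT : T ∈ 𝒯) : TileClass 𝒯 v :=
  Quotient.mk (tileSetoid 𝒯 v) ⟨T, hT⟩

theorem dartClass_eq_iff {v : Plane} {𝒯 : Set (Set Plane)} {T T' : Set Plane} {p p' : Plane}
    {hT : T ∈ 𝒯} {hp : IsCornerOf T p} {hT' : T' ∈ 𝒯} {hp' : IsCornerOf T' p'} :
    dartClass v hT hp = dartClass v hT' hp' ↔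
      ∃ n : ℤ, T' = n • v +ᵥ T ∧ p' = n • v + p :=
  Quotient.eq (r := dartSetoid 𝒯 v)

theorem dartClass_vadd {v : Plane} {𝒯 : Set (Set Plane)} {T : Set Plane} {p : Plane} (hT : T ∈ 𝒯)
    (hp : IsCornerOf T p) (n : ℤ) (hnT : n • v +ᵥ T ∈ 𝒯) :
    dartClass v hT hp = dartClass v hnT (hp.vadd (n • v)) :=
  dartClass_eq_iff.2 ⟨n, rfl, rfl⟩

theorem tileClass_eq_iff {v : Plane} {𝒯 : Set (Set Plane)} {T T' : Set Plane}
    {hT : T ∈ 𝒯} {hT' : T' ∈ 𝒯} :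
    tileClass v hT = tileClass v hT' ↔ ∃ n : ℤ, T' = n • v +ᵥ T :=
  Quotient.eq (r := tileSetoid 𝒯 v)

namespace DartClass

variable {𝒯 : Set (Set Plane)} {v : Plane}

theorem exists_rep (d : DartClass 𝒯 v) :
    ∃ (T : Set Plane) (p : Plane) (hT : T ∈ 𝒯) (hp : IsCornerOf T p), d = dartClass v hT hp := by
  induction d using Quotient.inductionOn with
  | h d => exact ⟨d.1.1, d.1.2, d.2.1, d.2.2, rfl⟩

/-- The tile of a dart. -/
def tile (d : DartClass 𝒯 v) : TileClass 𝒯 v :=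
  Quotient.map (sa := dartSetoid 𝒯 v) (sb := tileSetoid 𝒯 v)
    (fun d : Dart 𝒯 => (⟨d.1.1, d.2.1⟩ : 𝒯)) (by rintro _ _ ⟨n, hn, -⟩; exact ⟨n, hn⟩) d

/-- The corner of a dart. -/
def vert (d : DartClass 𝒯 v) : PointClass v :=
  Quotient.map (sa := dartSetoid 𝒯 v) (sb := pointSetoid v)
    (fun d : Dart 𝒯 => d.1.2) (by rintro _ _ ⟨n, -, hn⟩; exact ⟨n, hn⟩) d

/-- The height of the corner of a dart. -/
def ht {w : Plane} (hw : cr w v = 0) (d : DartClass 𝒯 v) : ℝ :=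
  Quotient.lift (s := dartSetoid 𝒯 v) (fun d : Dart 𝒯 => cr w d.1.2) (by
    rintro a b ⟨n, -, hn⟩
    rw [hn, ← Int.cast_smul_eq_zsmul ℝ, cr_add_right, cr_smul_right, hw, mul_zero, zero_add]) d

/-- The weight of a dart. -/
noncomputable def wt (w : Plane) (d : DartClass 𝒯 v) : ℤ :=
  Quotient.lift (s := dartSetoid 𝒯 v) (fun d : Dart 𝒯 => weight w d.1.1 d.1.2) (by
    rintro a b ⟨n, hn, hn'⟩
    rw [hn, hn', weight_vadd]) d

theorem ht_mk {w : Plane} (hw : cr w v = 0) {T : Set Plane} {p : Plane} (hT : T ∈ 𝒯)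
    (hp : IsCornerOf T p) : ht hw (dartClass v hT hp) = cr w p := rfl

theorem wt_mk {w : Plane} {T : Set Plane} {p : Plane} (hT : T ∈ 𝒯)
    (hp : IsCornerOf T p) : wt w (dartClass v hT hp) = weight w T p := rfl

theorem vert_eq_iff {T T' : Set Plane} {p p' : Plane} {hT : T ∈ 𝒯} {hp : IsCornerOf T p}
    {hT' : T' ∈ 𝒯} {hp' : IsCornerOf T' p'} :
    vert (dartClass v hT hp) = vert (dartClass v hT' hp') ↔ ∃ n : ℤ, p' = n • v + p :=
  Quotient.eq (r := pointSetoid v)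

theorem ht_eq_of_vert_eq {w : Plane} (hw : cr w v = 0) {d e : DartClass 𝒯 v}
    (h : vert d = vert e) : ht hw d = ht hw e := by
  obtain ⟨T, p, hT, hp, rfl⟩ := d.exists_rep
  obtain ⟨T', p', hT', hp', rfl⟩ := e.exists_rep
  obtain ⟨n, rfl⟩ := vert_eq_iff.1 h
  rw [ht_mk, ht_mk, ← Int.cast_smul_eq_zsmul ℝ, cr_add_right, cr_smul_right, hw, mul_zero,
    zero_add]

theorem exists_corner_of_tile_eq {T : Set Plane} (hT : T ∈ 𝒯) {d : DartClass 𝒯 v}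
    (hd : d.tile = tileClass v hT) :
    ∃ (p : Plane) (hp : IsCornerOf T p), d = dartClass v hT hp := by
  obtain ⟨T', p, hT', hp, rfl⟩ := d.exists_rep
  obtain ⟨n, rfl⟩ := tileClass_eq_iff.1 hd
  exact ⟨n • v + p, hp.vadd _, dartClass_eq_iff.2 ⟨n, rfl, rfl⟩⟩

theorem tile_inj {T T' : Set Plane} {hT : T ∈ 𝒯} {hT' : T' ∈ 𝒯} {p : Plane}
    {hp : IsCornerOf T p} {hp' : IsCornerOf T' p}
    (he : dartClass v hT hp = dartClass v hT' hp') : T = T' := by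
  obtain ⟨n, rfl, hn⟩ := dartClass_eq_iff.1 he
  have : n • v = 0 := by simpa using hn.symm
  rw [this, zero_vadd]

end DartClass

namespace IsPeriodicHexTiling

variable {𝒯 : Set (Set Plane)} {D r : ℝ} {v : Plane} (h : IsPeriodicHexTiling 𝒯 D r v)

include h

/-- The coordinate along `v` has a maximum on the compact tile. So a tile keeps its six corners
distinct in the quotient. -/
theorem vadd_ne {T : Set Plane} (hT : T ∈ 𝒯) {n : ℤ} (hn : n • v +ᵥ T = T) : n = 0 := by
  have hP := h.poly T hT
  obtain ⟨c, hc, -⟩ := hP.exists_corner_ne 0 0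
  obtain ⟨x, hx, hmax⟩ := hP.isCompact.exists_isMaxOn ⟨c, hc.mem⟩
    (f := along v) (by unfold along; fun_prop)
  have hvpos := along_self_pos h.ne_zero
  have e : ∀ m : ℤ, along v (m • v + x) = m * along v v + along v x := fun m => by
    rw [← Int.cast_smul_eq_zsmul ℝ]; simp [along]; ring
  have h1 : n • v + x ∈ T := by
    have : n • v + x ∈ n • v +ᵥ T := mem_vadd_iff.2 hx
    rwa [hn] at this
  have h2 : (-n) • v + x ∈ T := by
    rw [← hn] at hx
    rw [← mem_vadd_iff (t := n • v), ← add_assoc, ← add_smul]; simpa using hx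
  have h3 := hmax h1
  have h4 := hmax h2
  simp only [Set.mem_ofPred_eq, e] at h3 h4
  push_cast at h4
  have : (n : ℝ) * along v v = 0 := by linarith
  have := (mul_eq_zero.1 this).resolve_right hvpos.ne'
  exact_mod_cast this

theorem corner_inj {T : Set Plane} {hT : T ∈ 𝒯} {p q : Plane} {hp : IsCornerOf T p}
    {hq : IsCornerOf T q} (he : dartClass v hT hp = dartClass v hT hq) : p = q := by
  obtain ⟨n, hn, rfl⟩ := dartClass_eq_iff.1 he
  rw [h.vadd_ne hT hn.symm]; simp

theorem card_fiber (q : TileClass 𝒯 v) : {d : DartClass 𝒯 v | d.tile = q}.ncard = 6 := by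
  induction q using Quotient.inductionOn with
  | h T =>
    obtain ⟨T, hT⟩ := T
    rw [← h.card T hT]
    symm
    refine Set.ncard_congr (fun p hp => dartClass v hT hp) (fun p hp => rfl) ?_ ?_
    · intro p q hp hq he
      exact h.corner_inj he
    · intro d hd
      obtain ⟨p, hp, rfl⟩ := DartClass.exists_corner_of_tile_eq hT hd
      exact ⟨p, hp, rfl⟩

/-- The sum of the weights around a vertex, in the quotient and in the plane. -/
theorem sum_wt (w : Plane) {T : Set Plane} {p : Plane} (hT : T ∈ 𝒯) (hp : IsCornerOf T p) :
    ∑ᶠ e ∈ {e : DartClass 𝒯 v | e.vert = (dartClass v hT hp).vert}, e.wt w =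
      ∑ᶠ T' ∈ {T' | T' ∈ 𝒯 ∧ IsCornerOf T' p}, weight w T' p := by
  rw [← finsum_set_coe_eq_finsum_mem, ← finsum_set_coe_eq_finsum_mem]
  symm
  refine finsum_eq_of_bijective (fun T' : {T' | T' ∈ 𝒯 ∧ IsCornerOf T' p} =>
    (⟨dartClass v T'.2.1 T'.2.2, rfl⟩ :
      {e : DartClass 𝒯 v | e.vert = (dartClass v hT hp).vert})) ⟨?_, ?_⟩ fun T' => rfl
  · rintro ⟨T₁, h₁, h₁'⟩ ⟨T₂, h₂, h₂'⟩ he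
    exact Subtype.ext (DartClass.tile_inj (hT := h₁) (hT' := h₂) (hp := h₁') (hp' := h₂') (Subtype.ext_iff.1 he))
  · rintro ⟨e, he⟩
    obtain ⟨T', p', hT', hp', rfl⟩ := e.exists_rep
    obtain ⟨n, rfl⟩ := DartClass.vert_eq_iff.1 he
    exact ⟨⟨n • v +ᵥ T', h.vadd_mem n T' hT', hp'.vadd _⟩,
      Subtype.ext (dartClass_vadd hT' hp' n (h.vadd_mem n T' hT')).symm⟩

end IsPeriodicHexTiling

namespace DartClass

variable {𝒯 : Set (Set Plane)} {v : Plane}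

/-- The dart `e` follows `d` in its tile. -/
def Follows (d e : DartClass 𝒯 v) : Prop :=
  ∃ (T : Set Plane) (a b : Plane) (hT : T ∈ 𝒯) (hn : IsNext T a b),
    d = dartClass v hT hn.1 ∧ e = dartClass v hT hn.2.1

/-- The sides that start at the darts `d` and `e` are the same. -/
def Opposite (d e : DartClass 𝒯 v) : Prop :=
  ∃ (T T' : Set Plane) (a b : Plane) (hT : T ∈ 𝒯) (hT' : T' ∈ 𝒯) (hn : IsNext T a b)
    (hn' : IsNext T' b a), d = dartClass v hT hn.1 ∧ e = dartClass v hT' hn'.1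

theorem Follows.right_unique {d e e' : DartClass 𝒯 v} (h : Follows d e) (h' : Follows d e') :
    e = e' := by
  obtain ⟨T, a, b, hT, hn, rfl, rfl⟩ := h
  obtain ⟨T', a', b', hT', hn', he, rfl⟩ := h'
  obtain ⟨n, rfl, rfl⟩ := dartClass_eq_iff.1 he
  exact dartClass_eq_iff.2 ⟨n, rfl, hn'.right_unique (hn.vadd _)⟩

theorem Follows.left_unique {d d' e : DartClass 𝒯 v} (h : Follows d e) (h' : Follows d' e) :
    d = d' := by
  obtain ⟨T, a, b, hT, hn, rfl, rfl⟩ := h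
  obtain ⟨T', a', b', hT', hn', rfl, he⟩ := h'
  obtain ⟨n, rfl, rfl⟩ := dartClass_eq_iff.1 he
  exact dartClass_eq_iff.2 ⟨n, rfl, hn'.left_unique (hn.vadd _)⟩

theorem Opposite.symm {d e : DartClass 𝒯 v} (h : Opposite d e) : Opposite e d := by
  obtain ⟨T, T', a, b, hT, hT', hn, hn', rfl, rfl⟩ := h
  exact ⟨T', T, b, a, hT', hT, hn', hn, rfl, rfl⟩

open Classical in
/-- The dart at the other end of the side that starts at `d`, if that is a side of two tiles. -/
noncomputable def opp (d : DartClass 𝒯 v) : DartClass 𝒯 v :=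
  -- The default `d` makes `opp` an involution even where a side has no matching neighbour.
  if h : ∃ e, Opposite d e then h.choose else d

end DartClass

namespace IsPeriodicHexTiling

open DartClass

variable {𝒯 : Set (Set Plane)} {D r : ℝ} {v : Plane} (h : IsPeriodicHexTiling 𝒯 D r v)

include h

theorem exists_follows (d : DartClass 𝒯 v) : ∃ e, Follows d e := by
  obtain ⟨T, a, hT, ha, rfl⟩ := d.exists_rep
  obtain ⟨b, hb⟩ := (h.poly T hT).exists_next ha
  exact ⟨_, T, a, b, hT, hb, rfl, rfl⟩

theorem exists_follows_left (e : DartClass 𝒯 v) : ∃ d, Follows d e := by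
  obtain ⟨T, b, hT, hb, rfl⟩ := e.exists_rep
  obtain ⟨a, ha⟩ := (h.poly T hT).exists_prev hb
  exact ⟨_, T, a, b, hT, ha, rfl, rfl⟩

theorem opposite_right_unique {d e e' : DartClass 𝒯 v} (h₁ : Opposite d e) (h₂ : Opposite d e') :
    e = e' := by
  obtain ⟨T, S, a, b, hT, hS, hn, hm, rfl, rfl⟩ := h₁
  obtain ⟨T', S', a', b', hT', hS', hn', hm', he, rfl⟩ := h₂
  obtain ⟨n, rfl, rfl⟩ := dartClass_eq_iff.1 he
  obtain rfl := hn'.right_unique (hn.vadd _)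
  exact dartClass_eq_iff.2
    ⟨n, h.neighbour_unique hS' (h.vadd_mem n S hS) hm' (hm.vadd _), rfl⟩

theorem opp_eq {d e : DartClass 𝒯 v} (he : Opposite d e) : d.opp = e := by
  have hex : ∃ e, Opposite d e := ⟨e, he⟩
  unfold opp
  rw [dif_pos hex]
  exact h.opposite_right_unique hex.choose_spec he

theorem opp_opp (d : DartClass 𝒯 v) : d.opp.opp = d := by
  by_cases hex : ∃ e, Opposite d e
  · obtain ⟨e, he⟩ := hex
    rw [h.opp_eq he, h.opp_eq he.symm]
  · have : d.opp = d := by unfold opp; rw [dif_neg hex]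
    rw [this, this]

/-- Passing to the following corner. -/
noncomputable def next : Equiv.Perm (DartClass 𝒯 v) :=
  Equiv.ofBijective (fun d => (h.exists_follows d).choose) (by
    constructor
    · intro d d' he
      have h1 := (h.exists_follows d).choose_spec
      have h2 := (h.exists_follows d').choose_spec
      simp only at he
      rw [← he] at h2
      exact h1.left_unique h2
    · intro e
      obtain ⟨d, hd⟩ := h.exists_follows_left e
      exact ⟨d, (h.exists_follows d).choose_spec.right_unique hd⟩)

theorem next_eq {d e : DartClass 𝒯 v} (he : Follows d e) : h.next d = e :=
  Follows.right_unique (h.exists_follows d).choose_spec he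

theorem next_mk {T : Set Plane} {a b : Plane} (hT : T ∈ 𝒯) (hn : IsNext T a b) :
    h.next (dartClass v hT hn.1) = dartClass v hT hn.2.1 :=
  h.next_eq ⟨T, a, b, hT, hn, rfl, rfl⟩

theorem opp_mk {T T' : Set Plane} {a b : Plane} (hT : T ∈ 𝒯) (hT' : T' ∈ 𝒯) (hn : IsNext T a b)
    (hn' : IsNext T' b a) : (dartClass v hT hn.1).opp = dartClass v hT' hn'.1 :=
  h.opp_eq ⟨T, T', a, b, hT, hT', hn, hn', rfl, rfl⟩

theorem transitive (C : Set (DartClass 𝒯 v)) (d : DartClass 𝒯 v) (hd : d ∈ C)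
    (hC : ∀ x ∈ C, x.tile = d.tile → h.next x ∈ C) (e : DartClass 𝒯 v) (he : e.tile = d.tile) :
    e ∈ C := by
  obtain ⟨T, a, hT, ha, rfl⟩ := d.exists_rep
  obtain ⟨c, hc, rfl⟩ := DartClass.exists_corner_of_tile_eq hT he
  have := (h.poly T hT).corner_mem_of_closed
    (C := {p | ∃ hp : IsCornerOf T p, dartClass v hT hp ∈ C}) (fun x hx => hx.1) ?_
    ⟨a, ha, hd⟩ hc
  · exact this.2
  · rintro x ⟨hx, hxC⟩ b hb
    refine ⟨hb.2.1, ?_⟩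
    rw [← h.next_mk hT hb]
    exact hC _ hxC rfl

theorem abs_cr_sub_le (w : Plane) {T : Set Plane} (hT : T ∈ 𝒯) {x y : Plane} (hx : x ∈ T)
    (hy : y ∈ T) : cr w x ≤ cr w y + (|w 0| + |w 1|) * D := by
  have h1 := h.diam T hT x hx y hy
  rw [dist_eq_norm] at h1
  have h2 : ∀ i, |(x - y) i| ≤ D := fun i => (PiLp.norm_apply_le (x - y) i).trans h1
  have h3 : cr w x - cr w y = w 0 * (x - y) 1 - w 1 * (x - y) 0 := by
    rw [← cr_sub_right]; rfl
  have h4 : w 0 * (x - y) 1 ≤ |w 0| * D := by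
    refine (le_abs_self _).trans ?_
    rw [abs_mul]
    exact mul_le_mul_of_nonneg_left (h2 1) (abs_nonneg _)
  have h5 : -(w 1 * (x - y) 0) ≤ |w 1| * D := by
    refine (neg_le_abs _).trans ?_
    rw [abs_mul]
    exact mul_le_mul_of_nonneg_left (h2 0) (abs_nonneg _)
  linarith

/-- Few darts lie in a band parallel to the period. -/
theorem exists_band_bound {w : Plane} (hw : w ≠ 0) (hwv : cr w v = 0) (K : ℝ) :
    ∃ N : ℕ, ∀ b, {d : DartClass 𝒯 v | b - K < d.ht hwv ∧ d.ht hwv < b + K}.Finite ∧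
      {d : DartClass 𝒯 v | b - K < d.ht hwv ∧ d.ht hwv < b + K}.ncard ≤ N := by
  set L := along w w with hL
  have hLpos : 0 < L := along_self_pos hw
  obtain ⟨k, hk⟩ := eq_smul_of_cr_eq_zero hw hwv
  set M := along w v with hM
  have hMk : M = k * L := by rw [hM, hk, hL]; simp [along]; ring
  have hM0 : M ≠ 0 := by
    rw [hMk]
    refine mul_ne_zero (fun hk0 => h.ne_zero ?_) hLpos.ne'
    rw [hk, hk0, zero_smul]
  set y := (K ^ 2 + M ^ 2) / L with hy
  have hy0 : 0 ≤ y := by positivity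
  obtain ⟨N₀, hN₀⟩ := h.exists_packing (y + 1)
  refine ⟨6 * N₀, fun b => ?_⟩
  set c : Plane := (b / L) • !₂[-(w 1), w 0] with hc
  have hc1 : cr w c = b := by
    have : cr w !₂[-(w 1), w 0] = L := by simp [cr, hL, along]
    rw [hc, cr_smul_right, this]; field_simp
  have hc2 : along w c = 0 := by
    rw [hc]; simp [along]; ring
  set A := {T | T ∈ 𝒯 ∧ (T ∩ Metric.ball c (y + 1)).Nonempty} with hA
  obtain ⟨hfin, hcard⟩ := hN₀ c
  have hsub : {d : DartClass 𝒯 v | b - K < d.ht hwv ∧ d.ht hwv < b + K} ⊆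
      ⋃ T ∈ hfin.toFinset.attach,
        {d | d.tile = tileClass v ((hfin.mem_toFinset.1 T.2).1 : T.1 ∈ 𝒯)} := by
    intro d hd
    obtain ⟨T, p, hT, hp, rfl⟩ := d.exists_rep
    rw [Set.mem_ofPred_eq, ht_mk] at hd
    -- This multiple of `v` brings the corner to within one period of `c` along `w`, so that the
    -- translated tile meets a fixed ball around `c`.
    set n := ⌊-(along w p / M)⌋ with hn
    have hn1 := Int.floor_le (-(along w p / M))
    have hn2 := (Int.lt_floor_add_one (-(along w p / M))).le
    rw [← hn] at hn1 hn2
    have hp1 : cr w (n • v + p) = cr w p := by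
      rw [← Int.cast_smul_eq_zsmul ℝ, cr_add_right, cr_smul_right, hwv]; ring
    have hp2 : along w (n • v + p) = n * M + along w p := by
      rw [← Int.cast_smul_eq_zsmul ℝ, hM]; simp [along]; ring
    have hp3 : (n * M + along w p) ^ 2 ≤ M ^ 2 := by
      have : n * M + along w p = (n + along w p / M) * M := by field_simp
      rw [this, mul_pow]
      have h1 : (n + along w p / M) ^ 2 ≤ 1 := by
        rw [sq_le_one_iff_abs_le_one, abs_le]; constructor <;> linarith
      nlinarith [sq_nonneg M]
    have hTA : n • v +ᵥ T ∈ hfin.toFinset := by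
      rw [hfin.mem_toFinset]
      refine ⟨h.vadd_mem n T hT, n • v + p, mem_vadd_iff.2 hp.mem, ?_⟩
      rw [Metric.mem_ball, dist_eq_norm]
      have h1 : L * ‖n • v + p - c‖ ^ 2 =
          cr w (n • v + p - c) ^ 2 + along w (n • v + p - c) ^ 2 := by
        rw [EuclideanSpace.norm_sq_eq]
        simp only [Fin.sum_univ_two, Real.norm_eq_abs, sq_abs, hL, along, cr]
        ring
      have h2 : cr w (n • v + p - c) ^ 2 ≤ K ^ 2 := by
        rw [cr_sub_right, hp1, hc1]
        nlinarith
      have h3 : along w (n • v + p - c) ^ 2 ≤ M ^ 2 := by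
        have : along w (n • v + p - c) = along w (n • v + p) - along w c := by
          simp only [along, PiLp.sub_apply]; ring
        rw [this, hp2, hc2, sub_zero]; exact hp3
      have h4 : ‖n • v + p - c‖ ^ 2 ≤ y := by
        rw [hy, le_div_iff₀ hLpos]; linarith
      nlinarith [norm_nonneg (n • v + p - c)]
    simp only [Set.mem_iUnion]
    refine ⟨⟨_, hTA⟩, Finset.mem_attach _ _, ?_⟩
    exact tileClass_eq_iff.2 ⟨n, rfl⟩
  have hfib : ∀ q : TileClass 𝒯 v, {d : DartClass 𝒯 v | d.tile = q}.Finite := fun q =>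
    Set.finite_of_ncard_ne_zero (by rw [h.card_fiber]; norm_num)
  have hUfin := hfin.toFinset.attach.finite_toSet.biUnion fun T _ =>
    hfib (tileClass v ((hfin.mem_toFinset.1 T.2).1 : T.1 ∈ 𝒯))
  refine ⟨hUfin.subset hsub, (Set.ncard_le_ncard hsub hUfin).trans ?_⟩
  refine (Finset.set_ncard_biUnion_le _ _).trans ?_
  simp only [h.card_fiber, Finset.sum_const, Finset.card_attach, smul_eq_mul]
  rw [Set.ncard_eq_toFinset_card _ hfin] at hcard
  omega

/-- The combinatorial system of a periodic tiling. -/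
noncomputable def hexSystem {w : Plane} (hw : w ≠ 0) (hwv : cr w v = 0) :
    HexSystem (DartClass 𝒯 v) (TileClass 𝒯 v) where
  next := h.next
  opp := opp
  tile := tile
  ht := ht hwv
  diam := (|w 0| + |w 1|) * D
  card_fiber := h.card_fiber
  tile_next d := by
    obtain ⟨e, he⟩ := h.exists_follows d
    rw [h.next_eq he]
    obtain ⟨T, a, b, hT, hn, rfl, rfl⟩ := he
    rfl
  transitive := h.transitive
  opp_opp := h.opp_opp
  ht_le d e hde := by
    obtain ⟨T, p, hT, hp, rfl⟩ := e.exists_rep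
    obtain ⟨q, hq, rfl⟩ := DartClass.exists_corner_of_tile_eq hT hde
    exact h.abs_cr_sub_le w hT hq.mem hp.mem
  finite_band c c' := by
    obtain ⟨N, hN⟩ := h.exists_band_bound hw hwv ((c' - c) / 2)
    convert (hN ((c + c') / 2)).1 using 3
    ring_nf

end IsPeriodicHexTiling

/-! ### Reversal of height and the conclusion -/

namespace HexSystem

variable {Δ Q : Type*}

/-- Turning a system upside down reverses the sign of the flux. -/
theorem flux_neg (H H' : HexSystem Δ Q) (htile : ∀ d, H'.tile d = H.tile d)
    (hht : ∀ d, H'.ht d = -H.ht d) {b : ℝ} (hgen : ∀ d, H.ht d ≠ b) :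
    H'.flux (-b) = -H.flux b := by
  have hF : H'.crossFaces (-b) = H.crossFaces b := by
    ext q
    simp only [crossFaces, htile, hht, neg_lt_neg_iff, Set.mem_ofPred_eq]
    exact and_comm
  have hD : H'.crossDarts (-b) =
      {d | b < H.ht d ∧ ∃ e, H.tile e = H.tile d ∧ H.ht e < b} := by
    ext d
    simp only [crossDarts, htile, hht, neg_lt_neg_iff]
  have hfin := (H.finite_crossDarts b).image H.tile
  rw [← crossFaces_eq] at hfin
  have hfin' : {d | H.tile d ∈ H.crossFaces b}.Finite := by
    have : {d | H.tile d ∈ H.crossFaces b} = ⋃ q ∈ H.crossFaces b, {d | H.tile d = q} := by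
      ext d; simp
    rw [this]
    exact hfin.biUnion fun q _ => H.finite_fiber q
  -- Each crossed face has six corners in all, so `C` of them below `b` and `F` crossed faces give
  -- `(6F - C) - 3F = -(C - 3F)`.
  have hunion : H.crossDarts b ∪ H'.crossDarts (-b) = {d | H.tile d ∈ H.crossFaces b} := by
    rw [hD]
    ext d
    constructor
    · rintro (⟨h1, h2⟩ | ⟨h1, h2⟩)
      · exact ⟨⟨d, rfl, h1⟩, h2⟩
      · exact ⟨h2, d, rfl, h1⟩
    · rintro ⟨h1, h2⟩
      rcases lt_or_gt_of_ne (hgen d) with h3 | h3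
      · exact Or.inl ⟨h3, h2⟩
      · exact Or.inr ⟨h3, h1⟩
  have hdisj : Disjoint (H.crossDarts b) (H'.crossDarts (-b)) := by
    rw [hD, Set.disjoint_left]
    intro d h1 h2
    exact lt_asymm h1.1 h2.1
  have hsum := Set.ncard_union_eq hdisj (hfin'.subset (hunion ▸ Set.subset_union_left))
    (hfin'.subset (hunion ▸ Set.subset_union_right))
  rw [hunion, H.ncard_tile_mem _ hfin] at hsum
  unfold flux
  rw [hF]
  omega

end HexSystem

theorem IsPolygon.not_lexLT {w m : Plane} {T : Set Plane} (hT : IsPolygon T)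
    (hm : ∀ c, IsCornerOf T c → ¬ LexLT w c m) {x : Plane} (hx : x ∈ T) : ¬ LexLT w x m := by
  have hiff : ∀ x, ¬ LexLT w x m ↔
      cr w m < cr w x ∨ (cr w m = cr w x ∧ along w m ≤ along w x) := by
    intro x
    unfold LexLT
    rcases lt_trichotomy (cr w x) (cr w m) with h | h | h
    · simp [h, h.not_gt, h.ne']
    · simp [h]
    · simp [h, h.not_gt, h.ne']
  have hconv : Convex ℝ {x | ¬ LexLT w x m} := by
    intro x hx y hy s t hs ht hst
    rw [Set.mem_ofPred_eq, hiff] at hx hy ⊢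
    have e1 : cr w (s • x + t • y) = s * cr w x + t * cr w y := by
      rw [cr_add_right, cr_smul_right, cr_smul_right]
    have e2 : along w (s • x + t • y) = s * along w x + t * along w y := by
      simp [along]; ring
    rw [e1, e2]
    rcases hs.eq_or_lt with rfl | hs
    · obtain rfl : t = 1 := by linarith
      simpa using hy
    rcases ht.eq_or_lt with rfl | ht
    · obtain rfl : s = 1 := by linarith
      simpa using hx
    obtain rfl : s = 1 - t := by linarith
    rcases hx with hx | ⟨hx, hx'⟩ <;> rcases hy with hy | ⟨hy, hy'⟩
    · left; nlinarith
    · left; rw [← hy]; nlinarith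
    · left; rw [← hx]; nlinarith
    · right; rw [← hx, ← hy]; constructor <;> nlinarith
  rw [hT.eq_hull] at hx
  exact convexHull_min (fun c hc => hm c hc) hconv hx

/-- Each polygon has a lowest corner. -/
theorem IsPolygon.exists_lexLT_corner {w : Plane} (hw : w ≠ 0) {T : Set Plane} (hT : IsPolygon T) :
    ∃ m, IsCornerOf T m ∧ (∀ c, IsCornerOf T c → c ≠ m → LexLT w m c) ∧
      ∀ x ∈ T, ¬ LexLT w x m := by
  obtain ⟨c, hc, -⟩ := hT.exists_corner_ne 0 0
  obtain ⟨m, hm, hmin⟩ := Set.exists_min_image (T.extremePoints ℝ)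
    (fun p => toLex (cr w p, along w p)) hT.finite ⟨c, hc⟩
  have hnot : ∀ c, IsCornerOf T c → ¬ LexLT w c m := by
    intro c hc hlt
    refine absurd (hmin c hc) (not_le.2 ?_)
    rw [Prod.Lex.lt_iff]
    exact hlt
  exact ⟨m, hm, fun c hc hcm => (LexLT.total hw hcm).resolve_left (hnot c hc),
    fun x hx => hT.not_lexLT hnot hx⟩

theorem cr_le_of_lexLT {w p q : Plane} (h : LexLT w p q) : cr w p ≤ cr w q :=
  h.elim le_of_lt fun h => h.1.le

namespace IsPeriodicHexTiling

open DartClass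

variable {𝒯 : Set (Set Plane)} {D r : ℝ} {v : Plane} (h : IsPeriodicHexTiling 𝒯 D r v)
  {w : Plane} (hw : w ≠ 0) (hwv : cr w v = 0)

include h

include hw in
-- Breaking ties along `w` makes the lowest and the highest corner unique even if a side is
-- horizontal.
theorem isCornerWeight : (h.hexSystem hw hwv).IsCornerWeight (wt w) := by
  intro q
  induction q using Quotient.inductionOn with
  | h T =>
    obtain ⟨T, hT⟩ := T
    have hP := h.poly T hT
    obtain ⟨m, hm, hm1, hm2⟩ := hP.exists_lexLT_corner hw
    obtain ⟨M, hM, hM1, hM2⟩ := hP.exists_lexLT_corner (neg_ne_zero.2 hw)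
    simp only [lexLT_neg] at hM1 hM2
    have hmM : m ≠ M := by
      rintro rfl
      obtain ⟨c, hc, hcm, -⟩ := hP.exists_corner_ne m m
      exact LexLT.irrefl _ _ ((hm1 c hc hcm).trans (hM1 c hc hcm))
    refine ⟨dartClass v hT hm, dartClass v hT hM, rfl, rfl, fun he => hmM (h.corner_inj he),
      ?_, ?_, ?_, ?_⟩
    · rw [wt_mk]
      exact if_neg fun hc => hc.1.elim fun x hx => hm2 x hx.1 hx.2
    · rw [wt_mk]
      exact if_neg fun hc => hc.2.elim fun x hx => hM2 x hx.1 hx.2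
    · intro d hd hdm hdM
      obtain ⟨p, hp, rfl⟩ := DartClass.exists_corner_of_tile_eq hT hd
      rw [wt_mk]
      refine if_pos ⟨⟨m, hm.mem, hm1 p hp ?_⟩, M, hM.mem, hM1 p hp ?_⟩
      · rintro rfl; exact hdm rfl
      · rintro rfl; exact hdM rfl
    · intro d hd
      obtain ⟨p, hp, rfl⟩ := DartClass.exists_corner_of_tile_eq hT hd
      constructor
      · change cr w m ≤ cr w p
        by_cases hpm : p = m
        · rw [hpm]
        · exact cr_le_of_lexLT (hm1 p hp hpm)
      · change cr w p ≤ cr w M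
        by_cases hpm : p = M
        · rw [hpm]
        · exact cr_le_of_lexLT (hM1 p hp hpm)

/-- `K` bounds the height of a tile. A side that starts above `y₀ + K` therefore stays above `y₀`,
where only corners meet, so a tile lies across it and three turns lead back to the first tile. -/
theorem regularAbove (y₀ : ℝ) (hy : ∀ d : DartClass 𝒯 v, y₀ < d.ht hwv →
    ∑ᶠ e ∈ {e : DartClass 𝒯 v | e.vert = d.vert}, e.wt w = 0) :
    (h.hexSystem hw hwv).RegularAbove (y₀ + (|w 0| + |w 1|) * D) := by
  set K := (|w 0| + |w 1|) * D with hK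
  have reg : ∀ T ∈ 𝒯, ∀ p, IsCornerOf T p → y₀ < cr w p →
      (∀ T' ∈ 𝒯, p ∈ T' → IsCornerOf T' p) ∧ {T' | T' ∈ 𝒯 ∧ p ∈ T'}.ncard = 3 := by
    intro T hT p hp hlt
    refine (h.sum_weight hw hT hp).2 ?_
    rw [← h.sum_wt w hT hp]
    exact hy _ hlt
  have nb : ∀ T ∈ 𝒯, ∀ a b, IsNext T a b → y₀ + K < cr w a → ∃ T' ∈ 𝒯, IsNext T' b a := by
    intro T hT a b hn hlt
    refine h.exists_neighbour hT hn fun x hx T' hT' hx' => (reg T' hT' x hx' ?_).1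
    have h1 := h.abs_cr_sub_le w hT hn.1.mem hn.2.1.mem
    have h2 := h.abs_cr_sub_le w hT hn.1.mem hn.1.mem
    obtain ⟨s, t, hs, ht, hst, rfl⟩ := hx
    rw [cr_add_right, cr_smul_right, cr_smul_right]
    obtain rfl : s = 1 - t := by linarith
    nlinarith
  intro d hd
  obtain ⟨T, a, hT, ha, rfl⟩ := d.exists_rep
  change y₀ + K < cr w a at hd
  have hK0 := h.abs_cr_sub_le w hT ha.mem ha.mem
  obtain ⟨hcor, hval⟩ := reg T hT a ha (by linarith)
  obtain ⟨b₀, n₀⟩ := (h.poly T hT).exists_next ha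
  obtain ⟨T₁, hT₁, p₁⟩ := nb T hT a b₀ n₀ hd
  obtain ⟨b₁, n₁⟩ := (h.poly T₁ hT₁).exists_next p₁.2.1
  obtain ⟨T₂, hT₂, p₂⟩ := nb T₁ hT₁ a b₁ n₁ hd
  obtain ⟨b₂, n₂⟩ := (h.poly T₂ hT₂).exists_next p₂.2.1
  obtain ⟨T₃, hT₃, p₃⟩ := nb T₂ hT₂ a b₂ n₂ hd
  obtain ⟨rfl, hall⟩ := h.turn_around hval hT hT₁ hT₂ hT₃ n₀ p₁ n₁ p₂ n₂ p₃
  have o₀ : (dartClass v hT ha).opp = dartClass v hT₁ p₁.1 := h.opp_mk hT hT₁ n₀ p₁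
  have r₀ : (h.hexSystem hw hwv).rot (dartClass v hT ha) = dartClass v hT₁ n₁.1 := by
    change h.next (opp _) = _
    rw [o₀]; exact h.next_mk hT₁ p₁
  have r₁ : (h.hexSystem hw hwv).rot (dartClass v hT₁ n₁.1) = dartClass v hT₂ n₂.1 := by
    change h.next (opp _) = _
    rw [h.opp_mk hT₁ hT₂ n₁ p₂]; exact h.next_mk hT₂ p₂
  have r₂ : (h.hexSystem hw hwv).rot (dartClass v hT₂ n₂.1) = dartClass v hT ha := by
    change h.next (opp _) = _
    rw [h.opp_mk hT₂ hT n₂ p₃]; exact h.next_mk hT p₃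
  have x₀ : (h.hexSystem hw hwv).next (dartClass v hT ha) = dartClass v hT n₀.2.1 :=
    h.next_mk hT n₀
  have x₁ : (h.hexSystem hw hwv).next (dartClass v hT₁ n₁.1) = dartClass v hT₁ n₁.2.1 :=
    h.next_mk hT₁ n₁
  have x₂ : (h.hexSystem hw hwv).next (dartClass v hT₂ n₂.1) = dartClass v hT₂ n₂.2.1 :=
    h.next_mk hT₂ n₂
  have o₀' : (h.hexSystem hw hwv).opp (dartClass v hT ha) = dartClass v hT₁ p₁.1 := o₀
  rw [r₀, r₁, r₂, x₀, x₁, x₂, o₀']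
  refine ⟨rfl, rfl, rfl, ?_⟩
  change cr w b₀ < cr w a ∨ cr w b₁ < cr w a ∨ cr w b₂ < cr w a
  obtain ⟨S, hS, haS, b, hb, hlow⟩ := h.exists_descending hw hcor
  rcases hall S hS haS with rfl | rfl | rfl <;> rcases hb with hb | hb
  · obtain rfl := hb.right_unique n₀; exact Or.inl hlow
  · obtain rfl := hb.left_unique p₃; exact Or.inr (Or.inr hlow)
  · obtain rfl := hb.right_unique n₁; exact Or.inr (Or.inl hlow)
  · obtain rfl := hb.left_unique p₁; exact Or.inl hlow
  · obtain rfl := hb.right_unique n₂; exact Or.inr (Or.inr hlow)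
  · obtain rfl := hb.left_unique p₂; exact Or.inr (Or.inl hlow)

theorem diam_nonneg : 0 ≤ D := by
  obtain ⟨T, hT, hx⟩ := h.cover 0
  simpa using h.diam T hT 0 hx 0 hx

include hw in
theorem sum_wt_nonpos (d : DartClass 𝒯 v) :
    ∑ᶠ e ∈ {e : DartClass 𝒯 v | e.vert = d.vert}, e.wt w ≤ 0 := by
  obtain ⟨T, p, hT, hp, rfl⟩ := d.exists_rep
  rw [h.sum_wt w hT hp]
  exact (h.sum_weight hw hT hp).1

theorem flux_nonneg (b : ℝ) (hgen : ∀ d, (h.hexSystem hw hwv).ht d ≠ b) :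
    0 ≤ (h.hexSystem hw hwv).flux b := by
  have hD := h.diam_nonneg
  obtain ⟨N, hN⟩ := h.exists_band_bound hw hwv ((|w 0| + |w 1|) * D + 1)
  refine (h.hexSystem hw hwv).flux_nonneg (h.isCornerWeight hw hwv) (vert := vert)
    (fun d e hde => ht_eq_of_vert_eq hwv hde) (h.sum_wt_nonpos hw) (mul_nonneg (by positivity) hD)
    ((|w 0| + |w 1|) * D) N (fun c => ?_) (h.regularAbove hw hwv) b hgen
  refine (Set.ncard_le_ncard ?_ (hN c).1).trans (hN c).2
  rintro d ⟨h1, e, he, h2⟩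
  have h3 := (h.hexSystem hw hwv).ht_le e d he
  change ht hwv d < c at h1
  change c < ht hwv e at h2
  change ht hwv e ≤ ht hwv d + (|w 0| + |w 1|) * D at h3
  have h4 : 0 ≤ (|w 0| + |w 1|) * D := mul_nonneg (by positivity) hD
  constructor <;> linarith

/-- Exactly three tiles, all with a corner there, meet at each corner of a tile. -/
theorem corner_regular {T : Set Plane} (hT : T ∈ 𝒯) {p : Plane} (hp : IsCornerOf T p) :
    (∀ T' ∈ 𝒯, p ∈ T' → IsCornerOf T' p) ∧ {T' | T' ∈ 𝒯 ∧ p ∈ T'}.ncard = 3 := by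
  have hv := h.ne_zero
  have hvv := cr_self v
  have hv' := neg_ne_zero.2 hv
  have hvv' : cr (-v) v = 0 := by rw [cr_neg_left, hvv, neg_zero]
  set H := h.hexSystem hv hvv with hH
  set H' := h.hexSystem hv' hvv' with hH'
  have hht : ∀ d, H'.ht d = -H.ht d := by
    intro d
    obtain ⟨T, p, hT, hp, rfl⟩ := d.exists_rep
    exact cr_neg_left v p
  -- Both `v` and `-v` give a nonnegative flux, and the two are opposite.
  have hzero : ∀ b, (∀ d, H.ht d ≠ b) → H.flux b = 0 := by
    intro b hgen
    have h1 := h.flux_nonneg hv hvv b hgen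
    have h2 := h.flux_nonneg hv' hvv' (-b) (fun d hd => hgen d (by
      rw [← neg_inj, ← hd]; exact (hht d).symm))
    have h3 := HexSystem.flux_neg H H' (fun _ => rfl) hht hgen
    rw [← hH] at h1
    rw [← hH', h3] at h2
    omega
  refine (h.sum_weight hv hT hp).2 ?_
  rw [← h.sum_wt v hT hp]
  by_contra hne
  set d := dartClass v hT hp
  -- A nonzero sum at `p` would make the flux drop between a height below `p` and one above it.
  obtain ⟨b₀, -, hb₀, hgen₀⟩ := H.exists_generic (sub_one_lt (H.ht d))
  obtain ⟨b, hb, -, hgen⟩ := H.exists_generic (lt_add_one (H.ht d))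
  have := (H.flux_le_sub (h.isCornerWeight hv hvv) (vert := vert)
    (fun d e hde => ht_eq_of_vert_eq hvv hde) (h.sum_wt_nonpos hv) (hb₀.trans hb).le hgen₀ hgen).2
    d hb₀ hb hne
  rw [hzero b hgen, hzero b₀ hgen₀] at this
  exact lt_irrefl _ this

end IsPeriodicHexTiling

theorem corollary1 (𝒯 : Set (Set Plane)) (htiling : IsTiling 𝒯) (hmono : IsMonohedral 𝒯)
    (hhex : ∀ T ∈ 𝒯, IsConvexPolygon 6 T) (hper : IsPeriodic 𝒯) :
    IsEdgeToEdge 𝒯 ∧ ∀ p : Plane, IsVertex 𝒯 p → valence 𝒯 p = 3 := by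
  obtain ⟨D, r, hD⟩ := htiling.exists_isHexTiling hmono hhex
  obtain ⟨v, hv, hinv⟩ := hper
  have h : IsPeriodicHexTiling 𝒯 D r v := ⟨hD, hv, IsPeriodic.vadd_mem hinv⟩
  constructor
  · intro T hT T' hT' hne
    rcases Set.eq_empty_or_nonempty (T ∩ T') with hemp | hemp
    · exact Or.inl hemp
    rcases h.inter_eq hT hT' hne hemp
        (fun x _ T₀ hT₀ hx T₁ hT₁ hx₁ => (h.corner_regular hT₀ hx).1 T₁ hT₁ hx₁) with
      hp | ⟨a, b, hn, hn', hseg⟩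
    · exact Or.inr (Or.inl hp)
    · refine Or.inr (Or.inr ⟨segment ℝ a b, ⟨a, b, hn.1, hn.2.1, hn.2.2.1, rfl, ?_⟩,
        ⟨b, a, hn'.1, hn'.2.1, hn'.2.2.1, segment_symm ℝ a b, ?_⟩, hseg⟩)
      · rw [← hseg]
        exact fun x hx => ⟨subset_closure hx.1, h.notMem_interior hT' hT hne.symm hx.2⟩
      · rw [← hseg]
        exact fun x hx => ⟨subset_closure hx.2, h.notMem_interior hT hT' hne hx.1⟩
  · rintro p ⟨T, hT, -, -, -, hp, -⟩
    have h1 := (h.corner_regular hT hp).2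
    unfold valence
    rw [← (h.finite_mem p).cast_ncard_eq, h1]
    rfl
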